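/- **Setting.** Let $(M,\omega)$ be a symplectic manifold (smooth, Hausdorff, second countable, of dimension $2n$). For $x\in M$ let $\bar\omega_x$ be the symplectic form on $T_x^*M$ with $\bar\omega_x(\omega_x(u,\cdot),\omega_x(v,\cdot))=\omega_x(u,v)$, and let $\mathcal W_x$ be the completed Weyl algebra of $(T_x^*M\otimes\mathbb C,\bar\omega_x)$, that is, the completion of the tensor algebra of $T_x^*M\otimes\mathbb{C}$ over $\mathbb C[[\hbar]]$ modulo the relations $v\otimes w-w\otimes v=i\hbar\,\bar\omega_x(v,w)$; by symmetrization it consists of the formal power series in $\hbar$ and in the linear coordinates of $T_xM$, with the Moyal product. It is graded by $|\hbar|=2$, $|v|=1$ for $v\in T^*_xM$. These algebras form the Weyl bundle $\mathcal W$ over $M$; for $V\subset M$ open let $\Gamma(V,\mathcal W)$ be the algebra of its smooth sections over $V$, let $\Gamma(\mathcal W)=\Gamma(M,\mathcal W)$, and let $\mathcal Z$ be the centre of $\mathcal W$ (fibrewise $\mathbb C[[\hbar]]$). A superscript $\times$ denotes groups of invertible elements, and $\mathrm{Ad}\,U(f)=UfU^{-1}$. A *Fedosov connection* is a flat connection on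 $\mathcal W$ of the form $$\nabla=[A_{-1},-]+\nabla_0+[A_1,-]+[A_2,-]+\cdots ,\qquad A_{-1}(X)=\tfrac{1}{i\hbar}\,\omega(X,-),$$ where $\nabla_0$ is induced by an affine connection on $M$ that preserves $\omega$, and for $j\ge 1$, $A_j$ is a smooth one-form such that $i\hbar A_j$ takes values in the elements of $\mathcal W$ that are homogeneous of degree $j+2$ and real modulo $\hbar$. Fix a Fedosov connection $\nabla$. For $V\subset M$ open let $\mathrm{Ker}\,\nabla|_V=\{\sigma\in\Gamma(V,\mathcal W):\nabla\sigma=0\}$ and $$\mathcal G_\nabla(V)=\{U\in\Gamma(V,\mathcal W)^\times : \nabla(U^{-1})\,U\in\Omega^1(V,\mathcal Z)\}.$$ Let $\mathrm{Inn}(\Gamma(V,\mathcal W)\,|\,\mathrm{Ker}\,\nabla|_V)$ be the group of those inner automorphisms of the ring $\Gamma(V,\mathcal W)$ that restrict to automorphisms of $\mathrm{Ker}\,\nabla|_V$. **Statement.** 1. For every open $V\subset M$, $\mathcal G_\nabla(V)$ is a subgroup of $\Gamma(V,\mathcal W)^\times$. 2. For every open $V$, $\Gamma(V,\mathcal Z)^\times$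 and $(\mathrm{Ker}\,\nabla|_V)^\times$ are normal subgroups of $\mathcal G_\nabla(V)$. 3. For every open $V$, $U\mapsto\mathrm{Ad}\,U$ induces an isomorphism of groups $\mathcal G_\nabla(V)/\Gamma(V,\mathcal Z)^\times\cong\mathrm{Inn}(\Gamma(V,\mathcal W)\,|\,\mathrm{Ker}\,\nabla|_V)$. 4. $V\mapsto\mathcal G_\nabla(V)$, with restriction of sections, is a sheaf of groups on $M$. 5. If $V\subset M$ is open and the de Rham cohomology $H^1(V)$ (with complex coefficients) vanishes, then $\mathcal G_\nabla(V)=\Gamma(V,\mathcal Z)^\times\cdot(\mathrm{Ker}\,\nabla|_V)^\times$. 6. Let a group $\Gamma$ act on $M$ from the left by symplectomorphisms, and let $A\colon\Gamma^{op}\to\mathrm{Aut}(\mathrm{Ker}\,\nabla)$ be a homomorphism that extends the action, i.e. for every $\gamma\in\Gamma$ there is $U_\gamma\in\Gamma(\mathcal W)^\times$ such that $A_\gamma=\mathrm{Ad}\,U_\gamma\circ\gamma^*$ on $\mathrm{Ker}\,\nabla$. Then for every $\gamma\in\Gamma$ and every such $U_\gamma$, the automorphism $A_\gamma=\mathrm{Ad}\,U_\gamma\circ\gamma^*$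 of $\Gamma(\mathcal W)$ satisfies $A_\gamma(\mathcal G_\nabla(M))\subset\mathcal G_\nabla(M)$. -/

import Mathlib

open scoped Manifold ContDiff Topology Matrix
open Finset.HasAntidiagonal (antidiagonal)

universe u v

noncomputable section

namespace Fedosov

/-- Formal power series in the coordinate functions `y 1, …, y d` on `ℝ ^ d`. -/
abbrev FormalFun (d : ℕ) : Type := MvPowerSeries (Fin d) ℂ

/-- The partial derivative along the `i`-th coordinate. -/
abbrev pd {d : ℕ} (i : Fin d) : Derivation ℂ (FormalFun d) (FormalFun d) :=
  MvPowerSeries.pderiv ℂ i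

/-- The `r`-th bidifferential operator
`∑ P i₁ j₁ ⋯ P i_r j_r (∂ i₁ ⋯ ∂ i_r a) (∂ j₁ ⋯ ∂ j_r b)` of a constant matrix `P`. -/
def bidiff {d : ℕ} (P : Matrix (Fin d) (Fin d) ℂ) : ℕ → FormalFun d → FormalFun d → FormalFun d
  | 0, a, b => a * b
  | r + 1, a, b => ∑ i, ∑ j, P i j • bidiff P r (pd i a) (pd j b)

section Bidiff

variable {d : ℕ} (P : Matrix (Fin d) (Fin d) ℂ)

theorem pd_comm (i j : Fin d) (a : FormalFun d) : pd i (pd j a) = pd j (pd i a) := by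
  ext n
  simp only [pd, MvPowerSeries.coeff_pderiv]
  rcases eq_or_ne i j with rfl | h
  · rfl
  · simp [h, h.symm, add_right_comm, mul_right_comm]

theorem bidiff_add_left (r : ℕ) (a a' b : FormalFun d) :
    bidiff P r (a + a') b = bidiff P r a b + bidiff P r a' b := by
  induction r generalizing a a' b with
  | zero => simp [bidiff, add_mul]
  | succ r ih => simp [bidiff, ih, Finset.sum_add_distrib]

theorem bidiff_add_right (r : ℕ) (a b b' : FormalFun d) :
    bidiff P r a (b + b') = bidiff P r a b + bidiff P r a b' := by
  induction r generalizing a b b' with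
  | zero => simp [bidiff, mul_add]
  | succ r ih => simp [bidiff, ih, Finset.sum_add_distrib]

theorem bidiff_smul_left (r : ℕ) (c : ℂ) (a b : FormalFun d) :
    bidiff P r (c • a) b = c • bidiff P r a b := by
  induction r generalizing a b with
  | zero => simp [bidiff]
  | succ r ih => simp [bidiff, ih, Finset.smul_sum, smul_comm c]

theorem bidiff_smul_right (r : ℕ) (c : ℂ) (a b : FormalFun d) :
    bidiff P r a (c • b) = c • bidiff P r a b := by
  induction r generalizing a b with
  | zero => simp [bidiff]
  | succ r ih => simp [bidiff, ih, Finset.smul_sum, smul_comm c]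

/-- `bidiff` as a bilinear map. -/
def bidiffL (r : ℕ) : FormalFun d →ₗ[ℂ] FormalFun d →ₗ[ℂ] FormalFun d :=
  LinearMap.mk₂ ℂ (bidiff P r) (bidiff_add_left P r) (bidiff_smul_left P r)
    (bidiff_add_right P r) (bidiff_smul_right P r)

theorem bidiffL_apply (r : ℕ) (a b : FormalFun d) : bidiffL P r a b = bidiff P r a b := rfl

theorem bidiff_succ (r : ℕ) (a b : FormalFun d) :
    bidiff P (r + 1) a b = ∑ i, ∑ j, P i j • bidiff P r (pd i a) (pd j b) := rfl

theorem pd_bidiff (k : Fin d) (r : ℕ) (a b : FormalFun d) :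
    pd k (bidiff P r a b) = bidiff P r (pd k a) b + bidiff P r a (pd k b) := by
  induction r generalizing a b with
  | zero => simp [bidiff, Derivation.leibniz, mul_comm, add_comm]
  | succ r ih =>
    simp only [bidiff, map_sum, Derivation.map_smul, ih, smul_add, Finset.sum_add_distrib,
      pd_comm k]

/-- The tridifferential operators obtained by iterating both bracketings. -/
def tridiff : ℕ → FormalFun d → FormalFun d → FormalFun d → FormalFun d
  | 0, a, b, c => a * b * c
  | r + 1, a, b, c => ∑ i, ∑ j, P i j • (tridiff r (pd i a) (pd j b) c
      + tridiff r (pd i a) b (pd j c) + tridiff r a (pd i b) (pd j c))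

theorem bidiff_sum_smul_left (r : ℕ) (f : Fin d → Fin d → FormalFun d) (c : FormalFun d) :
    bidiff P r (∑ i, ∑ j, P i j • f i j) c = ∑ i, ∑ j, P i j • bidiff P r (f i j) c := by
  simp only [← bidiffL_apply, map_sum, LinearMap.sum_apply, map_smul, LinearMap.smul_apply]

theorem bidiff_sum_smul_right (r : ℕ) (f : Fin d → Fin d → FormalFun d) (c : FormalFun d) :
    bidiff P r c (∑ i, ∑ j, P i j • f i j) = ∑ i, ∑ j, P i j • bidiff P r c (f i j) := by
  simp only [← bidiffL_apply, map_sum, map_smul]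

theorem sum_bidiff_left (N : ℕ) (a b c : FormalFun d) :
    ∑ p ∈ antidiagonal N, N.choose p.1 • bidiff P p.1 (bidiff P p.2 a b) c
      = tridiff P N a b c := by
  induction N generalizing a b c with
  | zero => simp [bidiff, tridiff]
  | succ N ih =>
    rw [Finset.sum_antidiagonal_choose_succ_nsmul
      (fun r s => bidiff P r (bidiff P s a b) c)]
    simp only [bidiff_succ, bidiff_sum_smul_left, pd_bidiff, bidiff_add_left, tridiff, ← ih]
    simp only [Finset.smul_sum, smul_add, Finset.sum_add_distrib]
    simp only [Finset.sum_comm (s := antidiagonal N)]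
    have h : ∀ p ∈ antidiagonal N, N.choose p.2 = N.choose p.1 := fun p hp => by
      rw [Finset.HasAntidiagonal.mem_antidiagonal] at hp
      exact Nat.choose_symm_of_eq_add hp.symm |>.symm
    simp only [smul_comm (_ : ℕ) (_ : ℂ)]
    rw [add_assoc]
    congr 1
    congr 1 <;>
    · refine Finset.sum_congr rfl fun i _ => Finset.sum_congr rfl fun j _ =>
        Finset.sum_congr rfl fun p hp => by rw [h p hp]

theorem sum_bidiff_right (N : ℕ) (a b c : FormalFun d) :
    ∑ p ∈ antidiagonal N, N.choose p.1 • bidiff P p.1 a (bidiff P p.2 b c)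
      = tridiff P N a b c := by
  induction N generalizing a b c with
  | zero => simp [bidiff, tridiff, mul_assoc]
  | succ N ih =>
    rw [Finset.sum_antidiagonal_choose_succ_nsmul
      (fun r s => bidiff P r a (bidiff P s b c))]
    simp only [bidiff_succ, bidiff_sum_smul_right, pd_bidiff, bidiff_add_right, tridiff, ← ih]
    simp only [Finset.smul_sum, smul_add, Finset.sum_add_distrib]
    simp only [Finset.sum_comm (s := antidiagonal N)]
    have h : ∀ p ∈ antidiagonal N, N.choose p.2 = N.choose p.1 := fun p hp => by
      rw [Finset.HasAntidiagonal.mem_antidiagonal] at hp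
      exact Nat.choose_symm_of_eq_add hp.symm |>.symm
    simp only [smul_comm (_ : ℕ) (_ : ℂ)]
    rw [add_comm]
    congr 1
    congr 1 <;>
    · refine Finset.sum_congr rfl fun i _ => Finset.sum_congr rfl fun j _ =>
        Finset.sum_congr rfl fun p hp => by rw [h p hp]

/-- The coefficient of `ħ ^ r` in the Moyal product
`a ⋆ b = ∑ r, (1 / r!) (i ħ / 2) ^ r P(∂, ∂) ^ r (a, b)`, for which
`y k ⋆ y l - y l ⋆ y k = i ħ P k l` when `P` is antisymmetric. -/
def moyal (r : ℕ) (a b : FormalFun d) : FormalFun d :=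
  ((Complex.I / 2) ^ r / (r.factorial : ℂ)) • bidiff P r a b

theorem moyal_assoc (N : ℕ) (a b c : FormalFun d) :
    ∑ p ∈ antidiagonal N, moyal P p.1 (moyal P p.2 a b) c
      = ∑ p ∈ antidiagonal N, moyal P p.1 a (moyal P p.2 b c) := by
  have hc : ∀ p ∈ antidiagonal N, ((Complex.I / 2) ^ p.1 / (p.1.factorial : ℂ)) *
      ((Complex.I / 2) ^ p.2 / (p.2.factorial : ℂ))
      = ((Complex.I / 2) ^ N / (N.factorial : ℂ)) * (N.choose p.1 : ℂ) := by
    intro p hp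
    rw [Finset.HasAntidiagonal.mem_antidiagonal] at hp
    have h := Nat.add_choose_mul_factorial_mul_factorial p.1 p.2
    rw [hp, Nat.choose_symm_of_eq_add (hp.symm.trans (add_comm _ _))] at h
    have h' : (N.choose p.1 : ℂ) * p.1.factorial * p.2.factorial = N.factorial := by
      exact_mod_cast h
    have h1 : (p.1.factorial : ℂ) ≠ 0 := by exact_mod_cast p.1.factorial_ne_zero
    have h2 : (p.2.factorial : ℂ) ≠ 0 := by exact_mod_cast p.2.factorial_ne_zero
    have h3 : (N.factorial : ℂ) ≠ 0 := by exact_mod_cast N.factorial_ne_zero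
    rw [← hp, pow_add, hp, div_mul_div_comm, div_mul_eq_mul_div, div_eq_div_iff
      (mul_ne_zero h1 h2) h3, ← h']
    ring
  have e1 : ∑ p ∈ antidiagonal N, moyal P p.1 (moyal P p.2 a b) c
      = ((Complex.I / 2) ^ N / (N.factorial : ℂ)) • tridiff P N a b c := by
    rw [← sum_bidiff_left, Finset.smul_sum]
    refine Finset.sum_congr rfl fun p hp => ?_
    rw [moyal, moyal, bidiff_smul_left, smul_smul, hc p hp, mul_smul, Nat.cast_smul_eq_nsmul]
  have e2 : ∑ p ∈ antidiagonal N, moyal P p.1 a (moyal P p.2 b c)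
      = ((Complex.I / 2) ^ N / (N.factorial : ℂ)) • tridiff P N a b c := by
    rw [← sum_bidiff_right, Finset.smul_sum]
    refine Finset.sum_congr rfl fun p hp => ?_
    rw [moyal, moyal, bidiff_smul_right, smul_smul, hc p hp, mul_smul, Nat.cast_smul_eq_nsmul]
  rw [e1, e2]




theorem moyal_sum_left {ι : Type*} (s : Finset ι) (r : ℕ) (f : ι → FormalFun d)
    (b : FormalFun d) : moyal P r (∑ i ∈ s, f i) b = ∑ i ∈ s, moyal P r (f i) b := by
  simp only [moyal, ← bidiffL_apply, map_sum, LinearMap.sum_apply, Finset.smul_sum]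

theorem moyal_sum_right {ι : Type*} (s : Finset ι) (r : ℕ) (f : ι → FormalFun d)
    (b : FormalFun d) : moyal P r b (∑ i ∈ s, f i) = ∑ i ∈ s, moyal P r b (f i) := by
  simp only [moyal, ← bidiffL_apply, map_sum, Finset.smul_sum]

theorem bidiff_succ_one_left (r : ℕ) (a : FormalFun d) : bidiff P (r + 1) 1 a = 0 := by
  simp only [bidiff_succ, Derivation.map_one_eq_zero, ← bidiffL_apply, map_zero,
    LinearMap.zero_apply, smul_zero, Finset.sum_const_zero]

theorem bidiff_succ_one_right (r : ℕ) (a : FormalFun d) : bidiff P (r + 1) a 1 = 0 := by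
  simp only [bidiff_succ, Derivation.map_one_eq_zero, ← bidiffL_apply, map_zero,
    smul_zero, Finset.sum_const_zero]

theorem moyal_zero (a b : FormalFun d) : moyal P 0 a b = a * b := by
  simp [moyal, bidiff]

end Bidiff

/-- The completed Weyl algebra of a `d`-dimensional vector space `E` whose dual carries the bilinear
form with matrix `P`: formal power series in `ħ` (the `ℕ`-argument is the exponent of `ħ`) and in
the linear coordinates `y 1, …, y d` of `E`, with the Moyal product. By symmetrization this is
the completion of the tensor algebra of `E^* ⊗ ℂ` over `ℂ⟦ħ⟧` modulo the relations
`v ⊗ w - w ⊗ v = i ħ P(v, w)`. -/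
def Weyl {d : ℕ} (_P : Matrix (Fin d) (Fin d) ℂ) : Type := ℕ → FormalFun d

namespace Weyl

variable {d : ℕ} {P : Matrix (Fin d) (Fin d) ℂ}

instance : AddCommGroup (Weyl P) := inferInstanceAs (AddCommGroup (ℕ → FormalFun d))

instance : Module ℝ (Weyl P) := inferInstanceAs (Module ℝ (ℕ → FormalFun d))

instance : Mul (Weyl P) := ⟨fun a b N => ∑ p ∈ antidiagonal N, ∑ q ∈ antidiagonal p.2,
  moyal P p.1 (a q.1) (b q.2)⟩

instance : One (Weyl P) := ⟨Pi.single 0 1⟩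

theorem mul_apply (a b : Weyl P) (N : ℕ) : (a * b) N =
    ∑ p ∈ antidiagonal N, ∑ q ∈ antidiagonal p.2, moyal P p.1 (a q.1) (b q.2) := rfl

theorem one_apply (N : ℕ) : (1 : Weyl P) N = if N = 0 then 1 else 0 :=
  Pi.single_apply 0 1 N

theorem add_apply (a b : Weyl P) (N : ℕ) : (a + b) N = a N + b N := rfl

theorem sub_apply (a b : Weyl P) (N : ℕ) : (a - b) N = a N - b N := rfl

theorem zero_apply (N : ℕ) : (0 : Weyl P) N = 0 := rfl

@[ext] theorem ext' {a b : Weyl P} (h : ∀ N, a N = b N) : a = b := funext h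

protected theorem mul_assoc (a b c : Weyl P) : a * b * c = a * (b * c) := by
  ext1 N
  simp only [mul_apply, moyal_sum_left, moyal_sum_right]
  have e1 : ∑ p ∈ antidiagonal N, ∑ q ∈ antidiagonal p.2, ∑ p' ∈ antidiagonal q.1,
        ∑ q' ∈ antidiagonal p'.2, moyal P p.1 (moyal P p'.1 (a q'.1) (b q'.2)) (c q.2)
      = ∑ x ∈ antidiagonal N, ∑ y ∈ antidiagonal x.2, ∑ z ∈ antidiagonal y.2,
        ∑ w ∈ antidiagonal x.1, moyal P w.1 (moyal P w.2 (a y.1) (b z.1)) (c z.2) := by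
    simp only [Finset.sum_sigma']
    refine Finset.sum_nbij'
      (fun s => ⟨(s.1.1 + s.2.2.1.1, s.2.2.2.1 + s.2.2.2.2 + s.2.1.2),
        (s.2.2.2.1, s.2.2.2.2 + s.2.1.2), (s.2.2.2.2, s.2.1.2),
        (s.1.1, s.2.2.1.1)⟩)
      (fun t => ⟨(t.2.2.2.1, t.2.2.2.2 + t.2.1.1 + t.2.2.1.1 + t.2.2.1.2),
        (t.2.2.2.2 + t.2.1.1 + t.2.2.1.1, t.2.2.1.2), (t.2.2.2.2, t.2.1.1 + t.2.2.1.1),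
        (t.2.1.1, t.2.2.1.1)⟩) ?_ ?_ ?_ ?_ ?_
    all_goals
      rintro ⟨⟨a1, a2⟩, ⟨b1, b2⟩, ⟨c1, c2⟩, ⟨d1, d2⟩⟩ h
      simp only [Finset.mem_sigma, Finset.HasAntidiagonal.mem_antidiagonal] at h ⊢
    · obtain ⟨h1, h2, h3, h4⟩ := h
      refine ⟨?_, ?_, ?_, ?_⟩ <;> (try dsimp only at *) <;> omega
    · obtain ⟨h1, h2, h3, h4⟩ := h
      refine ⟨?_, ?_, ?_, ?_⟩ <;> (try dsimp only at *) <;> omega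
    · obtain ⟨h1, h2, h3, h4⟩ := h
      subst h4 h3 h2
      simp [add_assoc]
    · obtain ⟨h1, h2, h3, h4⟩ := h
      subst h4 h3 h2
      simp [add_assoc]
  have e2 : ∑ p ∈ antidiagonal N, ∑ q ∈ antidiagonal p.2, ∑ p' ∈ antidiagonal q.2,
        ∑ q' ∈ antidiagonal p'.2, moyal P p.1 (a q.1) (moyal P p'.1 (b q'.1) (c q'.2))
      = ∑ x ∈ antidiagonal N, ∑ y ∈ antidiagonal x.2, ∑ z ∈ antidiagonal y.2,
        ∑ w ∈ antidiagonal x.1, moyal P w.1 (a y.1) (moyal P w.2 (b z.1) (c z.2)) := by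
    simp only [Finset.sum_sigma']
    refine Finset.sum_nbij'
      (fun s => ⟨(s.1.1 + s.2.2.1.1, s.2.1.1 + s.2.2.2.1 + s.2.2.2.2), (s.2.1.1, s.2.2.2.1 + s.2.2.2.2), (s.2.2.2.1, s.2.2.2.2),
        (s.1.1, s.2.2.1.1)⟩)
      (fun t => ⟨(t.2.2.2.1, t.2.1.1 + t.2.2.2.2 + t.2.2.1.1 + t.2.2.1.2),
        (t.2.1.1, t.2.2.2.2 + t.2.2.1.1 + t.2.2.1.2), (t.2.2.2.2, t.2.2.1.1 + t.2.2.1.2),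
        (t.2.2.1.1, t.2.2.1.2)⟩) ?_ ?_ ?_ ?_ ?_
    all_goals
      rintro ⟨⟨a1, a2⟩, ⟨b1, b2⟩, ⟨c1, c2⟩, ⟨d1, d2⟩⟩ h
      simp only [Finset.mem_sigma, Finset.HasAntidiagonal.mem_antidiagonal] at h ⊢
    · obtain ⟨h1, h2, h3, h4⟩ := h
      refine ⟨?_, ?_, ?_, ?_⟩ <;> (try dsimp only at *) <;> omega
    · obtain ⟨h1, h2, h3, h4⟩ := h
      refine ⟨?_, ?_, ?_, ?_⟩ <;> (try dsimp only at *) <;> omega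
    · obtain ⟨h1, h2, h3, h4⟩ := h
      subst h4 h3 h2
      simp [add_assoc]
    · obtain ⟨h1, h2, h3, h4⟩ := h
      subst h4 h3 h2
      simp [add_assoc]
  rw [e1, e2]
  simp only [moyal_assoc]

protected theorem one_mul (a : Weyl P) : 1 * a = a := by
  ext1 N
  rw [mul_apply, Finset.sum_eq_single (0, N), Finset.sum_eq_single (0, N)]
  · simp [moyal_zero, one_apply]
  · rintro ⟨k, l⟩ h hne
    have hk : k ≠ 0 := by
      rintro rfl
      simp_all [Finset.HasAntidiagonal.mem_antidiagonal]
    simp [one_apply, hk, moyal_zero]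
  · simp
  · rintro ⟨r, s⟩ h hne
    obtain ⟨r, rfl⟩ : ∃ t, r = t + 1 := by
      refine Nat.exists_eq_succ_of_ne_zero ?_
      rintro rfl
      simp_all [Finset.HasAntidiagonal.mem_antidiagonal]
    refine Finset.sum_eq_zero fun q _ => ?_
    rw [one_apply]
    split_ifs
    · rw [moyal, bidiff_succ_one_left, smul_zero]
    · rw [moyal, ← bidiffL_apply, map_zero, LinearMap.zero_apply, smul_zero]
  · simp

protected theorem mul_one (a : Weyl P) : a * 1 = a := by
  ext1 N
  rw [mul_apply, Finset.sum_eq_single (0, N), Finset.sum_eq_single (N, 0)]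
  · simp [moyal_zero, one_apply]
  · rintro ⟨k, l⟩ h hne
    have hk : l ≠ 0 := by
      rintro rfl
      simp_all [Finset.HasAntidiagonal.mem_antidiagonal]
    simp [one_apply, hk, moyal_zero]
  · simp
  · rintro ⟨r, s⟩ h hne
    obtain ⟨r, rfl⟩ : ∃ t, r = t + 1 := by
      refine Nat.exists_eq_succ_of_ne_zero ?_
      rintro rfl
      simp_all [Finset.HasAntidiagonal.mem_antidiagonal]
    refine Finset.sum_eq_zero fun q _ => ?_
    rw [one_apply]
    split_ifs
    · rw [moyal, bidiff_succ_one_right, smul_zero]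
    · rw [moyal, ← bidiffL_apply, map_zero, smul_zero]
  · simp

theorem left_distrib' (a b c : Weyl P) : a * (b + c) = a * b + a * c := by
  ext1 N
  simp [mul_apply, add_apply, moyal, bidiff_add_right, Finset.sum_add_distrib]

theorem right_distrib' (a b c : Weyl P) : (a + b) * c = a * c + b * c := by
  ext1 N
  simp [mul_apply, add_apply, moyal, bidiff_add_left, Finset.sum_add_distrib]

instance : Ring (Weyl P) :=
  { (inferInstance : AddCommGroup (Weyl P)) with
    mul_assoc := Weyl.mul_assoc
    one_mul := Weyl.one_mul
    mul_one := Weyl.mul_one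
    left_distrib := left_distrib'
    right_distrib := right_distrib'
    zero_mul := fun a => by
      have h := right_distrib' 0 0 a
      rw [add_zero] at h
      simpa using h
    mul_zero := fun a => by
      have h := left_distrib' a 0 0
      rw [add_zero] at h
      simpa using h }

/-- The operation `[a, b] / (i ħ)`; the commutator has no term of order `ħ ^ 0`. -/
def bracket (a b : Weyl P) : Weyl P := fun N => Complex.I⁻¹ • (a * b - b * a) (N + 1)

/-- The linear function `y ↦ ∑ j, c j * y j`. -/
def lin (c : Fin d → ℂ) : Weyl P := Pi.single 0 (∑ j, c j • MvPowerSeries.X j)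

end Weyl


section LinSubst

variable {d : ℕ}

/-- The linear change of variables `y i ↦ ∑ j, A i j * y j`, that is, `a ↦ a ∘ A`. -/
def linSubst (A : Matrix (Fin d) (Fin d) ℂ) (a : FormalFun d) : FormalFun d :=
  MvPowerSeries.subst (fun i => (∑ j, A i j • MvPowerSeries.X j : FormalFun d)) a

variable (A B : Matrix (Fin d) (Fin d) ℂ)

theorem hasSubst_lin :
    MvPowerSeries.HasSubst (fun i => (∑ j, A i j • MvPowerSeries.X j : FormalFun d)) :=
  MvPowerSeries.hasSubst_of_constantCoeff_zero fun i => by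
    simp [map_sum, ← MvPowerSeries.coeff_zero_eq_constantCoeff_apply,
      MvPowerSeries.coeff_zero_X]

theorem linSubst_add (a b : FormalFun d) : linSubst A (a + b) = linSubst A a + linSubst A b :=
  MvPowerSeries.subst_add (hasSubst_lin A) a b

theorem linSubst_mul (a b : FormalFun d) : linSubst A (a * b) = linSubst A a * linSubst A b :=
  MvPowerSeries.subst_mul (hasSubst_lin A) a b

theorem linSubst_smul (c : ℂ) (a : FormalFun d) : linSubst A (c • a) = c • linSubst A a :=
  MvPowerSeries.subst_smul (hasSubst_lin A) c a

/-- `linSubst` as a linear map. -/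
def linSubstL : FormalFun d →ₗ[ℂ] FormalFun d where
  toFun := linSubst A
  map_add' := linSubst_add A
  map_smul' := linSubst_smul A

theorem linSubstL_apply (a : FormalFun d) : linSubstL A a = linSubst A a := rfl

theorem linSubst_one : linSubst A (1 : FormalFun d) = 1 := by
  rw [linSubst, ← MvPowerSeries.coe_substAlgHom (hasSubst_lin A), map_one]

theorem linSubst_zero : linSubst A (0 : FormalFun d) = 0 := map_zero (linSubstL A)

theorem linSubst_X (i : Fin d) :
    linSubst A (MvPowerSeries.X i) = ∑ j, A i j • MvPowerSeries.X j :=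
  MvPowerSeries.subst_X (hasSubst_lin A) i

theorem linSubst_comp (a : FormalFun d) : linSubst A (linSubst B a) = linSubst (B * A) a := by
  rw [linSubst, linSubst, MvPowerSeries.subst_comp_subst_apply (hasSubst_lin B) (hasSubst_lin A),
    linSubst]
  congr 1
  funext i
  rw [← linSubst, ← linSubstL_apply, map_sum]
  simp only [map_smul, linSubstL_apply, linSubst_X, Matrix.mul_apply, Finset.smul_sum,
    Finset.sum_smul, smul_smul]
  rw [Finset.sum_comm]

theorem linSubst_id (a : FormalFun d) : linSubst (1 : Matrix (Fin d) (Fin d) ℂ) a = a := by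
  have : (fun i => (∑ j, (1 : Matrix (Fin d) (Fin d) ℂ) i j • MvPowerSeries.X j : FormalFun d))
      = MvPowerSeries.X := by
    funext i
    simp [Matrix.one_apply]
  rw [linSubst, this, MvPowerSeries.subst_self, id]

/-- The coefficients of `linSubst`. -/
def linCoeff (m e : Fin d →₀ ℕ) : ℂ :=
  MvPolynomial.coeff e (m.prod fun i k => (∑ j, A i j • MvPolynomial.X j : MvPolynomial _ ℂ) ^ k)

theorem coeff_linSubst (a : FormalFun d) (e : Fin d →₀ ℕ) :
    MvPowerSeries.coeff e (linSubst A a)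
      = ∑ m ∈ Finset.finsuppAntidiag Finset.univ e.degree,
        MvPowerSeries.coeff m a * linCoeff A m e := by
  have hco : ∀ m : Fin d →₀ ℕ, MvPowerSeries.coeff e
      (m.prod fun i k => (∑ j, A i j • MvPowerSeries.X j : FormalFun d) ^ k) = linCoeff A m e := by
    intro m
    rw [linCoeff, ← MvPolynomial.coeff_coe]
    congr 1
    simp only [Finsupp.prod, ← MvPolynomial.coeToMvPowerSeries.ringHom_apply, map_prod, map_pow,
      map_sum]
    simp [MvPolynomial.smul_eq_C_mul, MvPowerSeries.smul_eq_C_mul]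
  rw [linSubst, MvPowerSeries.coeff_subst (hasSubst_lin A), finsum_eq_sum_of_support_subset]
  · refine Finset.sum_congr rfl fun m _ => ?_
    rw [hco, smul_eq_mul]
  · intro m hm
    rw [Function.mem_support, hco] at hm
    have h2 : linCoeff A m e ≠ 0 := fun h => hm (by rw [h, smul_zero])
    have hh : (m.prod fun i k =>
        (∑ j, A i j • MvPolynomial.X j : MvPolynomial _ ℂ) ^ k).IsHomogeneous m.degree := by
      rw [Finsupp.degree_apply]
      refine MvPolynomial.IsHomogeneous.prod _ _ _ fun i _ => ?_
      have h1 : (∑ j, A i j • MvPolynomial.X j : MvPolynomial (Fin d) ℂ).IsHomogeneous 1 := by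
        refine MvPolynomial.IsHomogeneous.sum _ _ _ fun j _ => ?_
        rw [MvPolynomial.smul_eq_C_mul]
        exact MvPolynomial.isHomogeneous_C_mul_X _ _
      simpa using h1.pow (m i)
    have hd : e.degree = m.degree := by
      by_contra hne
      exact h2 (hh.coeff_eq_zero hne)
    simp only [Finset.mem_coe, Finset.mem_finsuppAntidiag, Finset.subset_univ, and_true]
    rw [hd, Finsupp.degree_eq_sum]

theorem pd_linSubst_poly (k : Fin d) (p : MvPolynomial (Fin d) ℂ) :
    pd k (linSubst A (p : FormalFun d)) = ∑ i, A i k • linSubst A (pd i (p : FormalFun d)) := by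
  induction p using MvPolynomial.induction_on with
  | C c =>
    rw [MvPolynomial.coe_C]
    have : (MvPowerSeries.C c : FormalFun d) = c • 1 := by
      rw [MvPowerSeries.smul_eq_C_mul, mul_one]
    simp [this, linSubst_smul, linSubst_one, linSubst_zero]
  | add p q hp hq =>
    simp only [MvPolynomial.coe_add, linSubst_add, map_add, hp, hq, smul_add,
      Finset.sum_add_distrib]
  | mul_X p j hp =>
    simp only [MvPolynomial.coe_mul, MvPolynomial.coe_X, linSubst_mul, Derivation.leibniz, hp,
      linSubst_add, smul_add, Finset.sum_add_distrib, linSubst_X, map_sum, Derivation.map_smul,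
      smul_eq_mul, MvPowerSeries.pderiv_X, Pi.single_apply]
    simp [Finset.mul_sum, Finset.sum_mul, linSubst_zero, linSubst_one, apply_ite (linSubst A)]

theorem coeff_linSubst_congr {a b : FormalFun d} {e : Fin d →₀ ℕ}
    (h : ∀ m : Fin d →₀ ℕ, m.degree = e.degree →
      MvPowerSeries.coeff m a = MvPowerSeries.coeff m b) :
    MvPowerSeries.coeff e (linSubst A a) = MvPowerSeries.coeff e (linSubst A b) := by
  rw [coeff_linSubst, coeff_linSubst]
  refine Finset.sum_congr rfl fun m hm => ?_
  rw [h m]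
  simp only [Finset.mem_finsuppAntidiag, Finset.subset_univ, and_true] at hm
  rw [← hm, Finsupp.degree_eq_sum]

theorem pd_linSubst (k : Fin d) (a : FormalFun d) :
    pd k (linSubst A a) = ∑ i, A i k • linSubst A (pd i a) := by
  ext e
  have hp : ∀ m : Fin d →₀ ℕ, m.degree = e.degree + 1 → MvPowerSeries.coeff m a =
      MvPowerSeries.coeff m (MvPowerSeries.truncTotal (e.degree + 2) a : FormalFun d) := by
    intro m hm
    rw [MvPolynomial.coeff_coe, MvPowerSeries.coeff_truncTotal _ (by omega)]
  have h := congrArg (MvPowerSeries.coeff e)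
    (pd_linSubst_poly A k (MvPowerSeries.truncTotal (e.degree + 2) a))
  rw [MvPowerSeries.coeff_pderiv, ← coeff_linSubst_congr A (e := e + Finsupp.single k 1)
    (fun m hm => hp m (by simpa using hm)), ← MvPowerSeries.coeff_pderiv] at h
  rw [h, map_sum, map_sum]
  refine Finset.sum_congr rfl fun i _ => ?_
  rw [map_smul, map_smul]
  congr 1
  refine coeff_linSubst_congr A fun m hm => ?_
  rw [MvPowerSeries.coeff_pderiv, MvPowerSeries.coeff_pderiv, hp]
  simpa using hm

variable {A} {P P' : Matrix (Fin d) (Fin d) ℂ}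

theorem linSubst_bidiff (h : P = A * P' * Aᵀ) (r : ℕ) (a b : FormalFun d) :
    linSubst A (bidiff P r a b) = bidiff P' r (linSubst A a) (linSubst A b) := by
  induction r generalizing a b with
  | zero => exact linSubst_mul A a b
  | succ r ih =>
    simp only [bidiff_succ, ← linSubstL_apply, map_sum, map_smul]
    simp only [linSubstL_apply, ih, pd_linSubst]
    simp only [← bidiffL_apply, map_sum, map_smul, LinearMap.sum_apply, LinearMap.smul_apply,
      Finset.smul_sum, smul_smul]
    have e : ∀ k l : Fin d, P k l = ∑ i, ∑ j, A k i * P' i j * A l j := by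
      intro k l
      rw [h, Matrix.mul_apply, Finset.sum_comm]
      simp only [Matrix.mul_apply, Finset.sum_mul, Matrix.transpose_apply]
    simp only [e, Finset.sum_smul]
    calc _ = ∑ k, ∑ i, ∑ l, ∑ j, (A k i * P' i j * A l j) •
          bidiffL P' r (linSubst A (pd k a)) (linSubst A (pd l b)) :=
          Finset.sum_congr rfl fun k _ => Finset.sum_comm
      _ = ∑ i, ∑ k, ∑ l, ∑ j, (A k i * P' i j * A l j) •
          bidiffL P' r (linSubst A (pd k a)) (linSubst A (pd l b)) := Finset.sum_comm
      _ = ∑ i, ∑ k, ∑ j, ∑ l, (A k i * P' i j * A l j) •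
          bidiffL P' r (linSubst A (pd k a)) (linSubst A (pd l b)) :=
          Finset.sum_congr rfl fun i _ => Finset.sum_congr rfl fun k _ => Finset.sum_comm
      _ = ∑ i, ∑ j, ∑ k, ∑ l, (A k i * P' i j * A l j) •
          bidiffL P' r (linSubst A (pd k a)) (linSubst A (pd l b)) :=
          Finset.sum_congr rfl fun i _ => Finset.sum_comm
      _ = _ := ?_
    refine Finset.sum_congr rfl fun i _ => Finset.sum_congr rfl fun j _ => ?_
    rw [Finset.sum_comm]
    refine Finset.sum_congr rfl fun l _ => Finset.sum_congr rfl fun k _ => ?_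
    congr 1
    ring

theorem linSubst_moyal (h : P = A * P' * Aᵀ) (r : ℕ) (a b : FormalFun d) :
    linSubst A (moyal P r a b) = moyal P' r (linSubst A a) (linSubst A b) := by
  rw [moyal, linSubst_smul, linSubst_bidiff h, moyal]

end LinSubst

namespace Weyl

variable {d : ℕ} {P P' : Matrix (Fin d) (Fin d) ℂ}

/-- The linear change of variables, in each order of `ħ`. -/
def subst (A : Matrix (Fin d) (Fin d) ℂ) (a : Weyl P) : Weyl P' := fun N => linSubst A (a N)

theorem subst_mul {A : Matrix (Fin d) (Fin d) ℂ} (h : P = A * P' * Aᵀ) (a b : Weyl P) :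
    (subst A (a * b) : Weyl P') = subst A a * subst A b := by
  ext1 N
  simp only [subst, mul_apply, ← linSubstL_apply, map_sum]
  simp only [linSubstL_apply, linSubst_moyal h]

theorem subst_one (A : Matrix (Fin d) (Fin d) ℂ) : (subst A (1 : Weyl P) : Weyl P') = 1 := by
  ext1 N
  simp only [subst, one_apply]
  split_ifs
  · exact linSubst_one A
  · exact linSubst_zero A

theorem subst_add (A : Matrix (Fin d) (Fin d) ℂ) (a b : Weyl P) :
    (subst A (a + b) : Weyl P') = subst A a + subst A b := by
  ext1 N
  exact linSubst_add A _ _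

theorem subst_comp {P'' : Matrix (Fin d) (Fin d) ℂ} (A B : Matrix (Fin d) (Fin d) ℂ)
    (a : Weyl P) : (subst A (subst B a : Weyl P') : Weyl P'') = subst (B * A) a := by
  ext1 N
  exact linSubst_comp A B _

theorem subst_id (a : Weyl P) : (subst (1 : Matrix (Fin d) (Fin d) ℂ) a : Weyl P) = a := by
  ext1 N
  exact linSubst_id _

end Weyl


/-- The model space `ℝ ^ d`. -/
abbrev Eu (d : ℕ) : Type := EuclideanSpace ℝ (Fin d)

/-- The standard basis vectors of `ℝ ^ d`. -/
def basisVec {d : ℕ} (i : Fin d) : Eu d := EuclideanSpace.single i 1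

/-- The standard coordinates, as complex numbers. -/
def coord {d : ℕ} (v : Eu d) (i : Fin d) : ℂ := ((v i : ℝ) : ℂ)

/-- The (complexified) matrix of a linear map of `ℝ ^ d`. -/
def matrixOf {d : ℕ} (L : Eu d →L[ℝ] Eu d) : Matrix (Fin d) (Fin d) ℂ :=
  Matrix.of fun i j => coord (L (basisVec j)) i

section Manifold

variable {d : ℕ} {M : Type u} [TopologicalSpace M] [ChartedSpace (Eu d) M]

/-- The derivative of a vector-valued function at `x` along the tangent vector `v`. -/
def dirDeriv {F : Type*} [NormedAddCommGroup F] [NormedSpace ℝ F] (f : M → F) (x : M)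
    (v : TangentSpace 𝓘(ℝ, Eu d) x) : F :=
  mfderiv 𝓘(ℝ, Eu d) 𝓘(ℝ, F) f x v

/-- Smoothness near `x` of all Taylor coefficients of a function with values in power series. -/
def CoeffSmoothAt (f : M → FormalFun d) (x : M) : Prop :=
  ∀ m, ContMDiffAt 𝓘(ℝ, Eu d) 𝓘(ℝ, ℂ) ∞ (fun x' => MvPowerSeries.coeff m (f x')) x

theorem cmul {f g : M → ℂ} {x : M} (hf : ContMDiffAt 𝓘(ℝ, Eu d) 𝓘(ℝ, ℂ) ∞ f x)
    (hg : ContMDiffAt 𝓘(ℝ, Eu d) 𝓘(ℝ, ℂ) ∞ g x) :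
    ContMDiffAt 𝓘(ℝ, Eu d) 𝓘(ℝ, ℂ) ∞ (fun y => f y * g y) x :=
  ContDiffAt.comp_contMDiffAt (g := fun p : ℂ × ℂ => p.1 * p.2)
    contDiff_mul.contDiffAt (hf.prodMk_space hg)

theorem csum {ι : Type*} {s : Finset ι} {f : ι → M → ℂ} {x : M}
    (hf : ∀ i ∈ s, ContMDiffAt 𝓘(ℝ, Eu d) 𝓘(ℝ, ℂ) ∞ (f i) x) :
    ContMDiffAt 𝓘(ℝ, Eu d) 𝓘(ℝ, ℂ) ∞ (fun y => ∑ i ∈ s, f i y) x := by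
  classical
  induction s using Finset.induction_on with
  | empty => simpa using contMDiffAt_const
  | insert a s ha ih =>
    simp only [Finset.sum_insert ha]
    exact (hf a (Finset.mem_insert_self a s)).add
      (ih fun i hi => hf i (Finset.mem_insert_of_mem hi))

theorem cprod {ι : Type*} {s : Finset ι} {f : ι → M → ℂ} {x : M}
    (hf : ∀ i ∈ s, ContMDiffAt 𝓘(ℝ, Eu d) 𝓘(ℝ, ℂ) ∞ (f i) x) :
    ContMDiffAt 𝓘(ℝ, Eu d) 𝓘(ℝ, ℂ) ∞ (fun y => ∏ i ∈ s, f i y) x := by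
  classical
  induction s using Finset.induction_on with
  | empty => simpa using contMDiffAt_const
  | insert a s ha ih =>
    simp only [Finset.prod_insert ha]
    exact cmul (hf a (Finset.mem_insert_self a s))
      (ih fun i hi => hf i (Finset.mem_insert_of_mem hi))

/-- Smoothness of the entries of a matrix-valued function. -/
def MatSmoothAt (A : M → Matrix (Fin d) (Fin d) ℂ) (x : M) : Prop :=
  ∀ i j, ContMDiffAt 𝓘(ℝ, Eu d) 𝓘(ℝ, ℂ) ∞ (fun y => A y i j) x

theorem cdet {A : M → Matrix (Fin d) (Fin d) ℂ} {x : M} (hA : MatSmoothAt A x) :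
    ContMDiffAt 𝓘(ℝ, Eu d) 𝓘(ℝ, ℂ) ∞ (fun y => (A y).det) x := by
  simp only [Matrix.det_apply']
  exact csum fun σ _ => cmul contMDiffAt_const (cprod fun i _ => hA _ _)

theorem cinv {A : M → Matrix (Fin d) (Fin d) ℂ} {x : M} (hA : MatSmoothAt A x)
    (h0 : (A x).det ≠ 0) : MatSmoothAt (fun y => (A y)⁻¹) x := by
  intro i j
  simp only [Matrix.inv_def, Matrix.smul_apply, smul_eq_mul, Ring.inverse_eq_inv',
    Matrix.adjugate_apply]
  refine cmul ?_ ?_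
  · exact ((contDiffAt_inv ℝ h0).of_le le_top).contMDiffAt.comp x (cdet hA)
  · refine cdet fun k l => ?_
    by_cases hk : k = j
    · subst hk
      simpa using contMDiffAt_const
    · simpa [Matrix.updateRow_ne hk] using hA k l

theorem CoeffSmoothAt.mul {f g : M → FormalFun d} {x : M} (hf : CoeffSmoothAt f x)
    (hg : CoeffSmoothAt g x) : CoeffSmoothAt (fun y => f y * g y) x := by
  intro m
  classical
  simp only [MvPowerSeries.coeff_mul]
  exact csum fun p _ => cmul (hf _) (hg _)

theorem CoeffSmoothAt.add {f g : M → FormalFun d} {x : M} (hf : CoeffSmoothAt f x)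
    (hg : CoeffSmoothAt g x) : CoeffSmoothAt (fun y => f y + g y) x := by
  intro m
  simp only [map_add]
  exact (hf m).add (hg m)

theorem CoeffSmoothAt.sum {ι : Type*} {s : Finset ι} {f : ι → M → FormalFun d} {x : M}
    (hf : ∀ i ∈ s, CoeffSmoothAt (f i) x) : CoeffSmoothAt (fun y => ∑ i ∈ s, f i y) x := by
  intro m
  simp only [map_sum]
  exact csum fun i hi => hf i hi m

theorem CoeffSmoothAt.smul {c : M → ℂ} {f : M → FormalFun d} {x : M}
    (hc : ContMDiffAt 𝓘(ℝ, Eu d) 𝓘(ℝ, ℂ) ∞ c x) (hf : CoeffSmoothAt f x) :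
    CoeffSmoothAt (fun y => c y • f y) x := by
  intro m
  simp only [map_smul, smul_eq_mul]
  exact cmul hc (hf m)

theorem CoeffSmoothAt.pd {f : M → FormalFun d} {x : M} (hf : CoeffSmoothAt f x) (i : Fin d) :
    CoeffSmoothAt (fun y => Fedosov.pd i (f y)) x := by
  intro m
  simp only [MvPowerSeries.coeff_pderiv]
  exact cmul (hf _) contMDiffAt_const

theorem CoeffSmoothAt.const (a : FormalFun d) (x : M) : CoeffSmoothAt (fun _ => a) x :=
  fun _ => contMDiffAt_const

theorem CoeffSmoothAt.congr {f g : M → FormalFun d} {x : M} (hf : CoeffSmoothAt f x)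
    (h : g =ᶠ[𝓝 x] f) : CoeffSmoothAt g x :=
  fun m => (hf m).congr_of_eventuallyEq (h.mono fun y hy => by simp only [hy])

theorem CoeffSmoothAt.bidiff {P : M → Matrix (Fin d) (Fin d) ℂ} {x : M} (hP : MatSmoothAt P x)
    (r : ℕ) {f g : M → FormalFun d} (hf : CoeffSmoothAt f x) (hg : CoeffSmoothAt g x) :
    CoeffSmoothAt (fun y => Fedosov.bidiff (P y) r (f y) (g y)) x := by
  induction r generalizing f g with
  | zero => exact hf.mul hg
  | succ r ih =>
    exact CoeffSmoothAt.sum fun i _ => CoeffSmoothAt.sum fun j _ =>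
      (ih (hf.pd i) (hg.pd j)).smul (hP i j)

theorem CoeffSmoothAt.moyal {P : M → Matrix (Fin d) (Fin d) ℂ} {x : M} (hP : MatSmoothAt P x)
    (r : ℕ) {f g : M → FormalFun d} (hf : CoeffSmoothAt f x) (hg : CoeffSmoothAt g x) :
    CoeffSmoothAt (fun y => Fedosov.moyal (P y) r (f y) (g y)) x :=
  (CoeffSmoothAt.bidiff hP r hf hg).smul contMDiffAt_const

theorem CoeffSmoothAt.linSubst {A : M → Matrix (Fin d) (Fin d) ℂ} {x : M} (hA : MatSmoothAt A x)
    {f : M → FormalFun d} (hf : CoeffSmoothAt f x) :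
    CoeffSmoothAt (fun y => Fedosov.linSubst (A y) (f y)) x := by
  intro e
  simp only [coeff_linSubst]
  refine csum fun m _ => cmul (hf m) ?_
  have : ∀ (p : M → MvPolynomial (Fin d) ℂ), (∀ e, ContMDiffAt 𝓘(ℝ, Eu d) 𝓘(ℝ, ℂ) ∞
      (fun y => (p y).coeff e) x) → CoeffSmoothAt (fun y => (p y : FormalFun d)) x := by
    intro p hp e
    simpa using hp e
  have key : CoeffSmoothAt (fun y => m.prod fun i k =>
      (∑ j, A y i j • MvPowerSeries.X j : FormalFun d) ^ k) x := by
    have hpow : ∀ (g : M → FormalFun d), CoeffSmoothAt g x → ∀ k : ℕ,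
        CoeffSmoothAt (fun y => g y ^ k) x := by
      intro g hg k
      induction k with
      | zero => simpa using CoeffSmoothAt.const 1 x
      | succ k ih => simpa only [pow_succ] using ih.mul hg
    have hprod : ∀ s : Finset (Fin d), CoeffSmoothAt (fun y => ∏ i ∈ s,
        (∑ j, A y i j • MvPowerSeries.X j : FormalFun d) ^ m i) x := by
      intro s
      classical
      induction s using Finset.induction_on with
      | empty => simpa using CoeffSmoothAt.const 1 x
      | insert a s ha ih =>
        simp only [Finset.prod_insert ha]
        exact (hpow _ (CoeffSmoothAt.sum fun j _ =>
          (CoeffSmoothAt.const _ x).smul (hA a j)) _).mul ih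
    exact hprod m.support
  refine (key e).congr_of_eventuallyEq (Filter.Eventually.of_forall fun y => ?_)
  simp only [linCoeff]
  rw [← MvPolynomial.coeff_coe]
  congr 1
  simp only [Finsupp.prod, ← MvPolynomial.coeToMvPowerSeries.ringHom_apply, map_prod, map_pow,
    map_sum]
  simp [MvPolynomial.smul_eq_C_mul, MvPowerSeries.smul_eq_C_mul]

theorem chart_mem_nhds (x : M) : (chartAt (Eu d) x).source ∈ 𝓝 x :=
  (chartAt (Eu d) x).open_source.mem_nhds (mem_chart_source _ x)


variable [IsManifold 𝓘(ℝ, Eu d) ∞ M]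

/-- The frame of `T M` given by the preferred chart at `x`: the image in `T_{x'} M` of a vector of
`ℝ ^ d` under the inverse of the derivative of that chart (`T_{x'} M` is identified with `ℝ ^ d`
by the preferred chart at `x'`). Meaningful for `x'` in the domain of the chart at `x`. -/
def frame (x x' : M) : Eu d →L[ℝ] Eu d := tangentCoordChange 𝓘(ℝ, Eu d) x x' x'

/-- The vector field near `x` with constant coefficients `v` in the preferred chart at `x`. -/
def coordField (x : M) (v : Eu d) (x' : M) : TangentSpace 𝓘(ℝ, Eu d) x' := frame x x' v

variable (d M) in
/-- A symplectic form on `M`: a smooth, closed, nondegenerate alternating `2`-form. Closedness is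
the formula `dω(X, Y, Z) = X ω(Y, Z) + Y ω(Z, X) + Z ω(X, Y)` for coordinate vector fields. -/
structure SymplecticForm where
  form : ∀ x : M, TangentSpace 𝓘(ℝ, Eu d) x →L[ℝ] TangentSpace 𝓘(ℝ, Eu d) x →L[ℝ] ℝ
  alternating : ∀ x v, form x v v = 0
  nondegenerate : ∀ x v, (∀ w, form x v w = 0) → v = 0
  smooth : ∀ (x : M) (v w : Eu d), ContMDiffAt 𝓘(ℝ, Eu d) 𝓘(ℝ, ℝ) ∞
    (fun x' => form x' (coordField x v x') (coordField x w x')) x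
  closed : ∀ (x : M) (u v w : TangentSpace 𝓘(ℝ, Eu d) x),
    dirDeriv (fun x' => form x' (coordField x v x') (coordField x w x')) x u
    + dirDeriv (fun x' => form x' (coordField x w x') (coordField x u x')) x v
    + dirDeriv (fun x' => form x' (coordField x u x') (coordField x v x')) x w = 0

namespace SymplecticForm

variable (Ω : SymplecticForm d M)

/-- The Gram matrix of the symplectic form at `x` in the frame `L`. -/
def gram (x : M) (L : Eu d →L[ℝ] Eu d) : Matrix (Fin d) (Fin d) ℂ :=
  Matrix.of fun i j => ((Ω.form x (L (basisVec i)) (L (basisVec j)) : ℝ) : ℂ)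

/-- The matrix `P k l = \barω(y k, y l)` of the induced symplectic form on `T_x^* M`, which is
determined by `\barω(ω(u, ·), ω(v, ·)) = ω(u, v)`. -/
def poisson (x : M) : Matrix (Fin d) (Fin d) ℂ := (Ω.gram x (ContinuousLinearMap.id ℝ _))ᵀ⁻¹

end SymplecticForm

/-- Set-theoretic (not necessarily smooth) sections of the Weyl bundle. -/
abbrev RawSection (d : ℕ) (M : Type u) : Type u := M → ℕ → FormalFun d

/-- The coefficient of `ħ ^ N` of `s`, written near `x` in the linear fibre coordinates that come
from the preferred chart at `x`. -/
def localRep (s : RawSection d M) (x : M) (N : ℕ) (x' : M) : FormalFun d :=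
  linSubst (matrixOf (frame x x')) (s x' N)

/-- Smoothness of a section of the Weyl bundle near `x`: all its coefficients in the local
trivialization at `x` are smooth. -/
def SmoothAt (s : RawSection d M) (x : M) : Prop := ∀ N, CoeffSmoothAt (localRep s x N) x

/-- Coefficientwise directional derivative. -/
def coeffDeriv (f : M → FormalFun d) (x : M) (v : TangentSpace 𝓘(ℝ, Eu d) x) : FormalFun d :=
  fun m => dirDeriv (fun x' => MvPowerSeries.coeff m (f x')) x v

/-- Affine connections on `M`. -/
abbrev AffineConnection (d : ℕ) (M : Type u) [TopologicalSpace M] [ChartedSpace (Eu d) M]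
    [IsManifold 𝓘(ℝ, Eu d) ∞ M] : Type u :=
  CovariantDerivative 𝓘(ℝ, Eu d) (Eu d) (TangentSpace 𝓘(ℝ, Eu d) : M → Type)

/-- The matrix `Γ^k_j(v)` with `D_v ∂_j = ∑ k, Γ^k_j(v) ∂_k` in the preferred chart at `x`. -/
def christoffel (D : AffineConnection d M) (x : M) (v : TangentSpace 𝓘(ℝ, Eu d) x) :
    Matrix (Fin d) (Fin d) ℂ :=
  Matrix.of fun k j => coord (D (coordField x (basisVec j)) x v) k

/-- The derivation `∑ k j, G k j * y j * ∂ / ∂ y k`. -/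
def matrixDer {d : ℕ} (G : Matrix (Fin d) (Fin d) ℂ) :
    Derivation ℂ (FormalFun d) (FormalFun d) :=
  ∑ k, ∑ j, (G k j • MvPowerSeries.X j : FormalFun d) • pd k

/-- The connection is symplectic: `v ω(Y, Z) = ω(D_v Y, Z) + ω(Y, D_v Z)`. -/
def SymplecticForm.IsParallel (Ω : SymplecticForm d M) (D : AffineConnection d M) : Prop :=
  ∀ (x : M) (Y Z : ∀ x : M, TangentSpace 𝓘(ℝ, Eu d) x),
    MDifferentiableAt 𝓘(ℝ, Eu d) (𝓘(ℝ, Eu d).prod 𝓘(ℝ, Eu d))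
      (fun x' => Bundle.TotalSpace.mk' (Eu d) x' (Y x')) x →
    MDifferentiableAt 𝓘(ℝ, Eu d) (𝓘(ℝ, Eu d).prod 𝓘(ℝ, Eu d))
      (fun x' => Bundle.TotalSpace.mk' (Eu d) x' (Z x')) x → ∀ v : TangentSpace 𝓘(ℝ, Eu d) x,
      dirDeriv (fun x' => Ω.form x' (Y x') (Z x')) x v
        = Ω.form x (D Y x v) (Z x) + Ω.form x (Y x) (D Z x v)



theorem sum_coord {d : ℕ} (v : Eu d) : v = ∑ i, v i • basisVec i := by
  ext j
  simp [basisVec, Pi.single_apply]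

theorem bilin_eq {d : ℕ} (B : Eu d →L[ℝ] Eu d →L[ℝ] ℝ) (u v : Eu d) :
    B u v = ∑ l, ∑ k, u k * B (basisVec k) (basisVec l) * v l := by
  conv_lhs => rw [sum_coord u, sum_coord v]
  simp only [map_sum, map_smul, smul_eq_mul, sum_apply,
    smul_apply, Finset.mul_sum]
  refine Finset.sum_congr rfl fun l _ => Finset.sum_congr rfl fun k _ => ?_
  ring

theorem bilin_left {d : ℕ} (B : Eu d →L[ℝ] Eu d →L[ℝ] ℝ) (u : Eu d) (j : Fin d) :
    B u (basisVec j) = ∑ k, u k * B (basisVec k) (basisVec j) := by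
  conv_lhs => rw [sum_coord u]
  simp only [map_sum, map_smul, smul_eq_mul, sum_apply, smul_apply]

theorem bilin_right {d : ℕ} (B : Eu d →L[ℝ] Eu d →L[ℝ] ℝ) (u : Eu d) (i : Fin d) :
    B (basisVec i) u = ∑ k, B (basisVec i) (basisVec k) * u k := by
  conv_lhs => rw [sum_coord u]
  simp only [map_sum, map_smul, smul_eq_mul, mul_comm]

theorem matrixOf_id {d : ℕ} : matrixOf (ContinuousLinearMap.id ℝ (Eu d)) = 1 := by
  ext i j
  simp only [matrixOf, coord, basisVec, Matrix.one_apply, Matrix.of_apply,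
    ContinuousLinearMap.id_apply, PiLp.single_apply]
  split_ifs <;> simp

theorem matrixOf_comp {d : ℕ} (L K : Eu d →L[ℝ] Eu d) :
    matrixOf (L.comp K) = matrixOf L * matrixOf K := by
  ext i j
  simp only [matrixOf, coord, Matrix.mul_apply, Matrix.of_apply, ContinuousLinearMap.comp_apply]
  conv_lhs => rw [sum_coord (K (basisVec j)), map_sum]
  simp [mul_comm]

theorem frame_self (x : M) : frame (d := d) x x = ContinuousLinearMap.id ℝ _ := by
  ext1 v
  exact tangentCoordChange_self (mem_extChartAt_source x)

theorem frame_inv {x x' : M} (h : x' ∈ (chartAt (Eu d) x).source) :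
    (tangentCoordChange 𝓘(ℝ, Eu d) x' x x').comp (frame x x') = ContinuousLinearMap.id ℝ _ := by
  ext1 v
  have h1 : x' ∈ (extChartAt 𝓘(ℝ, Eu d) x).source := by rwa [extChartAt_source]
  have h2 := mem_extChartAt_source (I := 𝓘(ℝ, Eu d)) x'
  exact (tangentCoordChange_comp ⟨⟨h1, h2⟩, h1⟩).trans (tangentCoordChange_self h1)

theorem matrixOf_frame_inv {x x' : M} (h : x' ∈ (chartAt (Eu d) x).source) :
    matrixOf (tangentCoordChange 𝓘(ℝ, Eu d) x' x x') * matrixOf (frame x x') = 1 := by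
  rw [← matrixOf_comp, frame_inv h, matrixOf_id]

namespace SymplecticForm

variable (Ω : SymplecticForm d M)

theorem gram_eq (x : M) (L : Eu d →L[ℝ] Eu d) :
    Ω.gram x L = (matrixOf L)ᵀ * Ω.gram x (ContinuousLinearMap.id ℝ _) * matrixOf L := by
  ext i j
  simp only [gram, matrixOf, coord, Matrix.mul_apply, Matrix.of_apply, Matrix.transpose_apply,
    ContinuousLinearMap.id_apply]
  have h : Ω.form x (L (basisVec i)) (L (basisVec j)) = ∑ l, ∑ k,
      L (basisVec i) k * Ω.form x (basisVec k) (basisVec l) * L (basisVec j) l :=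
    bilin_eq (show Eu d →L[ℝ] Eu d →L[ℝ] ℝ from Ω.form x) _ _
  rw [h]
  push_cast
  simp only [Finset.sum_mul]

theorem det_gram_ne_zero (x : M) : (Ω.gram x (ContinuousLinearMap.id ℝ _)).det ≠ 0 := by
  let G : Matrix (Fin d) (Fin d) ℝ := Matrix.of fun i j => Ω.form x (basisVec i) (basisVec j)
  have hG : Ω.gram x (ContinuousLinearMap.id ℝ _) = G.map (Complex.ofRealHom) := rfl
  rw [hG, ← RingHom.mapMatrix_apply, ← RingHom.map_det]
  refine fun h => ?_
  have h0 : G.det = 0 := by simpa using h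
  obtain ⟨c, hc, hG0⟩ := Matrix.exists_vecMul_eq_zero_iff.2 h0
  refine hc ?_
  let v : Eu d := WithLp.toLp 2 c
  have hv : v = 0 := by
    refine Ω.nondegenerate x v fun w => ?_
    refine (bilin_eq (show Eu d →L[ℝ] Eu d →L[ℝ] ℝ from Ω.form x) v w).trans ?_
    refine Finset.sum_eq_zero fun l _ => ?_
    rw [← Finset.sum_mul]
    have h2 : ∑ k, c k * Ω.form x (basisVec k) (basisVec l) = 0 := congrFun hG0 l
    exact (congrArg (fun t => t * (show Eu d from w) l) h2).trans (zero_mul _)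
  funext i
  exact congrArg (fun u : Eu d => u i) hv

/-- The Poisson matrix of `Ω` at `x'`, in the coordinates of the chart at `x`. -/
def localPoisson (x x' : M) : Matrix (Fin d) (Fin d) ℂ := (Ω.gram x' (frame x x'))ᵀ⁻¹

theorem poisson_of_gram {x : M} {L : Eu d →L[ℝ] Eu d} {K : Matrix (Fin d) (Fin d) ℂ}
    (h : K * matrixOf L = 1) :
    Ω.poisson x = matrixOf L * (Ω.gram x L)ᵀ⁻¹ * (matrixOf L)ᵀ := by
  have h' : matrixOf L * K = 1 := mul_eq_one_comm.1 h
  have e1 : (matrixOf L)⁻¹ = K := Matrix.inv_eq_left_inv h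
  rw [Ω.gram_eq x L, poisson]
  simp only [Matrix.transpose_mul, Matrix.transpose_transpose, Matrix.mul_inv_rev]
  have e2 : ((matrixOf L)ᵀ)⁻¹ = Kᵀ := by rw [← Matrix.transpose_nonsing_inv, e1]
  rw [e1, e2]
  have e3 : Kᵀ * (matrixOf L)ᵀ = 1 := by
    rw [← Matrix.transpose_mul, h', Matrix.transpose_one]
  simp only [Matrix.mul_assoc, e3, Matrix.mul_one]
  rw [← Matrix.mul_assoc, h', Matrix.one_mul]

theorem poisson_eq_local {x x' : M} (h : x' ∈ (chartAt (Eu d) x).source) :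
    Ω.poisson x' = matrixOf (frame x x') * Ω.localPoisson x x' * (matrixOf (frame x x'))ᵀ :=
  Ω.poisson_of_gram (matrixOf_frame_inv h)

theorem det_localGram_ne_zero {x x' : M} (h : x' ∈ (chartAt (Eu d) x).source) :
    (Ω.gram x' (frame x x')).det ≠ 0 := by
  have h1 := congrArg Matrix.det (matrixOf_frame_inv h)
  rw [Matrix.det_mul, Matrix.det_one] at h1
  have h2 : (matrixOf (frame x x')).det ≠ 0 := right_ne_zero_of_mul (h1.trans_ne one_ne_zero)
  rw [gram_eq, Matrix.det_mul, Matrix.det_mul, Matrix.det_transpose]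
  exact mul_ne_zero (mul_ne_zero h2 (Ω.det_gram_ne_zero x')) h2

end SymplecticForm

section Smooth

theorem localPoisson_smooth (Ω : SymplecticForm d M) (x : M) :
    MatSmoothAt (Ω.localPoisson x) x := by
  refine cinv (A := fun y => (Ω.gram y (frame x y))ᵀ) (fun i j => ?_) ?_
  · exact Complex.ofRealCLM.contDiff.contMDiff.contMDiffAt.comp x
      (Ω.smooth x (basisVec j) (basisVec i))
  · rw [Matrix.det_transpose]
    exact Ω.det_localGram_ne_zero (mem_chart_source _ x)

end Smooth


theorem localRep_self (s : RawSection d M) (x : M) (N : ℕ) : localRep s x N x = s x N := by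
  rw [localRep, frame_self, matrixOf_id, linSubst_id]

namespace SymplecticForm

variable (Ω : SymplecticForm d M)

/-- The pointwise product of two (not necessarily smooth) sections. -/
def rawMul (s t : RawSection d M) : RawSection d M :=
  fun x => Mul.mul (α := Weyl (Ω.poisson x)) (s x) (t x)

theorem localRep_rawMul (s t : RawSection d M) {x x' : M} (h : x' ∈ (chartAt (Eu d) x).source)
    (N : ℕ) : localRep (Ω.rawMul s t) x N x' = ∑ p ∈ antidiagonal N, ∑ q ∈ antidiagonal p.2,
      moyal (Ω.localPoisson x x') p.1 (localRep s x q.1 x') (localRep t x q.2 x') := by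
  simp only [localRep]
  exact congrFun (Weyl.subst_mul (Ω.poisson_eq_local h)
    (s x') (t x')) N

theorem smoothAt_rawMul {s t : RawSection d M} {x : M} (hs : SmoothAt s x) (ht : SmoothAt t x) :
    SmoothAt (Ω.rawMul s t) x := by
  intro N
  refine CoeffSmoothAt.congr (f := fun x' => ∑ p ∈ antidiagonal N, ∑ q ∈ antidiagonal p.2,
      moyal (Ω.localPoisson x x') p.1 (localRep s x q.1 x') (localRep t x q.2 x')) ?_ ?_
  · exact CoeffSmoothAt.sum fun p _ => CoeffSmoothAt.sum fun q _ =>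
      CoeffSmoothAt.moyal (localPoisson_smooth Ω x) _ (hs _) (ht _)
  · filter_upwards [chart_mem_nhds (d := d) x] with x' hx'
    exact Ω.localRep_rawMul s t hx' N

open Classical in
/-- Extension by zero of a section over `V`. -/
def extend {V : TopologicalSpace.Opens M} (σ : ∀ x : V, Weyl (Ω.poisson x)) : RawSection d M :=
  fun x => if h : x ∈ V then σ ⟨x, h⟩ else 0

theorem extend_apply {V : TopologicalSpace.Opens M} (σ : ∀ x : V, Weyl (Ω.poisson x)) {x : M}
    (h : x ∈ V) : Ω.extend σ x = σ ⟨x, h⟩ := dif_pos h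

theorem smoothAt_congr {s t : RawSection d M} {x : M} (hs : SmoothAt s x) (h : t =ᶠ[𝓝 x] s) :
    SmoothAt t x := fun N =>
  (hs N).congr (h.mono fun y hy => by simp only [localRep, hy])

theorem smoothAt_add {s t : RawSection d M} {x : M} (hs : SmoothAt s x) (ht : SmoothAt t x) :
    SmoothAt (s + t) x := fun N =>
  ((hs N).add (ht N)).congr (Filter.Eventually.of_forall fun _ => linSubst_add _ _ _)

theorem smoothAt_neg {s : RawSection d M} {x : M} (hs : SmoothAt s x) :
    SmoothAt (-s) x := fun N =>
  (CoeffSmoothAt.smul (c := fun _ => -1) contMDiffAt_const (hs N)).congr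
    (Filter.Eventually.of_forall fun y => by
      simp only [localRep, neg_smul, one_smul]
      exact map_neg (linSubstL _) _)

theorem smoothAt_zero (x : M) : SmoothAt (0 : RawSection d M) x := fun _ =>
  (CoeffSmoothAt.const 0 x).congr (Filter.Eventually.of_forall fun _ => linSubst_zero _)

/-- The ring `Γ(V, 𝒲)` of smooth sections of the Weyl bundle over the open set `V`. -/
def sections (V : TopologicalSpace.Opens M) : Subring (∀ x : V, Weyl (Ω.poisson x)) where
  carrier := {σ | ∀ x ∈ V, SmoothAt (Ω.extend σ) x}
  zero_mem' := fun x hx => smoothAt_congr (smoothAt_zero x) (by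
    filter_upwards [V.isOpen.mem_nhds hx] with y hy
    rw [extend_apply Ω _ hy]
    rfl)
  one_mem' := fun x hx => by
    refine smoothAt_congr (s := fun x' => (1 : Weyl (Ω.poisson x'))) (fun N => ?_) ?_
    · refine CoeffSmoothAt.congr (CoeffSmoothAt.const ((1 : Weyl (Ω.poisson x)) N) x)
        (Filter.Eventually.of_forall fun y => ?_)
      exact congrFun (Weyl.subst_one (P := Ω.poisson y) (P' := Ω.poisson x) _) N
    · filter_upwards [V.isOpen.mem_nhds hx] with y hy
      rw [extend_apply Ω _ hy]
      rfl
  add_mem' := fun {σ τ} hσ hτ x hx => smoothAt_congr (smoothAt_add (hσ x hx) (hτ x hx)) (by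
    filter_upwards [V.isOpen.mem_nhds hx] with y hy
    rw [Pi.add_apply, extend_apply Ω _ hy, extend_apply Ω _ hy, extend_apply Ω _ hy]
    rfl)
  neg_mem' := fun {σ} hσ x hx => smoothAt_congr (smoothAt_neg (hσ x hx)) (by
    filter_upwards [V.isOpen.mem_nhds hx] with y hy
    rw [Pi.neg_apply, extend_apply Ω _ hy, extend_apply Ω _ hy]
    rfl)
  mul_mem' := fun {σ τ} hσ hτ x hx =>
    smoothAt_congr (Ω.smoothAt_rawMul (hσ x hx) (hτ x hx)) (by
      filter_upwards [V.isOpen.mem_nhds hx] with y hy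
      rw [rawMul, extend_apply Ω _ hy, extend_apply Ω _ hy, extend_apply Ω _ hy]
      rfl)

/-- Restriction of sections. -/
def restrict {V V' : TopologicalSpace.Opens M} (h : V' ≤ V) : Ω.sections V →+* Ω.sections V' where
  toFun σ := ⟨fun x => σ.1 ⟨x.1, h x.2⟩, fun x hx => smoothAt_congr (σ.2 x (h hx)) (by
    filter_upwards [V'.isOpen.mem_nhds hx] with y hy
    rw [extend_apply Ω _ hy, extend_apply Ω _ (h hy)])⟩
  map_one' := rfl
  map_mul' _ _ := rfl
  map_zero' := rfl
  map_add' _ _ := rfl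

open CategoryTheory in
/-- The presheaf of groups `V ↦ Γ(V, 𝒲)ˣ`. -/
def unitsPresheaf : TopCat.Presheaf GrpCat.{u} (TopCat.of M) where
  obj V := GrpCat.of (Ω.sections V.unop)ˣ
  map f := GrpCat.ofHom (Units.map (Ω.restrict (leOfHom f.unop)).toMonoidHom)
  map_id _ := rfl
  map_comp _ _ := rfl

end SymplecticForm


theorem matrixDer_apply (G : Matrix (Fin d) (Fin d) ℂ) (a : FormalFun d) :
    matrixDer G a = ∑ k, ∑ j, G k j • (MvPowerSeries.X j * pd k a) := by
  have h : ∀ f : Fin d → Derivation ℂ (FormalFun d) (FormalFun d),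
      (∑ k, f k) a = ∑ k, f k a := fun f =>
    map_sum ((Pi.evalAddMonoidHom _ a).comp
      (Derivation.coeFnAddMonoidHom (R := ℂ) (A := FormalFun d) (M := FormalFun d))) f _
  simp only [matrixDer, h, Derivation.smul_apply, smul_eq_mul, smul_mul_assoc]

theorem pd_matrixDer (G : Matrix (Fin d) (Fin d) ℂ) (i : Fin d) (a : FormalFun d) :
    pd i (matrixDer G a) = matrixDer G (pd i a) + ∑ k, G k i • pd k a := by
  simp only [matrixDer_apply, map_sum, Derivation.map_smul, Derivation.leibniz, smul_add,
    Finset.sum_add_distrib, pd_comm i, smul_eq_mul, MvPowerSeries.pderiv_X]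
  congr 1
  refine Finset.sum_congr rfl fun k _ => ?_
  rw [Finset.sum_eq_single i]
  · simp
  · intro j _ hj
    simp [hj]
  · simp

section Leibniz

variable {x : M} (v : TangentSpace 𝓘(ℝ, Eu d) x)

theorem mdiff {F : Type*} [NormedAddCommGroup F] [NormedSpace ℝ F] {f : M → F}
    (hf : ContMDiffAt 𝓘(ℝ, Eu d) 𝓘(ℝ, F) ∞ f x) : MDifferentiableAt 𝓘(ℝ, Eu d) 𝓘(ℝ, F) f x :=
  hf.mdifferentiableAt (by simp)

theorem dirDeriv_congr {F : Type*} [NormedAddCommGroup F] [NormedSpace ℝ F] {f g : M → F}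
    (h : f =ᶠ[𝓝 x] g) : dirDeriv f x v = dirDeriv g x v := by
  rw [dirDeriv, dirDeriv, h.mfderiv_eq]
  rfl

theorem dirDeriv_const (c : ℂ) : dirDeriv (fun _ : M => c) x v = 0 := by
  rw [dirDeriv, mfderiv_const]
  rfl

theorem dirDeriv_mul {f g : M → ℂ} (hf : ContMDiffAt 𝓘(ℝ, Eu d) 𝓘(ℝ, ℂ) ∞ f x)
    (hg : ContMDiffAt 𝓘(ℝ, Eu d) 𝓘(ℝ, ℂ) ∞ g x) :
    dirDeriv (fun y => f y * g y) x v = dirDeriv f x v * g x + f x * dirDeriv g x v := by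
  have h := ((mdiff hf).hasMFDerivAt.mul (mdiff hg).hasMFDerivAt).mfderiv
  rw [dirDeriv, dirDeriv, dirDeriv]
  refine (congrArg (fun L => L v) h).trans ?_
  change f x * _ + g x * _ = _
  rw [add_comm, mul_comm (g x)]
  rfl

theorem dirDeriv_add {f g : M → ℂ} (hf : ContMDiffAt 𝓘(ℝ, Eu d) 𝓘(ℝ, ℂ) ∞ f x)
    (hg : ContMDiffAt 𝓘(ℝ, Eu d) 𝓘(ℝ, ℂ) ∞ g x) :
    dirDeriv (fun y => f y + g y) x v = dirDeriv f x v + dirDeriv g x v :=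
  congrArg (fun L => L v) ((mdiff hf).hasMFDerivAt.add (mdiff hg).hasMFDerivAt).mfderiv

theorem dirDeriv_sum {ι : Type*} {s : Finset ι} {f : ι → M → ℂ}
    (hf : ∀ i ∈ s, ContMDiffAt 𝓘(ℝ, Eu d) 𝓘(ℝ, ℂ) ∞ (f i) x) :
    dirDeriv (fun y => ∑ i ∈ s, f i y) x v = ∑ i ∈ s, dirDeriv (f i) x v := by
  classical
  induction s using Finset.induction_on with
  | empty => simpa using dirDeriv_const v 0
  | insert a s ha ih =>
    simp only [Finset.sum_insert ha]
    rw [dirDeriv_add v (hf a (Finset.mem_insert_self a s))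
      (csum fun i hi => hf i (Finset.mem_insert_of_mem hi)),
      ih fun i hi => hf i (Finset.mem_insert_of_mem hi)]

theorem coeff_coeffDeriv (f : M → FormalFun d) (m : Fin d →₀ ℕ) :
    MvPowerSeries.coeff m (coeffDeriv f x v)
      = dirDeriv (fun y => MvPowerSeries.coeff m (f y)) x v := rfl

theorem coeffDeriv_congr {f g : M → FormalFun d} (h : f =ᶠ[𝓝 x] g) :
    coeffDeriv f x v = coeffDeriv g x v := by
  ext m
  exact dirDeriv_congr v (h.mono fun y hy => by simp only [hy])

theorem coeffDeriv_const (a : FormalFun d) : coeffDeriv (fun _ : M => a) x v = 0 := by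
  ext m
  exact dirDeriv_const v _

theorem coeffDeriv_sum {ι : Type*} {s : Finset ι} {f : ι → M → FormalFun d}
    (hf : ∀ i ∈ s, CoeffSmoothAt (f i) x) :
    coeffDeriv (fun y => ∑ i ∈ s, f i y) x v = ∑ i ∈ s, coeffDeriv (f i) x v := by
  ext m
  simp only [coeff_coeffDeriv, map_sum]
  exact dirDeriv_sum v fun i hi => hf i hi m

theorem coeffDeriv_mul {f g : M → FormalFun d} (hf : CoeffSmoothAt f x) (hg : CoeffSmoothAt g x) :
    coeffDeriv (fun y => f y * g y) x v
      = coeffDeriv f x v * g x + f x * coeffDeriv g x v := by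
  classical
  ext m
  simp only [coeff_coeffDeriv, map_add, MvPowerSeries.coeff_mul]
  rw [dirDeriv_sum v fun p _ => cmul (hf _) (hg _), ← Finset.sum_add_distrib]
  exact Finset.sum_congr rfl fun p _ => dirDeriv_mul v (hf _) (hg _)

theorem coeffDeriv_smul {c : M → ℂ} {f : M → FormalFun d}
    (hc : ContMDiffAt 𝓘(ℝ, Eu d) 𝓘(ℝ, ℂ) ∞ c x) (hf : CoeffSmoothAt f x) :
    coeffDeriv (fun y => c y • f y) x v = dirDeriv c x v • f x + c x • coeffDeriv f x v := by
  ext m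
  simp only [coeff_coeffDeriv, map_add, map_smul, smul_eq_mul]
  exact dirDeriv_mul v hc (hf _)

theorem coeffDeriv_pd {f : M → FormalFun d} (hf : CoeffSmoothAt f x) (i : Fin d) :
    coeffDeriv (fun y => pd i (f y)) x v = pd i (coeffDeriv f x v) := by
  ext m
  simp only [coeff_coeffDeriv, MvPowerSeries.coeff_pderiv]
  rw [dirDeriv_mul v (hf _) contMDiffAt_const, dirDeriv_const, mul_zero, add_zero]

theorem totalDeriv_bidiff {P : M → Matrix (Fin d) (Fin d) ℂ} (hP : MatSmoothAt P x)
    {G : Matrix (Fin d) (Fin d) ℂ}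
    (hG : ∀ k l, dirDeriv (fun y => P y k l) x v + (∑ i, P x i l * G k i)
      + (∑ j, P x k j * G l j) = 0)
    (r : ℕ) {f g : M → FormalFun d} (hf : CoeffSmoothAt f x) (hg : CoeffSmoothAt g x) :
    coeffDeriv (fun y => bidiff (P y) r (f y) (g y)) x v
        - matrixDer G (bidiff (P x) r (f x) (g x))
      = bidiff (P x) r (coeffDeriv f x v - matrixDer G (f x)) (g x)
        + bidiff (P x) r (f x) (coeffDeriv g x v - matrixDer G (g x)) := by
  induction r generalizing f g with
  | zero =>
    simp only [bidiff]
    rw [coeffDeriv_mul v hf hg, Derivation.leibniz, smul_eq_mul, smul_eq_mul]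
    ring
  | succ r ih =>
    have hs : ∀ (f : M → FormalFun d), CoeffSmoothAt f x → ∀ i,
        coeffDeriv (fun y => pd i (f y)) x v - matrixDer G (pd i (f x))
          = pd i (coeffDeriv f x v - matrixDer G (f x)) + ∑ k, G k i • pd k (f x) := by
      intro f hf i
      rw [coeffDeriv_pd v hf, map_sub, pd_matrixDer]
      abel
    simp only [bidiff_succ]
    rw [coeffDeriv_sum v fun i _ => CoeffSmoothAt.sum fun j _ =>
      (CoeffSmoothAt.bidiff hP r (hf.pd i) (hg.pd j)).smul (hP i j)]
    have e1 : ∀ i ∈ Finset.univ, coeffDeriv (fun y => ∑ j, P y i j •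
        bidiff (P y) r (pd i (f y)) (pd j (g y))) x v
        = ∑ j, (dirDeriv (fun y => P y i j) x v • bidiff (P x) r (pd i (f x)) (pd j (g x))
          + P x i j • coeffDeriv (fun y => bidiff (P y) r (pd i (f y)) (pd j (g y))) x v) := by
      intro i _
      rw [coeffDeriv_sum v fun j _ =>
        (CoeffSmoothAt.bidiff hP r (hf.pd i) (hg.pd j)).smul (hP i j)]
      exact Finset.sum_congr rfl fun j _ =>
        coeffDeriv_smul v (hP i j) (CoeffSmoothAt.bidiff hP r (hf.pd i) (hg.pd j))
    rw [Finset.sum_congr rfl e1]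
    simp only [map_sum, Derivation.map_smul]
    have e2 : ∀ i j, coeffDeriv (fun y => bidiff (P y) r (pd i (f y)) (pd j (g y))) x v
        = matrixDer G (bidiff (P x) r (pd i (f x)) (pd j (g x)))
          + (bidiff (P x) r (pd i (coeffDeriv f x v - matrixDer G (f x))) (pd j (g x))
            + ∑ k, G k i • bidiff (P x) r (pd k (f x)) (pd j (g x)))
          + (bidiff (P x) r (pd i (f x)) (pd j (coeffDeriv g x v - matrixDer G (g x)))
            + ∑ k, G k j • bidiff (P x) r (pd i (f x)) (pd k (g x))) := by
      intro i j
      have h := ih (hf.pd i) (hg.pd j)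
      rw [hs f hf, hs g hg, bidiff_add_left, bidiff_add_right, sub_eq_iff_eq_add'] at h
      rw [h]
      simp only [← bidiffL_apply, map_sum, map_smul, LinearMap.sum_apply, LinearMap.smul_apply]
      abel
    simp only [e2, smul_add, Finset.sum_add_distrib]
    have e3 : (∑ i, ∑ j, dirDeriv (fun y => P y i j) x v •
          bidiff (P x) r (pd i (f x)) (pd j (g x)))
        + (∑ i, ∑ j, P x i j • ∑ k, G k i • bidiff (P x) r (pd k (f x)) (pd j (g x)))
        + (∑ i, ∑ j, P x i j • ∑ k, G k j • bidiff (P x) r (pd i (f x)) (pd k (g x))) = 0 := by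
      have a1 : (∑ i, ∑ j, P x i j • ∑ k, G k i • bidiff (P x) r (pd k (f x)) (pd j (g x)))
          = ∑ k, ∑ l, (∑ i, P x i l * G k i) • bidiff (P x) r (pd k (f x)) (pd l (g x)) := by
        simp only [Finset.smul_sum, smul_smul, Finset.sum_smul]
        rw [Finset.sum_comm]
        conv_rhs => rw [Finset.sum_comm]
        refine Finset.sum_congr rfl fun l _ => ?_
        rw [Finset.sum_comm]
      have a2 : (∑ i, ∑ j, P x i j • ∑ k, G k j • bidiff (P x) r (pd i (f x)) (pd k (g x)))
          = ∑ k, ∑ l, (∑ j, P x k j * G l j) • bidiff (P x) r (pd k (f x)) (pd l (g x)) := by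
        simp only [Finset.smul_sum, smul_smul, Finset.sum_smul]
        refine Finset.sum_congr rfl fun k _ => ?_
        rw [Finset.sum_comm]
      rw [a1, a2]
      simp only [← Finset.sum_add_distrib, ← add_smul, hG, zero_smul, Finset.sum_const_zero]
    rw [← sub_eq_zero]
    refine Eq.trans ?_ e3
    abel

end Leibniz

namespace Weyl

variable {P : Matrix (Fin d) (Fin d) ℂ}

/-- Dropping the coefficient of `ħ ^ 0` and dividing by `ħ`. -/
def shift (a : Weyl P) : Weyl P := fun n => a (n + 1)

theorem mul_apply_succ_left {a b : Weyl P} (h : a 0 = 0) (N : ℕ) :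
    (a * b) (N + 1) = (a.shift * b) N := by
  have h0 : ∀ r c, moyal P r (a 0) c = 0 := fun r c => by
    rw [h, moyal, ← bidiffL_apply, map_zero, LinearMap.zero_apply, smul_zero]
  rw [mul_apply, mul_apply, Finset.Nat.sum_antidiagonal_succ']
  simp [Finset.Nat.sum_antidiagonal_succ, h0, shift]

theorem mul_apply_succ_right {a b : Weyl P} (h : b 0 = 0) (N : ℕ) :
    (a * b) (N + 1) = (a * b.shift) N := by
  have h0 : ∀ r c, moyal P r c (b 0) = 0 := fun r c => by
    rw [h, moyal, ← bidiffL_apply, map_zero, smul_zero]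
  rw [mul_apply, mul_apply, Finset.Nat.sum_antidiagonal_succ']
  simp [Finset.Nat.sum_antidiagonal_succ', h0, shift]

theorem comm_apply_zero (a b : Weyl P) : (a * b - b * a) 0 = 0 := by
  simp [sub_apply, mul_apply, moyal_zero, mul_comm]

theorem moyal_smul_left (r : ℕ) (z : ℂ) (a b : FormalFun d) :
    moyal P r (z • a) b = z • moyal P r a b := by
  rw [moyal, bidiff_smul_left, smul_comm, moyal]

theorem moyal_smul_right (r : ℕ) (z : ℂ) (a b : FormalFun d) :
    moyal P r a (z • b) = z • moyal P r a b := by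
  rw [moyal, bidiff_smul_right, smul_comm, moyal]

theorem bracket_mul (a b c : Weyl P) : bracket a (b * c) = bracket a b * c + b * bracket a c := by
  have h : a * (b * c) - b * c * a = (a * b - b * a) * c + b * (a * c - c * a) := by
    noncomm_ring
  ext1 N
  rw [bracket, h, add_apply, mul_apply_succ_left (comm_apply_zero a b),
    mul_apply_succ_right (comm_apply_zero a c), smul_add, add_apply]
  congr 1
  · simp only [mul_apply, Finset.smul_sum, ← moyal_smul_left]
    rfl
  · simp only [mul_apply, Finset.smul_sum, ← moyal_smul_right]
    rfl

theorem bracket_add (a b c : Weyl P) : bracket a (b + c) = bracket a b + bracket a c := by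
  have h : a * (b + c) - (b + c) * a = (a * b - b * a) + (a * c - c * a) := by
    noncomm_ring
  ext1 N
  rw [bracket, h, add_apply, smul_add]
  rfl

theorem bracket_one (a : Weyl P) : bracket a 1 = 0 := by
  ext1 N
  rw [bracket, mul_one, one_mul, sub_self, zero_apply, smul_zero, zero_apply]

end Weyl


section Parallel

variable (Ω : SymplecticForm d M) (D : AffineConnection d M)

theorem coordField_self (x : M) (v : Eu d) : coordField x v x = v := by
  rw [coordField, frame_self]
  rfl

theorem coordField_mdiff (x : M) (v : Eu d) :
    MDifferentiableAt 𝓘(ℝ, Eu d) (𝓘(ℝ, Eu d).prod 𝓘(ℝ, Eu d))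
      (fun x' => Bundle.TotalSpace.mk' (Eu d) x'
        (coordField x v x' : TangentSpace 𝓘(ℝ, Eu d) x')) x := by
  rw [mdifferentiableAt_section]
  refine (mdifferentiableAt_const (c := v)).congr_of_eventuallyEq ?_
  filter_upwards [chart_mem_nhds (d := d) x] with x' hx'
  exact congrArg (fun L : Eu d →L[ℝ] Eu d => L v) (frame_inv hx')

theorem dirDeriv_ofReal {f : M → ℝ} {x : M} (v : TangentSpace 𝓘(ℝ, Eu d) x)
    (hf : ContMDiffAt 𝓘(ℝ, Eu d) 𝓘(ℝ, ℝ) ∞ f x) :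
    dirDeriv (fun y => (f y : ℂ)) x v = (dirDeriv f x v : ℝ) := by
  have h1 : HasMFDerivAt 𝓘(ℝ, ℝ) 𝓘(ℝ, ℂ) Complex.ofRealCLM (f x) Complex.ofRealCLM :=
    Complex.ofRealCLM.hasMFDerivAt
  exact congrArg (fun L => L v) (h1.comp x (mdiff hf).hasMFDerivAt).mfderiv

variable {Ω D}

theorem dirDeriv_gram (hD : Ω.IsParallel D) (x : M) (v : TangentSpace 𝓘(ℝ, Eu d) x)
    (i j : Fin d) : dirDeriv (fun y => Ω.gram y (frame x y) i j) x v
      = (∑ k, christoffel D x v k i * Ω.gram x (ContinuousLinearMap.id ℝ _) k j)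
        + ∑ k, Ω.gram x (ContinuousLinearMap.id ℝ _) i k * christoffel D x v k j := by
  refine (dirDeriv_ofReal v (Ω.smooth x (basisVec i) (basisVec j))).trans ?_
  rw [hD x _ _ (coordField_mdiff x _) (coordField_mdiff x _) v, coordField_self, coordField_self]
  have e1 := bilin_left (show Eu d →L[ℝ] Eu d →L[ℝ] ℝ from Ω.form x)
    (D (coordField x (basisVec i)) x v) j
  have e2 := bilin_right (show Eu d →L[ℝ] Eu d →L[ℝ] ℝ from Ω.form x)
    (D (coordField x (basisVec j)) x v) i
  refine (congrArg (fun t : ℝ => (t : ℂ)) (congrArg₂ (· + ·) e1 e2)).trans ?_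
  push_cast
  rfl

theorem dirDeriv_localPoisson (hD : Ω.IsParallel D) (x : M) (v : TangentSpace 𝓘(ℝ, Eu d) x)
    (k l : Fin d) : dirDeriv (fun y => Ω.localPoisson x y k l) x v
      + (∑ i, Ω.localPoisson x x i l * christoffel D x v k i)
      + (∑ j, Ω.localPoisson x x k j * christoffel D x v l j) = 0 := by
  set G := christoffel D x v
  let A : M → Matrix (Fin d) (Fin d) ℂ := fun y => (Ω.gram y (frame x y))ᵀ
  let P := Ω.localPoisson x
  have hA : MatSmoothAt A x := fun i j =>
    Complex.ofRealCLM.contDiff.contMDiff.contMDiffAt.comp x (Ω.smooth x (basisVec j) (basisVec i))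
  have hP : MatSmoothAt P x := localPoisson_smooth Ω x
  let DA : Matrix (Fin d) (Fin d) ℂ := Matrix.of fun i j => dirDeriv (fun y => A y i j) x v
  let DP : Matrix (Fin d) (Fin d) ℂ := Matrix.of fun i j => dirDeriv (fun y => P y i j) x v
  have hdet : ∀ y ∈ (chartAt (Eu d) x).source, IsUnit (A y).det := fun y hy => by
    rw [Matrix.det_transpose]
    exact (Ω.det_localGram_ne_zero hy).isUnit
  have hx := mem_chart_source (Eu d) x
  have hAP : DA * P x + A x * DP = 0 := by
    ext i j
    have h0 : dirDeriv (fun y => ∑ m, A y i m * P y m j) x v = 0 := by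
      refine (dirDeriv_congr (g := fun _ => (1 : Matrix (Fin d) (Fin d) ℂ) i j) v ?_).trans
        (dirDeriv_const v _)
      filter_upwards [chart_mem_nhds (d := d) x] with y hy
      exact congrFun (congrFun (Matrix.mul_nonsing_inv (A y) (hdet y hy)) i) j
    rw [dirDeriv_sum v fun m _ => cmul (hA i m) (hP m j),
      Finset.sum_congr rfl fun m _ => dirDeriv_mul v (hA i m) (hP m j)] at h0
    rw [Matrix.add_apply, Matrix.mul_apply, Matrix.mul_apply, ← Finset.sum_add_distrib]
    exact h0
  have hDA : DA = A x * G + Gᵀ * A x := by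
    ext i j
    refine (dirDeriv_gram hD x v j i).trans ?_
    rw [Matrix.add_apply, Matrix.mul_apply, Matrix.mul_apply]
    simp only [A, frame_self, Matrix.transpose_apply]
    congr 1
    · exact Finset.sum_congr rfl fun m _ => mul_comm _ _
    · exact Finset.sum_congr rfl fun m _ => mul_comm _ _
  have hPA : P x * A x = 1 := Matrix.nonsing_inv_mul (A x) (hdet x hx)
  have hAP1 : A x * P x = 1 := Matrix.mul_nonsing_inv (A x) (hdet x hx)
  have key : DP + G * P x + P x * Gᵀ = 0 := by
    have h := congrArg (fun X => P x * X) hAP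
    simp only [Matrix.mul_add, ← Matrix.mul_assoc, hPA, Matrix.one_mul, Matrix.mul_zero, hDA,
      Matrix.add_mul] at h
    rw [Matrix.mul_assoc (P x * Gᵀ), hAP1, Matrix.mul_one] at h
    rw [← h]
    abel
  have hk := congrFun (congrFun key k) l
  rw [Matrix.add_apply, Matrix.add_apply, Matrix.mul_apply, Matrix.mul_apply] at hk
  refine Eq.trans ?_ hk
  congr 2
  exact Finset.sum_congr rfl fun m _ => mul_comm _ _

end Parallel

/-- The connection on the Weyl bundle induced by an affine connection `D`: in the chart at `x`,
`∂_v s - ∑ k j, Γ^k_j(v) y j ∂ s / ∂ y k`, the dual connection on `T^* M` extended as a derivation. -/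
def nablaZero (Ω : SymplecticForm d M) (D : AffineConnection d M) (s : RawSection d M) (x : M)
    (v : TangentSpace 𝓘(ℝ, Eu d) x) : Weyl (Ω.poisson x) :=
  fun N => coeffDeriv (localRep s x N) x v - matrixDer (christoffel D x v) (s x N)

/-- The covector `ω(v, ·)` as an element of the Weyl algebra. -/
def SymplecticForm.flat (Ω : SymplecticForm d M) (x : M) (v : TangentSpace 𝓘(ℝ, Eu d) x) :
    Weyl (Ω.poisson x) :=
  Weyl.lin fun j => ((Ω.form x v (basisVec j) : ℝ) : ℂ)

/-- `∇ s = [ω(v, ·), s] / (i ħ) + ∇₀ s + [Φ(v), s] / (i ħ)`. -/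
def nabla (Ω : SymplecticForm d M) (D : AffineConnection d M)
    (Φ : ∀ x : M, TangentSpace 𝓘(ℝ, Eu d) x →ₗ[ℝ] Weyl (Ω.poisson x)) (s : RawSection d M)
    (x : M) (v : TangentSpace 𝓘(ℝ, Eu d) x) : Weyl (Ω.poisson x) :=
  Weyl.bracket (Ω.flat x v) (s x) + nablaZero Ω D s x v + Weyl.bracket (Φ x v) (s x)

section NablaLemmas

variable {Ω : SymplecticForm d M} {D : AffineConnection d M}
  {Φ : ∀ x : M, TangentSpace 𝓘(ℝ, Eu d) x →ₗ[ℝ] Weyl (Ω.poisson x)} {x : M}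
  (v : TangentSpace 𝓘(ℝ, Eu d) x)

theorem localPoisson_self : Ω.localPoisson x x = Ω.poisson x := by
  rw [SymplecticForm.localPoisson, frame_self, SymplecticForm.poisson]

theorem nablaZero_congr {s t : RawSection d M} (h : s =ᶠ[𝓝 x] t) :
    nablaZero Ω D s x v = nablaZero Ω D t x v := by
  funext N
  rw [nablaZero, nablaZero, h.self_of_nhds]
  congr 1
  exact coeffDeriv_congr v (h.mono fun y hy => by simp only [localRep, hy])

theorem nabla_congr {s t : RawSection d M} (h : s =ᶠ[𝓝 x] t) :
    nabla Ω D Φ s x v = nabla Ω D Φ t x v := by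
  rw [nabla, nabla, nablaZero_congr v h, h.self_of_nhds]

theorem nablaZero_add {s t : RawSection d M} (hs : SmoothAt s x) (ht : SmoothAt t x) :
    nablaZero Ω D (s + t) x v = nablaZero Ω D s x v + nablaZero Ω D t x v := by
  funext N
  have h : coeffDeriv (localRep (s + t) x N) x v
      = coeffDeriv (localRep s x N) x v + coeffDeriv (localRep t x N) x v := by
    have e : localRep (s + t) x N = fun y => localRep s x N y + localRep t x N y :=
      funext fun y => linSubst_add _ _ _
    rw [e]
    ext m
    simp only [coeff_coeffDeriv, map_add]
    exact dirDeriv_add v (hs N m) (ht N m)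
  rw [Weyl.add_apply]
  simp only [nablaZero]
  rw [h, Pi.add_apply, Pi.add_apply, map_add]
  abel

theorem nablaZero_mul (hD : Ω.IsParallel D) {s t : RawSection d M} (hs : SmoothAt s x)
    (ht : SmoothAt t x) : nablaZero Ω D (Ω.rawMul s t) x v
      = Mul.mul (α := Weyl (Ω.poisson x)) (nablaZero Ω D s x v) (t x)
        + Mul.mul (α := Weyl (Ω.poisson x)) (s x) (nablaZero Ω D t x v) := by
  have hP := localPoisson_smooth Ω x
  have hm : ∀ (r k l : ℕ), coeffDeriv (fun y => moyal (Ω.localPoisson x y) r (localRep s x k y)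
        (localRep t x l y)) x v - matrixDer (christoffel D x v) (moyal (Ω.poisson x) r (s x k)
        (t x l)) = moyal (Ω.poisson x) r (nablaZero Ω D s x v k) (t x l)
          + moyal (Ω.poisson x) r (s x k) (nablaZero Ω D t x v l) := by
    intro r k l
    have h := totalDeriv_bidiff v hP (dirDeriv_localPoisson hD x v) r (hs k) (ht l)
    simp only [localRep_self, localPoisson_self] at h
    simp only [moyal]
    rw [coeffDeriv_smul v contMDiffAt_const (CoeffSmoothAt.bidiff hP r (hs k) (ht l)),
      dirDeriv_const, zero_smul, zero_add, Derivation.map_smul, ← smul_sub, h, smul_add]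
    rfl
  funext N
  have e : coeffDeriv (localRep (Ω.rawMul s t) x N) x v
      = ∑ p ∈ antidiagonal N, ∑ q ∈ antidiagonal p.2, coeffDeriv (fun y =>
        moyal (Ω.localPoisson x y) p.1 (localRep s x q.1 y) (localRep t x q.2 y)) x v := by
    rw [coeffDeriv_congr v (g := fun y => ∑ p ∈ antidiagonal N, ∑ q ∈ antidiagonal p.2,
      moyal (Ω.localPoisson x y) p.1 (localRep s x q.1 y) (localRep t x q.2 y))]
    · rw [coeffDeriv_sum v fun p _ => CoeffSmoothAt.sum fun q _ =>
        CoeffSmoothAt.moyal hP _ (hs _) (ht _)]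
      exact Finset.sum_congr rfl fun p _ => coeffDeriv_sum v fun q _ =>
        CoeffSmoothAt.moyal hP _ (hs _) (ht _)
    · filter_upwards [chart_mem_nhds (d := d) x] with y hy
      exact Ω.localRep_rawMul s t hy N
  have e' : Ω.rawMul s t x N = ∑ p ∈ antidiagonal N, ∑ q ∈ antidiagonal p.2,
      moyal (Ω.poisson x) p.1 (s x q.1) (t x q.2) := rfl
  refine Eq.trans (b := ∑ p ∈ antidiagonal N, ∑ q ∈ antidiagonal p.2,
    (moyal (Ω.poisson x) p.1 (nablaZero Ω D s x v q.1) (t x q.2)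
      + moyal (Ω.poisson x) p.1 (s x q.1) (nablaZero Ω D t x v q.2))) ?_ ?_
  · rw [nablaZero, e, e']
    simp only [map_sum, ← Finset.sum_sub_distrib, hm]
  · simp only [Finset.sum_add_distrib]
    rfl

theorem nabla_add {s t : RawSection d M} (hs : SmoothAt s x) (ht : SmoothAt t x) :
    nabla Ω D Φ (s + t) x v = nabla Ω D Φ s x v + nabla Ω D Φ t x v := by
  have hb : ∀ a : Weyl (Ω.poisson x), Weyl.bracket a ((s + t) x)
      = Weyl.bracket a (s x) + Weyl.bracket a (t x) := by
    intro a
    exact Weyl.bracket_add a (s x) (t x)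
  rw [nabla, nabla, nabla, nablaZero_add v hs ht, hb, hb]
  abel

theorem nabla_mul (hD : Ω.IsParallel D) {s t : RawSection d M} (hs : SmoothAt s x)
    (ht : SmoothAt t x) : nabla Ω D Φ (Ω.rawMul s t) x v
      = nabla Ω D Φ s x v * (show Weyl (Ω.poisson x) from t x)
        + (show Weyl (Ω.poisson x) from s x) * nabla Ω D Φ t x v := by
  have hb : ∀ a : Weyl (Ω.poisson x), Weyl.bracket a (Ω.rawMul s t x)
      = Weyl.bracket a (s x) * (show Weyl (Ω.poisson x) from t x)
        + (show Weyl (Ω.poisson x) from s x) * Weyl.bracket a (t x) := fun a =>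
    Weyl.bracket_mul a (s x) (t x)
  rw [nabla, hb, hb, nablaZero_mul v hD hs ht, nabla, nabla]
  change _ + (nablaZero Ω D s x v * (show Weyl (Ω.poisson x) from t x)
    + (show Weyl (Ω.poisson x) from s x) * nablaZero Ω D t x v) + _ = _
  rw [add_mul, add_mul, mul_add, mul_add]
  abel

end NablaLemmas


variable {Ω : SymplecticForm d M}

variable (Ω) in
/-- A Fedosov connection: a flat connection on the Weyl bundle of the form
`∇ = [A₋₁, ·] + ∇₀ + [A₁, ·] + [A₂, ·] + ⋯` with `A₋₁(v) = ω(v, ·) / (i ħ)`, with `∇₀` induced by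
a symplectic connection, and with `A_j` a one-form with values in the elements of degree `j` of
`1 / (i ħ)` times the Weyl algebra that are `1 / (i ħ)` times an element real modulo `ħ`. Degrees
count `ħ` twice and each `y` once, so that `pert = i ħ (A₁ + A₂ + ⋯)` is an arbitrary smooth
one-form of degree at least `3` which is real modulo `ħ`. -/
structure FedosovConnection where
  conn : AffineConnection d M
  conn_smooth : CovariantDerivative.ContMDiffCovariantDerivative conn ∞
  conn_symplectic : Ω.IsParallel conn
  pert : ∀ x : M, TangentSpace 𝓘(ℝ, Eu d) x →ₗ[ℝ] Weyl (Ω.poisson x)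
  pert_smooth : ∀ (x : M) (w : Eu d), SmoothAt (fun x' => pert x' (coordField x w x')) x
  pert_degree : ∀ (x : M) (v : TangentSpace 𝓘(ℝ, Eu d) x) (k : ℕ) (m : Fin d →₀ ℕ),
    2 * k + m.degree < 3 → MvPowerSeries.coeff m (pert x v k) = 0
  pert_real : ∀ (x : M) (v : TangentSpace 𝓘(ℝ, Eu d) x) (m : Fin d →₀ ℕ),
    (MvPowerSeries.coeff m (pert x v 0)).im = 0
  /-- `∇ ∘ ∇ = 0`, evaluated on the coordinate fields through `v` and `w`. -/
  flat : ∀ σ ∈ Ω.sections ⊤, ∀ (x : M) (v w : TangentSpace 𝓘(ℝ, Eu d) x),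
    nabla Ω conn pert
        (fun x' => nabla Ω conn pert (Ω.extend σ) x' (coordField x w x')) x v
      - nabla Ω conn pert
        (fun x' => nabla Ω conn pert (Ω.extend σ) x' (coordField x v x')) x w = 0

namespace FedosovConnection

variable (F : FedosovConnection Ω)

/-- `∇_v σ` at the point `x`. -/
def deriv {V : TopologicalSpace.Opens M} (σ : Ω.sections V) (x : V)
    (v : TangentSpace 𝓘(ℝ, Eu d) (x : M)) : Weyl (Ω.poisson x) :=
  nabla Ω F.conn F.pert (Ω.extend σ.1) x v

theorem deriv_mul {V : TopologicalSpace.Opens M} (σ τ : Ω.sections V) (x : V)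
    (v : TangentSpace 𝓘(ℝ, Eu d) (x : M)) :
    F.deriv (σ * τ) x v = F.deriv σ x v * τ.1 x + σ.1 x * F.deriv τ x v := by
  have e : Ω.extend (σ * τ).1 =ᶠ[𝓝 (x : M)] Ω.rawMul (Ω.extend σ.1) (Ω.extend τ.1) := by
    filter_upwards [V.isOpen.mem_nhds x.2] with y hy
    rw [SymplecticForm.rawMul, Ω.extend_apply _ hy, Ω.extend_apply _ hy, Ω.extend_apply _ hy]
    rfl
  have h := nabla_mul (Φ := F.pert) v F.conn_symplectic (σ.2 x x.2) (τ.2 x x.2)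
  rw [Ω.extend_apply _ x.2, Ω.extend_apply _ x.2] at h
  exact (nabla_congr v e).trans h

theorem deriv_add {V : TopologicalSpace.Opens M} (σ τ : Ω.sections V) (x : V)
    (v : TangentSpace 𝓘(ℝ, Eu d) (x : M)) :
    F.deriv (σ + τ) x v = F.deriv σ x v + F.deriv τ x v := by
  have e : Ω.extend (σ + τ).1 =ᶠ[𝓝 (x : M)] Ω.extend σ.1 + Ω.extend τ.1 := by
    filter_upwards [V.isOpen.mem_nhds x.2] with y hy
    rw [Pi.add_apply, Ω.extend_apply _ hy, Ω.extend_apply _ hy, Ω.extend_apply _ hy]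
    rfl
  exact (nabla_congr v e).trans (nabla_add v (σ.2 x x.2) (τ.2 x x.2))

theorem deriv_one {V : TopologicalSpace.Opens M} (x : V)
    (v : TangentSpace 𝓘(ℝ, Eu d) (x : M)) : F.deriv (1 : Ω.sections V) x v = 0 := by
  have h := F.deriv_mul 1 1 x v
  rw [mul_one] at h
  have h1 : (1 : Ω.sections V).1 x = 1 := rfl
  rw [h1, mul_one, one_mul] at h
  simpa using h

/-- The ring `Ker ∇` of flat sections over `V`. -/
def kernel (V : TopologicalSpace.Opens M) : Subring (Ω.sections V) where
  carrier := {σ | ∀ x v, F.deriv σ x v = 0}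
  zero_mem' x v := by
    have h := F.deriv_add 0 0 x v
    rw [add_zero] at h
    simpa using h
  one_mem' x v := F.deriv_one x v
  add_mem' {σ τ} hσ hτ x v := by rw [deriv_add, hσ, hτ, add_zero]
  neg_mem' {σ} hσ x v := by
    have h := F.deriv_add σ (-σ) x v
    have h0 := F.deriv_add 0 0 x v
    rw [add_zero] at h0
    rw [add_neg_cancel, hσ, zero_add] at h
    rw [← h]
    simpa using h0
  mul_mem' {σ τ} hσ hτ x v := by rw [deriv_mul, hσ, hτ, zero_mul, mul_zero, add_zero]

/-- The condition `∇(U⁻¹) U ∈ Ω¹(V, 𝒵)` that defines the Fedosov equivariance group; `𝒵` is the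
bundle of centres of the fibres. -/
def IsEquivariant {V : TopologicalSpace.Opens M} (U : (Ω.sections V)ˣ) : Prop :=
  ∀ (x : V) (v : TangentSpace 𝓘(ℝ, Eu d) (x : M)),
    F.deriv (↑U⁻¹ : Ω.sections V) x v * (U : Ω.sections V).1 x
      ∈ Subring.center (Weyl (Ω.poisson x))

end FedosovConnection

/-- Inner automorphisms: `Ad u r = u r u⁻¹`. -/
def Ad (R : Type*) [Ring R] : Rˣ →* RingAut R :=
  (MulSemiringAction.toRingAut (ConjAct Rˣ) R).comp (ConjAct.toConjAct (G := Rˣ)).toMonoidHom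

theorem Ad_apply {R : Type*} [Ring R] (u : Rˣ) (r : R) : Ad R u r = u * r * ↑u⁻¹ :=
  ConjAct.units_smul_def _ _

/-- `Inn(R | K)`: the inner automorphisms of `R` that restrict to automorphisms of `K`. -/
def relInner {R : Type*} [Ring R] (K : Subring R) : Subgroup (RingAut R) where
  carrier := {φ | φ ∈ (Ad R).range ∧ ∀ r, φ r ∈ K ↔ r ∈ K}
  one_mem' := ⟨one_mem _, fun _ => Iff.rfl⟩
  mul_mem' {φ ψ} hφ hψ := ⟨mul_mem hφ.1 hψ.1, fun r => (hφ.2 (ψ r)).trans (hψ.2 r)⟩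
  inv_mem' {φ} hφ := ⟨inv_mem hφ.1, fun r => by
    rw [← hφ.2 (φ⁻¹ r)]
    exact iff_of_eq (congrArg (· ∈ K) (φ.apply_symm_apply r))⟩

/-- The group of invertible elements of the centre. -/
def centralUnits (R : Type*) [Ring R] : Subgroup Rˣ := (Subring.center R).toSubmonoid.units

/-- The group `(Ker ∇)ˣ` over `V`. -/
def FedosovConnection.flatUnits (F : FedosovConnection Ω) (V : TopologicalSpace.Opens M) :
    Subgroup (Ω.sections V)ˣ := (F.kernel V).toSubmonoid.units

open CategoryTheory Opposite in
/-- The subpresheaf of groups given by subgroups that are stable under restriction. -/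
def subgroupPresheaf {X : TopCat.{u}} (F : TopCat.Presheaf GrpCat.{u} X)
    (S : ∀ V : TopologicalSpace.Opens X, Subgroup (F.obj (op V)))
    (h : ∀ {V V' : TopologicalSpace.Opens X} (i : V' ⟶ V), ∀ g ∈ S V, F.map i.op g ∈ S V') :
    TopCat.Presheaf GrpCat.{u} X where
  obj V := GrpCat.of (S V.unop)
  map i := GrpCat.ofHom (((F.map i).hom.comp (S _).subtype).codRestrict (S _)
    fun g => h i.unop g.1 g.2)
  map_id V := by
    ext g
    exact congrArg (fun f => f g.1) (F.map_id V)
  map_comp i j := by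
    ext g
    exact congrArg (fun f => f g.1) (F.map_comp i j)

/-- `H¹(V) = 0`: every smooth closed complex `1`-form on `V` is exact. The values of `α` and `f`
outside `V` play no role. -/
def FirstDeRhamVanishes (V : TopologicalSpace.Opens M) : Prop :=
  ∀ α : ∀ x : M, TangentSpace 𝓘(ℝ, Eu d) x →L[ℝ] ℂ,
    (∀ x ∈ V, ∀ w : Eu d,
      ContMDiffAt 𝓘(ℝ, Eu d) 𝓘(ℝ, ℂ) ∞ (fun x' => α x' (coordField x w x')) x) →
    (∀ x ∈ V, ∀ v w : TangentSpace 𝓘(ℝ, Eu d) x,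
      dirDeriv (fun x' => α x' (coordField x w x')) x v
        - dirDeriv (fun x' => α x' (coordField x v x')) x w = 0) →
    ∃ f : M → ℂ, (∀ x ∈ V, ContMDiffAt 𝓘(ℝ, Eu d) 𝓘(ℝ, ℂ) ∞ f x) ∧
      ∀ x ∈ V, ∀ v : TangentSpace 𝓘(ℝ, Eu d) x, dirDeriv f x v = α x v

variable (Ω) in
/-- Smooth maps `φ : M → M` with `φ^* ω = ω`. -/
structure SymplecticForm.IsSymplecticMap (φ : M → M) : Prop where
  contMDiff : ContMDiff 𝓘(ℝ, Eu d) 𝓘(ℝ, Eu d) ∞ φ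
  preserves : ∀ (x : M) (v w : TangentSpace 𝓘(ℝ, Eu d) x),
    Ω.form (φ x) (mfderiv 𝓘(ℝ, Eu d) 𝓘(ℝ, Eu d) φ x v) (mfderiv 𝓘(ℝ, Eu d) 𝓘(ℝ, Eu d) φ x w)
      = Ω.form x v w

/-- Pull-back of sections of the Weyl bundle: `(φ^* s)(x) = s(φ(x)) ∘ Tφ_x`. -/
def rawPullback (φ : M → M) (s : RawSection d M) : RawSection d M :=
  fun x N => linSubst (matrixOf (mfderiv 𝓘(ℝ, Eu d) 𝓘(ℝ, Eu d) φ x)) (s (φ x) N)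

theorem smoothAt_rawPullback {φ : M → M} (hφ : ContMDiff 𝓘(ℝ, Eu d) 𝓘(ℝ, Eu d) ∞ φ)
    {s : RawSection d M} {x : M} (hs : SmoothAt s (φ x)) : SmoothAt (rawPullback φ s) x := by
  intro N
  let T : M → Eu d →L[ℝ] Eu d := inTangentCoordinates 𝓘(ℝ, Eu d) 𝓘(ℝ, Eu d) id φ
    (fun y => mfderiv 𝓘(ℝ, Eu d) 𝓘(ℝ, Eu d) φ y) x
  have hT : ContMDiffAt 𝓘(ℝ, Eu d) 𝓘(ℝ, Eu d →L[ℝ] Eu d) ∞ T x :=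
    ContMDiffAt.mfderiv_const (hφ x) le_rfl
  have hTm : MatSmoothAt (fun y => matrixOf (T y)) x := by
    intro i j
    let L : (Eu d →L[ℝ] Eu d) →L[ℝ] ℂ := Complex.ofRealCLM.comp
      ((EuclideanSpace.proj i : Eu d →L[ℝ] ℝ).comp
        (ContinuousLinearMap.apply ℝ (Eu d) (basisVec j)))
    exact L.contDiff.contMDiff.contMDiffAt.comp x hT
  have hN : CoeffSmoothAt (fun y => localRep s (φ x) N (φ y)) x := fun m =>
    ContMDiffAt.comp
      (g := fun z => MvPowerSeries.coeff m (localRep s (φ x) N z)) x (hs N m) (hφ x)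
  refine (CoeffSmoothAt.linSubst hTm hN).congr ?_
  filter_upwards [chart_mem_nhds (d := d) x,
    (hφ.continuous.continuousAt).preimage_mem_nhds (chart_mem_nhds (d := d) (φ x))] with y hy hy'
  have hTy : T y = (tangentCoordChange 𝓘(ℝ, Eu d) (φ y) (φ x) (φ y)).comp
      ((show Eu d →L[ℝ] Eu d from mfderiv 𝓘(ℝ, Eu d) 𝓘(ℝ, Eu d) φ y).comp (frame x y)) :=
    inTangentCoordinates_eq id φ (fun y => mfderiv 𝓘(ℝ, Eu d) 𝓘(ℝ, Eu d) φ y) hy hy'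
  have hinv : matrixOf (frame (φ x) (φ y)) *
      matrixOf (tangentCoordChange 𝓘(ℝ, Eu d) (φ y) (φ x) (φ y)) = 1 :=
    mul_eq_one_comm.1 (matrixOf_frame_inv hy')
  change linSubst (matrixOf (frame x y)) (linSubst (matrixOf (show Eu d →L[ℝ] Eu d from
    mfderiv 𝓘(ℝ, Eu d) 𝓘(ℝ, Eu d) φ y)) (s (φ y) N)) = linSubst (matrixOf (T y))
      (linSubst (matrixOf (frame (φ x) (φ y))) (s (φ y) N))
  rw [linSubst_comp, linSubst_comp, hTy, matrixOf_comp, matrixOf_comp,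
    ← Matrix.mul_assoc (matrixOf (frame (φ x) (φ y))), hinv, Matrix.one_mul]

theorem poisson_pullback {φ : M → M} (hφ : Ω.IsSymplecticMap φ) (x : M) :
    Ω.poisson (φ x) = matrixOf (mfderiv 𝓘(ℝ, Eu d) 𝓘(ℝ, Eu d) φ x) * Ω.poisson x *
      (matrixOf (mfderiv 𝓘(ℝ, Eu d) 𝓘(ℝ, Eu d) φ x))ᵀ := by
  let L : Eu d →L[ℝ] Eu d := mfderiv 𝓘(ℝ, Eu d) 𝓘(ℝ, Eu d) φ x
  have hg : Ω.gram (φ x) L = Ω.gram x (ContinuousLinearMap.id ℝ _) := by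
    ext i j
    exact congrArg (fun t : ℝ => (t : ℂ)) (hφ.preserves x (basisVec i) (basisVec j))
  have hdet : (matrixOf L).det ≠ 0 := by
    have h := Ω.det_gram_ne_zero x
    rw [← hg, Ω.gram_eq, Matrix.det_mul] at h
    exact right_ne_zero_of_mul h
  have h := Ω.poisson_of_gram (x := φ x) (L := L) (Matrix.nonsing_inv_mul _ hdet.isUnit)
  rw [hg] at h
  exact h

/-- Pull-back `φ^*` of global sections of the Weyl bundle, as a ring endomorphism of `Γ(𝒲)`. -/
def SymplecticForm.IsSymplecticMap.pullback {φ : M → M} (hφ : Ω.IsSymplecticMap φ) :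
    Ω.sections ⊤ →+* Ω.sections ⊤ where
  toFun σ := ⟨fun x => Weyl.subst (matrixOf (mfderiv 𝓘(ℝ, Eu d) 𝓘(ℝ, Eu d) φ x))
    (σ.1 ⟨φ x, trivial⟩), fun x _ => by
      refine SymplecticForm.smoothAt_congr
        (smoothAt_rawPullback hφ.contMDiff (σ.2 (φ x) trivial))
        (Filter.Eventually.of_forall fun y => ?_)
      rw [Ω.extend_apply _ (show y ∈ (⊤ : TopologicalSpace.Opens M) from trivial)]
      funext N
      rw [rawPullback,
        Ω.extend_apply _ (show φ y ∈ (⊤ : TopologicalSpace.Opens M) from trivial)]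
      rfl⟩
  map_one' := Subtype.ext (funext fun x => Weyl.subst_one (P := Ω.poisson (φ x)) _)
  map_mul' _ _ := Subtype.ext (funext fun x => Weyl.subst_mul (poisson_pullback hφ x) _ _)
  map_zero' := Subtype.ext (funext fun _ => funext fun _ => linSubst_zero _)
  map_add' _ _ := Subtype.ext (funext fun _ => Weyl.subst_add _ _ _)

/-- The automorphism `a` of `Ker ∇` is `Ad U ∘ φ^*`. -/
def FedosovConnection.IsAdPullback (F : FedosovConnection Ω) {φ : M → M}
    (hφ : Ω.IsSymplecticMap φ) (a : RingAut (F.kernel ⊤)) (U : (Ω.sections ⊤)ˣ) : Prop :=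
  ∀ k : F.kernel ⊤, (a k : Ω.sections ⊤) = Ad (Ω.sections ⊤) U (hφ.pullback k)

end Manifold

end Fedosov

end

open Fedosov

/-! All statements about the group rest on one equivalence, `isEquivariant_iff_kernel`: a unit `U`
is equivariant exactly when conjugation by `U` maps `Ker ∇` into itself. For flat `k`, the Leibniz
rule gives `∇(U k U⁻¹) = U [U⁻¹∇U, k] U⁻¹`. If `U⁻¹∇U` is central this vanishes. Conversely, if it
vanishes for all flat `k`, then `U⁻¹∇U` commutes at every point with the values of all flat
sections, and one has to know that only fibrewise constants, i.e. central elements, do so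
(`isConst_of_commute_kernel`).

This centralizer statement follows from Fedosov's existence theorem. Write `∇ = -δ + rem`, where `δ
= ∑ dxⁱ ∂/∂yⁱ` is the Koszul differential and `rem` does not lower the degree in which `ħ` counts
twice. For a smooth function `f`, the equation `s = f + δ⁻¹ rem s` has a solution, since `δ⁻¹`
raises the degree and the right side is a contraction. The form `b = ∇s` then satisfies `δ⁻¹ b = 0`
and, by flatness of `∇`, `δ b = rem b`; induction on the degree gives `b = 0`. The section `s`
begins with `f + ∑ ∂ᵢf yⁱ`, so flat sections realize every linear term at a given point. As the
bracket with a linear function is a derivative and `ω` is nondegenerate, a second induction on the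
degree shows that an element commuting with them all has no dependence on `y`.

The smoothness of `s` needs some care. The fibre `T_x M` is identified with the model space by the
preferred chart at `x`, which need not vary continuously with `x`. Hence `∇₀` is rewritten in one
fixed chart (`linSubst_frame_nablaZero`), using the transformation law of the connection
coefficients.

Given the equivalence, normality, the quotient isomorphism and the invariance under group actions
are formal, and the sheaf property holds because the defining condition is pointwise and involves
only the germ of `U`. If `H¹(V) = 0`, the coefficients of `ħ` in `U⁻¹∇U` are complex one-forms,
closed by `∇∇U = 0` (`closed_logForm`). Integrating each of them and exponentiating in `ℂ⟦ħ⟧` gives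
a central unit `z` with the same logarithmic derivative as `U`, and `z⁻¹U` is flat. -/

noncomputable section

namespace Fedosov

/-! ### Bidifferential operators: loss of degree and linear arguments. -/

section FormalPowerSeries

variable {d : ℕ}

/-- Characteristic zero enters here: the coefficient at `m` appears in `∂ᵢ a` at `m - eᵢ` with the
factor `mᵢ`, which is nonzero for some `i` unless `m = 0`. -/
theorem pd_eq_zero_iff (a : FormalFun d) :
    (∀ i, pd i a = 0) ↔ ∀ m : Fin d →₀ ℕ, m ≠ 0 → MvPowerSeries.coeff m a = 0 := by
  constructor
  · intro h m hm
    obtain ⟨i, hi⟩ : ∃ i, m i ≠ 0 := by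
      by_contra! h0
      exact hm (Finsupp.ext h0)
    have h1 := congrArg (MvPowerSeries.coeff (m - Finsupp.single i 1)) (h i)
    have h2 : m - Finsupp.single i 1 + Finsupp.single i 1 = m :=
      tsub_add_cancel_of_le (Finsupp.single_le_iff.2 (Nat.one_le_iff_ne_zero.2 hi))
    rw [MvPowerSeries.coeff_pderiv, h2, map_zero] at h1
    refine (mul_eq_zero.1 h1).resolve_right ?_
    exact Nat.cast_add_one_ne_zero _
  · intro h i
    ext m
    rw [MvPowerSeries.coeff_pderiv, h _ (by
      intro h0
      have := DFunLike.congr_fun h0 i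
      simp at this), zero_mul, map_zero]

theorem coeff_pd_eq_zero {a : FormalFun d} {k : ℕ}
    (h : ∀ m : Fin d →₀ ℕ, m.degree < k → MvPowerSeries.coeff m a = 0) (i : Fin d)
    (m : Fin d →₀ ℕ) (hm : m.degree < k - 1) : MvPowerSeries.coeff m (pd i a) = 0 := by
  rw [MvPowerSeries.coeff_pderiv, h _ (by simp; omega), zero_mul]

/-- Each of the `r` steps differentiates both factors once and so costs two degrees; this is what
the weight `2` of `ħ` compensates in the Moyal product. -/
theorem coeff_bidiff_eq_zero (P : Matrix (Fin d) (Fin d) ℂ) (r : ℕ) {a b : FormalFun d} {k l : ℕ}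
    (ha : ∀ m : Fin d →₀ ℕ, m.degree < k → MvPowerSeries.coeff m a = 0)
    (hb : ∀ m : Fin d →₀ ℕ, m.degree < l → MvPowerSeries.coeff m b = 0)
    (m : Fin d →₀ ℕ) (hm : m.degree + 2 * r < k + l) :
    MvPowerSeries.coeff m (bidiff P r a b) = 0 := by
  classical
  induction r generalizing a b k l with
  | zero =>
    rw [bidiff, MvPowerSeries.coeff_mul]
    refine Finset.sum_eq_zero fun p hp => ?_
    rw [Finset.HasAntidiagonal.mem_antidiagonal] at hp
    have hd : p.1.degree + p.2.degree = m.degree := by rw [← hp, map_add]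
    rcases lt_or_ge p.1.degree k with h | h
    · rw [ha _ h, zero_mul]
    · rw [hb _ (by omega), mul_zero]
  | succ r ih =>
    simp only [bidiff_succ, map_sum, map_smul]
    refine Finset.sum_eq_zero fun i _ => Finset.sum_eq_zero fun j _ => ?_
    rw [ih (coeff_pd_eq_zero ha i) (coeff_pd_eq_zero hb j) (by omega), smul_zero]

theorem bidiff_succ_eq_zero_left (P : Matrix (Fin d) (Fin d) ℂ) (r : ℕ) {a : FormalFun d}
    (h : ∀ i, pd i a = 0) (b : FormalFun d) : bidiff P (r + 1) a b = 0 := by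
  simp only [bidiff_succ, h, ← bidiffL_apply, map_zero, LinearMap.zero_apply, smul_zero,
    Finset.sum_const_zero]

theorem bidiff_succ_eq_zero_right (P : Matrix (Fin d) (Fin d) ℂ) (r : ℕ) {a : FormalFun d}
    (h : ∀ i, pd i a = 0) (b : FormalFun d) : bidiff P (r + 1) b a = 0 := by
  simp only [bidiff_succ, h, ← bidiffL_apply, map_zero, smul_zero, Finset.sum_const_zero]

theorem pd_C (i : Fin d) (c : ℂ) : pd i (MvPowerSeries.C c) = 0 :=
  (pd i).map_algebraMap c

theorem pd_linear (i : Fin d) (c : Fin d → ℂ) :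
    pd i (∑ j, c j • MvPowerSeries.X j : FormalFun d) = MvPowerSeries.C (c i) := by
  simp [map_sum, MvPowerSeries.pderiv_X, Pi.single_apply,
    MvPowerSeries.smul_eq_C_mul]

theorem bidiff_one_linear_left (P : Matrix (Fin d) (Fin d) ℂ) (c : Fin d → ℂ) (a : FormalFun d) :
    bidiff P 1 (∑ j, c j • MvPowerSeries.X j) a = ∑ i, ∑ j, (P i j * c i) • pd j a := by
  simp only [bidiff, pd_linear, ← MvPowerSeries.smul_eq_C_mul, smul_smul]

theorem bidiff_one_linear_right (P : Matrix (Fin d) (Fin d) ℂ) (c : Fin d → ℂ) (a : FormalFun d) :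
    bidiff P 1 a (∑ j, c j • MvPowerSeries.X j) = ∑ i, ∑ j, (P j i * c i) • pd j a := by
  simp only [bidiff, pd_linear, mul_comm _ (MvPowerSeries.C _), ← MvPowerSeries.smul_eq_C_mul,
    smul_smul]
  exact Finset.sum_comm

/-- Second derivatives of a linear function vanish, so Moyal products with linear functions stop at
first order in `ħ`. -/
theorem bidiff_linear_left_of_two_le (P : Matrix (Fin d) (Fin d) ℂ) (r : ℕ) (c : Fin d → ℂ)
    (a : FormalFun d) : bidiff P (r + 2) (∑ j, c j • MvPowerSeries.X j) a = 0 := by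
  rw [bidiff_succ]
  refine Finset.sum_eq_zero fun i _ => Finset.sum_eq_zero fun j _ => ?_
  rw [bidiff_succ_eq_zero_left P r (fun k => by rw [pd_linear, pd_C]), smul_zero]

theorem bidiff_linear_right_of_two_le (P : Matrix (Fin d) (Fin d) ℂ) (r : ℕ) (c : Fin d → ℂ)
    (a : FormalFun d) : bidiff P (r + 2) a (∑ j, c j • MvPowerSeries.X j) = 0 := by
  rw [bidiff_succ]
  refine Finset.sum_eq_zero fun i _ => Finset.sum_eq_zero fun j _ => ?_
  rw [bidiff_succ_eq_zero_right P r (fun k => by rw [pd_linear, pd_C]), smul_zero]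

end FormalPowerSeries

/-! ### The degree filtration and the centre of the Weyl algebra. -/

namespace Weyl

variable {d : ℕ} {P : Matrix (Fin d) (Fin d) ℂ}

/-- All coefficients of total degree less than `k` vanish, where `ħ` has degree `2` and the
coordinates have degree `1`. -/
def OrdGE (k : ℕ) (a : Weyl P) : Prop :=
  ∀ (N : ℕ) (m : Fin d →₀ ℕ), 2 * N + m.degree < k → MvPowerSeries.coeff m (a N) = 0

/-- The Moyal product respects the grading: the factor `ħ ^ r` contributes `2 r` and the `r`-th
bidifferential operator loses `2 r`. -/
theorem OrdGE.mul {k l : ℕ} {a b : Weyl P} (ha : OrdGE k a) (hb : OrdGE l b) :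
    OrdGE (k + l) (a * b) := by
  intro N m hm
  simp only [mul_apply, map_sum]
  refine Finset.sum_eq_zero fun p hp => Finset.sum_eq_zero fun q hq => ?_
  rw [Finset.HasAntidiagonal.mem_antidiagonal] at hp hq
  -- The coefficient of `ħ ^ q` starts in polynomial degree `k - 2 q`. Truncation of the subtraction
  -- only makes the bound larger, which is harmless.
  rw [moyal, map_smul, coeff_bidiff_eq_zero P p.1 (k := k - 2 * q.1) (l := l - 2 * q.2)
    (fun m' hm' => ha _ _ (by omega)) (fun m' hm' => hb _ _ (by omega)) m (by omega), smul_zero]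

theorem OrdGE.sub {k : ℕ} {a b : Weyl P} (ha : OrdGE k a) (hb : OrdGE k b) : OrdGE k (a - b) :=
  fun N m hm => by rw [sub_apply, map_sub, ha N m hm, hb N m hm, sub_zero]

theorem OrdGE.mono {k l : ℕ} {a : Weyl P} (ha : OrdGE k a) (h : l ≤ k) : OrdGE l a :=
  fun N m hm => ha N m (by omega)

theorem ordGE_zero (a : Weyl P) : OrdGE 0 a := fun _ _ h => absurd h (Nat.not_lt_zero _)

/-- Division of the commutator by `i ħ` costs the two degrees in `j + 2`. -/
theorem OrdGE.bracket {j k l : ℕ} {a b : Weyl P} (ha : OrdGE k a) (hb : OrdGE l b)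
    (h : j + 2 ≤ k + l) : OrdGE j (bracket a b) := by
  intro N m hm
  have h2 := ((ha.mul hb).sub ((hb.mul ha).mono (add_comm k l).le)) (N + 1) m (by omega)
  rw [Weyl.bracket, map_smul, h2, smul_zero]

theorem bracket_sub (a b c : Weyl P) : bracket a (b - c) = bracket a b - bracket a c := by
  have h := bracket_add a (b - c) c
  rw [sub_add_cancel] at h
  rw [h, add_sub_cancel_right]

theorem bracket_swap (a b : Weyl P) : bracket a b = -bracket b a := by
  ext1 N
  have h : a * b - b * a = -(b * a - a * b) := (neg_sub _ _).symm
  rw [bracket, h]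
  exact smul_neg _ _

theorem bracket_eq_zero_of_commute {a b : Weyl P} (h : a * b = b * a) : bracket a b = 0 := by
  ext1 N
  rw [bracket, h, sub_self, zero_apply, smul_zero, zero_apply]

theorem lin_apply_zero (c : Fin d → ℂ) :
    (lin c : Weyl P) 0 = ∑ j, c j • MvPowerSeries.X j := Pi.single_eq_same 0 _

theorem lin_apply_succ (c : Fin d → ℂ) (N : ℕ) : (lin c : Weyl P) (N + 1) = 0 :=
  Pi.single_eq_of_ne (Nat.succ_ne_zero N) _

theorem moyal_zero_left (r : ℕ) (b : FormalFun d) : moyal P r 0 b = 0 := by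
  rw [moyal, ← bidiffL_apply, map_zero, LinearMap.zero_apply, smul_zero]

theorem moyal_zero_right (r : ℕ) (b : FormalFun d) : moyal P r b 0 = 0 := by
  rw [moyal, ← bidiffL_apply, map_zero, smul_zero]

theorem lin_mul_apply_succ (c : Fin d → ℂ) (a : Weyl P) (N : ℕ) :
    (lin c * a : Weyl P) (N + 1) = (∑ j, c j • MvPowerSeries.X j) * a (N + 1)
      + (Complex.I / 2) • ∑ i, ∑ j, (P i j * c i) • pd j (a N) := by
  -- A linear function sits in order `ħ ^ 0`, so only the pair `(0, n)` contributes.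
  have h0 : ∀ r n, ∑ q ∈ antidiagonal n, moyal P r ((lin c : Weyl P) q.1) (a q.2)
      = moyal P r (∑ j, c j • MvPowerSeries.X j) (a n) := by
    intro r n
    rw [Finset.sum_eq_single (0, n), lin_apply_zero]
    · rintro ⟨k, l⟩ h hne
      obtain ⟨k, rfl⟩ : ∃ t, k = t + 1 := by
        refine Nat.exists_eq_succ_of_ne_zero ?_
        rintro rfl
        simp_all [Finset.HasAntidiagonal.mem_antidiagonal]
      rw [lin_apply_succ, moyal_zero_left]
    · simp
  simp only [mul_apply, h0]
  rw [Finset.Nat.sum_antidiagonal_succ, moyal_zero]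
  congr 1
  cases N with
  | zero => simp [moyal, bidiff_one_linear_left]
  | succ N =>
    rw [Finset.Nat.sum_antidiagonal_succ]
    refine (congrArg₂ (· + ·) ?_ (Finset.sum_eq_zero fun p _ => ?_)).trans (add_zero _)
    · simp [moyal, bidiff_one_linear_left]
    · rw [moyal, bidiff_linear_left_of_two_le, smul_zero]

theorem mul_lin_apply_succ (c : Fin d → ℂ) (a : Weyl P) (N : ℕ) :
    (a * lin c : Weyl P) (N + 1) = (∑ j, c j • MvPowerSeries.X j) * a (N + 1)
      + (Complex.I / 2) • ∑ i, ∑ j, (P j i * c i) • pd j (a N) := by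
  have h0 : ∀ r n, ∑ q ∈ antidiagonal n, moyal P r (a q.1) ((lin c : Weyl P) q.2)
      = moyal P r (a n) (∑ j, c j • MvPowerSeries.X j) := by
    intro r n
    rw [Finset.sum_eq_single (n, 0), lin_apply_zero]
    · rintro ⟨l, k⟩ h hne
      obtain ⟨k, rfl⟩ : ∃ t, k = t + 1 := by
        refine Nat.exists_eq_succ_of_ne_zero ?_
        rintro rfl
        simp_all [Finset.HasAntidiagonal.mem_antidiagonal]
      rw [lin_apply_succ, moyal_zero_right]
    · simp
  simp only [mul_apply, h0]
  rw [Finset.Nat.sum_antidiagonal_succ, moyal_zero, mul_comm (a (N + 1))]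
  congr 1
  cases N with
  | zero => simp [moyal, bidiff_one_linear_right]
  | succ N =>
    rw [Finset.Nat.sum_antidiagonal_succ]
    refine (congrArg₂ (· + ·) ?_ (Finset.sum_eq_zero fun p _ => ?_)).trans (add_zero _)
    · simp [moyal, bidiff_one_linear_right]
    · rw [moyal, bidiff_linear_right_of_two_le, smul_zero]

/-- In the commutator the commutative products cancel and, by antisymmetry of `P`, the two
first-order terms add up. Bracketing with a linear function is therefore exactly a constant vector
field, without corrections in `ħ`. -/
theorem bracket_lin (hP : Pᵀ = -P) (c : Fin d → ℂ) (a : Weyl P) (N : ℕ) :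
    bracket (lin c) a N = ∑ i, ∑ j, (c i * P i j) • pd j (a N) := by
  have hP' : ∀ i j, P j i = -P i j := fun i j => congrFun (congrFun hP i) j
  rw [bracket, sub_apply, lin_mul_apply_succ, mul_lin_apply_succ, add_sub_add_left_eq_sub]
  rw [← smul_sub, ← Finset.sum_sub_distrib, smul_smul, Finset.smul_sum]
  refine Finset.sum_congr rfl fun i _ => ?_
  rw [← Finset.sum_sub_distrib, Finset.smul_sum]
  refine Finset.sum_congr rfl fun j _ => ?_
  rw [← sub_smul, smul_smul, hP' i j]
  congr 1
  have hI := Complex.I_ne_zero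
  field_simp
  ring

/-- The elements without dependence on the coordinates. -/
def IsConst (a : Weyl P) : Prop := ∀ (i : Fin d) (N : ℕ), pd i (a N) = 0

/-- Bidifferential operators of positive order kill constants, leaving a convolution in `ħ`. The
product in the other order gives the same convolution, whence centrality. -/
theorem IsConst.mul_apply {a : Weyl P} (h : IsConst a) (b : Weyl P) (N : ℕ) :
    (a * b) N = ∑ q ∈ antidiagonal N, a q.1 * b q.2 := by
  rw [Weyl.mul_apply, Finset.sum_eq_single (0, N)]
  · exact Finset.sum_congr rfl fun q _ => moyal_zero P _ _
  · rintro ⟨r, s⟩ hr hne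
    obtain ⟨r, rfl⟩ : ∃ t, r = t + 1 := by
      refine Nat.exists_eq_succ_of_ne_zero ?_
      rintro rfl
      simp_all [Finset.HasAntidiagonal.mem_antidiagonal]
    refine Finset.sum_eq_zero fun q _ => ?_
    rw [moyal, bidiff_succ_eq_zero_left P r (fun i => h i _), smul_zero]
  · simp

theorem IsConst.mul_apply' {a : Weyl P} (h : IsConst a) (b : Weyl P) (N : ℕ) :
    (b * a) N = ∑ q ∈ antidiagonal N, a q.1 * b q.2 := by
  rw [Weyl.mul_apply, Finset.sum_eq_single (0, N)]
  · rw [← Finset.Nat.sum_antidiagonal_swap]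
    exact Finset.sum_congr rfl fun q _ => (moyal_zero P _ _).trans (mul_comm _ _)
  · rintro ⟨r, s⟩ hr hne
    obtain ⟨r, rfl⟩ : ∃ t, r = t + 1 := by
      refine Nat.exists_eq_succ_of_ne_zero ?_
      rintro rfl
      simp_all [Finset.HasAntidiagonal.mem_antidiagonal]
    refine Finset.sum_eq_zero fun q _ => ?_
    rw [moyal, bidiff_succ_eq_zero_right P r (fun i => h i _), smul_zero]
  · simp

theorem IsConst.mem_center {a : Weyl P} (h : IsConst a) : a ∈ Subring.center (Weyl P) :=
  Subring.mem_center_iff.2 fun b => by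
    ext1 N
    rw [h.mul_apply, h.mul_apply']

theorem pd_eq_zero_of_bracket_lin {hP : Pᵀ = -P} (hdet : IsUnit P.det) {k : ℕ} {a : Weyl P}
    (h : ∀ c : Fin d → ℂ, OrdGE k (bracket (lin c) a)) (j : Fin d) (N : ℕ) (m : Fin d →₀ ℕ)
    (hm : 2 * N + m.degree < k) : MvPowerSeries.coeff m (pd j (a N)) = 0 := by
  -- Row `j` of `P⁻¹` turns the vector field of `bracket_lin` into `∂/∂yʲ`.
  have h1 := h (fun i => P⁻¹ j i) N m hm
  rw [bracket_lin hP, Finset.sum_comm] at h1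
  have h2 : ∀ l, ∑ i, (P⁻¹ j i * P i l) = if j = l then 1 else 0 := fun l => by
    rw [← Matrix.mul_apply, Matrix.nonsing_inv_mul P hdet, Matrix.one_apply]
  simp only [← Finset.sum_smul, h2, ite_smul, one_smul, zero_smul] at h1
  simpa using h1

/-- An element that commutes with elements having arbitrary linear terms and only constants in
lower degree is constant. -/
theorem isConst_of_commute (hP : Pᵀ = -P) (hdet : IsUnit P.det) {a : Weyl P}
    (h : ∀ c : Fin d → ℂ, ∃ s z : Weyl P, IsConst z ∧ OrdGE 2 (s - z - lin c) ∧ a * s = s * a) :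
    IsConst a := by
  -- Removing the constant terms changes `a` by a central element, so `a'` satisfies the same
  -- commutation relations. It remains to show `a' = 0`, by raising its order step by step.
  let a' : Weyl P := fun N => a N - MvPowerSeries.C (MvPowerSeries.coeff 0 (a N))
  have hpd : ∀ i N, pd i (a' N) = pd i (a N) := fun i N => by
    simp only [a', map_sub, pd_C, sub_zero]
  have hconst : IsConst (a - a') := fun i N => by
    rw [sub_apply, map_sub, hpd, sub_self]
  have hord : ∀ k, OrdGE k a' := by
    intro k
    induction k with
    | zero => exact ordGE_zero a'
    | succ k ih =>
      intro N m hm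
      rcases eq_or_ne m 0 with rfl | hm0
      · simp [a']
      obtain ⟨i, hi⟩ : ∃ i, m i ≠ 0 := by
        by_contra! h0
        exact hm0 (Finsupp.ext h0)
      have hmi : m - Finsupp.single i 1 + Finsupp.single i 1 = m :=
        tsub_add_cancel_of_le (Finsupp.single_le_iff.2 (Nat.one_le_iff_ne_zero.2 hi))
      have hdeg : (m - Finsupp.single i 1).degree + 1 = m.degree := by
        conv_rhs => rw [← hmi, map_add, Finsupp.degree_single]
      have key : ∀ c : Fin d → ℂ, OrdGE k (bracket (lin c) a') := by
        intro c
        obtain ⟨s, z, hz, hs, hcomm⟩ := h c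
        -- The bracket with `lin c` alone could lower the degree by one. As `a'` commutes with `s`
        -- and `z`, it equals a bracket with a remainder of order two, which loses nothing.
        have h1 : bracket a' (s - z - lin c) = -bracket a' (lin c) := by
          have hs' : a' * s = s * a' := by
            have := Subring.mem_center_iff.1 hconst.mem_center s
            rw [mul_sub, sub_mul, hcomm] at this
            exact (sub_right_injective this).symm
          rw [bracket_sub, bracket_sub, bracket_eq_zero_of_commute hs',
            bracket_eq_zero_of_commute (Subring.mem_center_iff.1 hz.mem_center a'), sub_zero,
            zero_sub]
        rw [bracket_swap, ← h1]
        exact ih.bracket hs (by omega)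
      -- The derivatives of `a'` vanish below total degree `k`, hence its nonconstant coefficients
      -- vanish in degree `k` too.
      have h2 := pd_eq_zero_of_bracket_lin (hP := hP) hdet key i N (m - Finsupp.single i 1)
        (by omega)
      rw [MvPowerSeries.coeff_pderiv, hmi] at h2
      refine (mul_eq_zero.1 h2).resolve_right ?_
      exact Nat.cast_add_one_ne_zero _
  intro i N
  rw [← hpd]
  have : a' N = 0 := MvPowerSeries.ext fun m => by
    rw [hord (2 * N + m.degree + 1) N m (by omega), map_zero]
  rw [this, map_zero]

theorem mem_center_iff_isConst (hP : Pᵀ = -P) (hdet : IsUnit P.det) {a : Weyl P} :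
    a ∈ Subring.center (Weyl P) ↔ IsConst a := by
  refine ⟨fun h => isConst_of_commute hP hdet fun c => ⟨lin c, 0, fun i N => ?_, fun N m _ => ?_,
    (Subring.mem_center_iff.1 h _).symm⟩, IsConst.mem_center⟩
  · rw [zero_apply, map_zero]
  · rw [sub_zero, sub_self, zero_apply, map_zero]

end Weyl

section Manifold

variable {d : ℕ} {M : Type u} [TopologicalSpace M] [ChartedSpace (Eu d) M]
  [IsManifold 𝓘(ℝ, Eu d) ∞ M]

/-! ### The Poisson matrix of the symplectic form and the term of degree `-1`. -/

namespace SymplecticForm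

variable (Ω : SymplecticForm d M)

theorem form_swap (x : M) (v w : TangentSpace 𝓘(ℝ, Eu d) x) : Ω.form x v w = -Ω.form x w v := by
  have h := Ω.alternating x (v + w)
  simp only [map_add, add_apply, Ω.alternating, zero_add, add_zero] at h
  linarith

theorem gram_transpose (x : M) :
    (Ω.gram x (ContinuousLinearMap.id ℝ _))ᵀ = -Ω.gram x (ContinuousLinearMap.id ℝ _) := by
  ext i j
  simp only [gram, Matrix.transpose_apply, Matrix.neg_apply, Matrix.of_apply,
    ← Complex.ofReal_neg]
  exact congrArg (fun t : ℝ => (t : ℂ)) (Ω.form_swap x _ _)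

theorem isUnit_det_gram_transpose (x : M) :
    IsUnit (Ω.gram x (ContinuousLinearMap.id ℝ _))ᵀ.det := by
  rw [Matrix.det_transpose]
  exact (Ω.det_gram_ne_zero x).isUnit

theorem gram_mul_poisson (x : M) :
    Ω.gram x (ContinuousLinearMap.id ℝ _) * Ω.poisson x = -1 := by
  have h := Matrix.mul_nonsing_inv _ (Ω.isUnit_det_gram_transpose x)
  rw [← neg_eq_iff_eq_neg, ← Matrix.neg_mul, ← gram_transpose]
  exact h

theorem poisson_transpose (x : M) : (Ω.poisson x)ᵀ = -Ω.poisson x := by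
  have h1 := congrArg Matrix.transpose (Ω.gram_mul_poisson x)
  rw [Matrix.transpose_mul, gram_transpose, Matrix.mul_neg, Matrix.transpose_neg,
    Matrix.transpose_one, neg_inj] at h1
  have h2 : -Ω.poisson x * Ω.gram x (ContinuousLinearMap.id ℝ _) = 1 := by
    rw [mul_eq_one_comm, Matrix.mul_neg, gram_mul_poisson, neg_neg]
  have h3 := mul_eq_one_comm.1 h2
  calc (Ω.poisson x)ᵀ = (Ω.poisson x)ᵀ * (Ω.gram x (ContinuousLinearMap.id ℝ _)
        * -Ω.poisson x) := by rw [h3, Matrix.mul_one]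
    _ = _ := by rw [← Matrix.mul_assoc, h1, Matrix.one_mul]

theorem isUnit_det_poisson (x : M) : IsUnit (Ω.poisson x).det := by
  rw [poisson, Matrix.det_nonsing_inv]
  exact Ω.isUnit_det_gram_transpose x |>.ringInverse

/-- This identifies `[A₋₁, ·]` with `-δ`: lowering an index with the Gram matrix and raising it with
the Poisson matrix gives `-1`. -/
theorem bracket_flat (x : M) (v : TangentSpace 𝓘(ℝ, Eu d) x) (a : Weyl (Ω.poisson x)) (N : ℕ) :
    Weyl.bracket (Ω.flat x v) a N = -∑ j, coord v j • pd j (a N) := by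
  rw [flat, Weyl.bracket_lin (Ω.poisson_transpose x), Finset.sum_comm, ← Finset.sum_neg_distrib]
  refine Finset.sum_congr rfl fun j _ => ?_
  rw [← Finset.sum_smul, ← neg_smul]
  congr 1
  have h : ∀ i, ((Ω.form x v (basisVec i) : ℝ) : ℂ)
      = ∑ k, coord v k * Ω.gram x (ContinuousLinearMap.id ℝ _) k i := by
    intro i
    have := bilin_left (show Eu d →L[ℝ] Eu d →L[ℝ] ℝ from Ω.form x) v i
    refine (congrArg (fun t : ℝ => (t : ℂ)) this).trans ?_
    push_cast
    rfl
  simp only [h, Finset.sum_mul, mul_assoc]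
  rw [Finset.sum_comm]
  simp only [← Finset.mul_sum, ← Matrix.mul_apply, gram_mul_poisson, Matrix.neg_apply,
    Matrix.one_apply]
  simp

end SymplecticForm

/-! ### The Koszul homotopy. -/

section Homotopy

/-- Multiplication of the homogeneous component of degree `k` by `g k`. -/
def degScale (g : ℕ → ℂ) (a : FormalFun d) : FormalFun d :=
  fun m => g m.degree * MvPowerSeries.coeff m a

theorem coeff_degScale (g : ℕ → ℂ) (a : FormalFun d) (m : Fin d →₀ ℕ) :
    MvPowerSeries.coeff m (degScale g a) = g m.degree * MvPowerSeries.coeff m a := rfl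

theorem linSubst_degScale (g : ℕ → ℂ) (A : Matrix (Fin d) (Fin d) ℂ) (a : FormalFun d) :
    linSubst A (degScale g a) = degScale g (linSubst A a) := by
  ext e
  rw [coeff_degScale, coeff_linSubst, coeff_linSubst, Finset.mul_sum]
  refine Finset.sum_congr rfl fun m hm => ?_
  simp only [Finset.mem_finsuppAntidiag, Finset.subset_univ, and_true] at hm
  rw [coeff_degScale, mul_assoc, ← hm, Finsupp.degree_eq_sum]

theorem linSubst_sum {ι : Type*} (A : Matrix (Fin d) (Fin d) ℂ) (s : Finset ι)
    (f : ι → FormalFun d) : linSubst A (∑ i ∈ s, f i) = ∑ i ∈ s, linSubst A (f i) :=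
  map_sum (linSubstL A) f s

/-- The homotopy for the Koszul differential `∑ dx i ∂ / ∂ y i` on one-forms. -/
def koszulInv (b : Fin d → FormalFun d) : FormalFun d :=
  degScale (fun k => (k : ℂ)⁻¹) (∑ i, MvPowerSeries.X i * b i)

/-- Linear substitutions preserve degrees and `∑ yⁱ bᵢ` is invariant when `b` transforms as a
one-form, so the homotopy does not depend on the linear coordinates. This allows computing it in a
fixed chart. -/
theorem linSubst_koszulInv (A : Matrix (Fin d) (Fin d) ℂ) (b : Fin d → FormalFun d) :
    linSubst A (koszulInv b) = koszulInv fun j => linSubst A (∑ i, A i j • b i) := by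
  simp only [koszulInv, linSubst_degScale, linSubst_sum, linSubst_mul, linSubst_X, linSubst_smul,
    Finset.sum_mul, Finset.mul_sum]
  rw [Finset.sum_comm]
  simp only [smul_mul_assoc, mul_smul_comm]

theorem coeff_X_mul_eq_zero {a : FormalFun d} {i : Fin d} {m : Fin d →₀ ℕ}
    (h : ∀ m' : Fin d →₀ ℕ, m'.degree + 1 = m.degree → MvPowerSeries.coeff m' a = 0) :
    MvPowerSeries.coeff m (MvPowerSeries.X i * a) = 0 := by
  classical
  rw [MvPowerSeries.coeff_mul]
  refine Finset.sum_eq_zero fun p hp => ?_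
  rw [Finset.HasAntidiagonal.mem_antidiagonal] at hp
  rw [MvPowerSeries.coeff_X]
  split_ifs with h1
  · rw [h p.2, mul_zero]
    rw [← hp, h1, map_add, Finsupp.degree_single, add_comm]
  · rw [zero_mul]

/-- The Euler identity. -/
theorem coeff_euler (a : FormalFun d) (m : Fin d →₀ ℕ) :
    MvPowerSeries.coeff m (∑ i, MvPowerSeries.X i * pd i a)
      = m.degree * MvPowerSeries.coeff m a := by
  classical
  have h : ∀ i, MvPowerSeries.coeff m (MvPowerSeries.X i * pd i a)
      = m i * MvPowerSeries.coeff m a := by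
    intro i
    rw [MvPowerSeries.X, MvPowerSeries.coeff_monomial_mul, one_mul]
    split_ifs with h1
    · have h2 : m - Finsupp.single i 1 + Finsupp.single i 1 = m := tsub_add_cancel_of_le h1
      rw [MvPowerSeries.coeff_pderiv, h2, mul_comm]
      congr 1
      have := DFunLike.congr_fun h2 i
      rw [← this]
      simp
    · have : m i = 0 := by
        by_contra h0
        exact h1 (Finsupp.single_le_iff.2 (Nat.one_le_iff_ne_zero.2 h0))
      rw [this, Nat.cast_zero, zero_mul]
  rw [map_sum, Finset.sum_congr rfl fun i _ => h i, ← Finset.sum_mul, Finsupp.degree_eq_sum]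
  push_cast
  rfl

end Homotopy

/-! ### Differentiating a substitution that varies with the point. -/

section LinSubstDeriv

variable {x : M} (v : TangentSpace 𝓘(ℝ, Eu d) x) {T : M → Matrix (Fin d) (Fin d) ℂ}

/-- The entrywise derivative of a matrix-valued function. -/
def matDeriv (T : M → Matrix (Fin d) (Fin d) ℂ) (x : M) (v : TangentSpace 𝓘(ℝ, Eu d) x) :
    Matrix (Fin d) (Fin d) ℂ := Matrix.of fun i j => dirDeriv (fun y => T y i j) x v

theorem coeffDeriv_linear (hT : MatSmoothAt T x) (i : Fin d) :
    coeffDeriv (fun y => (∑ j, T y i j • MvPowerSeries.X j : FormalFun d)) x v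
      = ∑ j, matDeriv T x v i j • MvPowerSeries.X j := by
  rw [coeffDeriv_sum v fun j _ => CoeffSmoothAt.smul (hT i j) (CoeffSmoothAt.const _ x)]
  refine Finset.sum_congr rfl fun j _ => ?_
  rw [coeffDeriv_smul v (hT i j) (CoeffSmoothAt.const _ x), coeffDeriv_const, smul_zero, add_zero]
  rfl

/-- The chain rule for `p ∘ T y`. Both sides are additive in `p` and obey the same product rule, so
induction over polynomials leaves only the coordinates, where it is `coeffDeriv_linear`. -/
theorem coeffDeriv_linSubst_poly (hT : MatSmoothAt T x) (p : MvPolynomial (Fin d) ℂ) :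
    coeffDeriv (fun y => linSubst (T y) (p : FormalFun d)) x v
      = ∑ k, (∑ j, matDeriv T x v k j • MvPowerSeries.X j)
          * linSubst (T x) (pd k (p : FormalFun d)) := by
  have hs : ∀ a : FormalFun d, CoeffSmoothAt (fun y => linSubst (T y) a) x := fun a =>
    CoeffSmoothAt.linSubst hT (CoeffSmoothAt.const a x)
  induction p using MvPolynomial.induction_on with
  | C c =>
    have h : ∀ y, linSubst (T y) ((MvPolynomial.C c : MvPolynomial (Fin d) ℂ) : FormalFun d)
        = c • 1 := fun y => by
      rw [MvPolynomial.coe_C, ← mul_one (MvPowerSeries.C c), ← MvPowerSeries.smul_eq_C_mul,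
        linSubst_smul, linSubst_one]
    simp only [h]
    simp only [MvPolynomial.coe_C, pd_C, linSubst_zero, mul_zero, Finset.sum_const_zero]
    exact coeffDeriv_const v _
  | add p q hp hq =>
    have h : coeffDeriv (fun y => linSubst (T y) (p : FormalFun d)
        + linSubst (T y) (q : FormalFun d)) x v
        = coeffDeriv (fun y => linSubst (T y) (p : FormalFun d)) x v
          + coeffDeriv (fun y => linSubst (T y) (q : FormalFun d)) x v := by
      ext m
      simp only [coeff_coeffDeriv, map_add]
      exact dirDeriv_add v (hs _ m) (hs _ m)
    simp only [MvPolynomial.coe_add, linSubst_add, map_add, h, hp, hq, mul_add,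
      Finset.sum_add_distrib]
  | mul_X p i hp =>
    have hl : CoeffSmoothAt (fun y => (∑ j, T y i j • MvPowerSeries.X j : FormalFun d)) x :=
      CoeffSmoothAt.sum fun j _ => CoeffSmoothAt.smul (hT i j) (CoeffSmoothAt.const _ x)
    have hk : ∀ k, linSubst (T x) (pd k ((p : FormalFun d) * MvPowerSeries.X i))
        = linSubst (T x) (pd k (p : FormalFun d)) * linSubst (T x) (MvPowerSeries.X i)
          + if k = i then linSubst (T x) (p : FormalFun d) else 0 := by
      intro k
      rw [Derivation.leibniz, linSubst_add, smul_eq_mul, smul_eq_mul, linSubst_mul, linSubst_mul,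
        MvPowerSeries.pderiv_X, Pi.single_apply, add_comm, mul_comm]
      split_ifs with h1 h2 h2
      · rw [linSubst_one, mul_one]
      · exact absurd h1.symm h2
      · exact absurd h2.symm h1
      · rw [linSubst_zero, mul_zero]
    simp only [MvPolynomial.coe_mul, MvPolynomial.coe_X, hk]
    simp only [linSubst_mul, linSubst_X]
    rw [coeffDeriv_mul v (hs _) hl, hp, coeffDeriv_linear v hT]
    simp only [mul_add, Finset.sum_add_distrib, mul_ite, mul_zero, Finset.sum_ite_eq',
      Finset.mem_univ, if_true, ← mul_assoc]
    rw [← Finset.sum_mul, mul_comm (linSubst (T x) (p : FormalFun d))]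

theorem coeff_mul_congr_degree {a b c : FormalFun d} {e : Fin d →₀ ℕ}
    (h : ∀ m : Fin d →₀ ℕ, m.degree ≤ e.degree →
      MvPowerSeries.coeff m a = MvPowerSeries.coeff m b) :
    MvPowerSeries.coeff e (c * a) = MvPowerSeries.coeff e (c * b) := by
  classical
  rw [MvPowerSeries.coeff_mul, MvPowerSeries.coeff_mul]
  refine Finset.sum_congr rfl fun p hp => ?_
  rw [Finset.HasAntidiagonal.mem_antidiagonal] at hp
  rw [h p.2]
  rw [← hp, map_add]
  omega

theorem coeffDeriv_linSubst_const (hT : MatSmoothAt T x) (a : FormalFun d) :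
    coeffDeriv (fun y => linSubst (T y) a) x v
      = ∑ k, (∑ j, matDeriv T x v k j • MvPowerSeries.X j) * linSubst (T x) (pd k a) := by
  ext e
  -- The coefficient at `e` of either side sees `a` only up to degree `e.degree + 1`, one more than
  -- `e.degree` because of `pd k`; so a polynomial may replace `a`.
  let p := MvPowerSeries.truncTotal (e.degree + 2) a
  have hp : ∀ m : Fin d →₀ ℕ, m.degree < e.degree + 2 → MvPowerSeries.coeff m a =
      MvPowerSeries.coeff m (p : FormalFun d) := by
    intro m hm
    rw [MvPolynomial.coeff_coe, MvPowerSeries.coeff_truncTotal _ hm]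
  have h := congrArg (MvPowerSeries.coeff e) (coeffDeriv_linSubst_poly v hT p)
  rw [coeff_coeffDeriv] at h ⊢
  simp only [coeff_linSubst_congr _ (a := a) (b := (p : FormalFun d)) (e := e)
    fun m hm => hp m (by omega)]
  rw [h, map_sum, map_sum]
  refine Finset.sum_congr rfl fun k _ => coeff_mul_congr_degree fun m hm =>
    coeff_linSubst_congr _ fun m' hm' => ?_
  rw [MvPowerSeries.coeff_pderiv, MvPowerSeries.coeff_pderiv, hp]
  rw [map_add, Finsupp.degree_single]
  omega

/-- Substituting into the single monomial of exponent `m` isolates this entry of the substitution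
operator. -/
theorem linCoeff_smoothAt (hT : MatSmoothAt T x) {m e : Fin d →₀ ℕ}
    (hm : m ∈ Finset.finsuppAntidiag Finset.univ e.degree) :
    ContMDiffAt 𝓘(ℝ, Eu d) 𝓘(ℝ, ℂ) ∞ (fun y => linCoeff (T y) m e) x := by
  classical
  have h := CoeffSmoothAt.linSubst hT (CoeffSmoothAt.const (MvPowerSeries.monomial m 1) x) e
  simp only [coeff_linSubst, MvPowerSeries.coeff_monomial, ite_mul, one_mul, zero_mul,
    Finset.sum_ite_eq', hm, if_true] at h
  exact h

/-- Each coefficient is a finite sum of products of a coefficient of `g` with an entry of the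
substitution. The product rule splits it into a part with `T` frozen and a part with `g` frozen, the
latter being `coeffDeriv_linSubst_const`. -/
theorem coeffDeriv_linSubst (hT : MatSmoothAt T x) {g : M → FormalFun d}
    (hg : CoeffSmoothAt g x) : coeffDeriv (fun y => linSubst (T y) (g y)) x v
      = linSubst (T x) (coeffDeriv g x v)
        + ∑ k, (∑ j, matDeriv T x v k j • MvPowerSeries.X j) * linSubst (T x) (pd k (g x)) := by
  rw [← coeffDeriv_linSubst_const v hT]
  ext e
  rw [map_add, coeff_coeffDeriv, coeff_coeffDeriv]
  simp only [coeff_linSubst]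
  rw [dirDeriv_sum v fun m hm => cmul (hg m) (linCoeff_smoothAt hT hm),
    dirDeriv_sum v fun m hm => cmul contMDiffAt_const (linCoeff_smoothAt hT hm),
    ← Finset.sum_add_distrib]
  refine Finset.sum_congr rfl fun m hm => ?_
  rw [dirDeriv_mul v (hg m) (linCoeff_smoothAt hT hm),
    dirDeriv_mul v contMDiffAt_const (linCoeff_smoothAt hT hm), dirDeriv_const, zero_mul, zero_add]
  rfl

end LinSubstDeriv

end Manifold

section Manifold

variable {d : ℕ} {M : Type u} [TopologicalSpace M] [ChartedSpace (Eu d) M]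
  [IsManifold 𝓘(ℝ, Eu d) ∞ M]

/-! ### Coordinate fields and transition matrices. -/

section CoordinateFields

theorem tangentCoordChange_comp_of_mem {x y z w : M} (hx : w ∈ (chartAt (Eu d) x).source)
    (hy : w ∈ (chartAt (Eu d) y).source) (hz : w ∈ (chartAt (Eu d) z).source) :
    (tangentCoordChange 𝓘(ℝ, Eu d) y z w).comp (tangentCoordChange 𝓘(ℝ, Eu d) x y w)
      = tangentCoordChange 𝓘(ℝ, Eu d) x z w := by
  ext1 v
  refine tangentCoordChange_comp ⟨⟨?_, ?_⟩, ?_⟩ <;> rwa [extChartAt_source]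

theorem contMDiffAt_vectorField_iff {x x' : M} (h : x' ∈ (chartAt (Eu d) x).source)
    {Y : ∀ y : M, TangentSpace 𝓘(ℝ, Eu d) y} :
    ContMDiffAt 𝓘(ℝ, Eu d) (𝓘(ℝ, Eu d).prod 𝓘(ℝ, Eu d)) ∞
      (fun y => Bundle.TotalSpace.mk' (Eu d) y (Y y)) x' ↔
    ContMDiffAt 𝓘(ℝ, Eu d) 𝓘(ℝ, Eu d) ∞
      (fun y => tangentCoordChange 𝓘(ℝ, Eu d) y x y (Y y)) x' :=
  Bundle.Trivialization.contMDiffAt_section_iff (IB := 𝓘(ℝ, Eu d)) (n := ∞)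
    (E := (TangentSpace 𝓘(ℝ, Eu d) : M → Type))
    (trivializationAt (Eu d) (TangentSpace 𝓘(ℝ, Eu d)) x) h

theorem coordField_contMDiffAt {x x' : M} (h : x' ∈ (chartAt (Eu d) x).source) (w : Eu d) :
    ContMDiffAt 𝓘(ℝ, Eu d) (𝓘(ℝ, Eu d).prod 𝓘(ℝ, Eu d)) ∞
      (fun y => Bundle.TotalSpace.mk' (Eu d) y
        (coordField x w y : TangentSpace 𝓘(ℝ, Eu d) y)) x' := by
  rw [contMDiffAt_vectorField_iff h]
  refine (contMDiffAt_const (c := w)).congr_of_eventuallyEq ?_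
  filter_upwards [(chartAt (Eu d) x).open_source.mem_nhds h] with y hy
  exact congrArg (fun L : Eu d →L[ℝ] Eu d => L w) (frame_inv hy)

/-- The transition map applied to `w` is the coordinate field `w` of the chart at `x`, read in the
chart at `y`. -/
theorem tangentCoordChange_contMDiffAt {x y z : M} (hx : z ∈ (chartAt (Eu d) x).source)
    (hy : z ∈ (chartAt (Eu d) y).source) (w : Eu d) : ContMDiffAt 𝓘(ℝ, Eu d) 𝓘(ℝ, Eu d) ∞
      (fun z => tangentCoordChange 𝓘(ℝ, Eu d) x y z w) z := by
  refine ((contMDiffAt_vectorField_iff hy).1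
    (coordField_contMDiffAt hx w)).congr_of_eventuallyEq ?_
  filter_upwards [(chartAt (Eu d) x).open_source.mem_nhds hx,
    (chartAt (Eu d) y).open_source.mem_nhds hy] with z' hx' hy'
  exact congrArg (fun L : Eu d →L[ℝ] Eu d => L w)
    (tangentCoordChange_comp_of_mem hx' (mem_chart_source _ z') hy').symm

theorem contMDiffAt_coord {f : M → Eu d} {x : M} (hf : ContMDiffAt 𝓘(ℝ, Eu d) 𝓘(ℝ, Eu d) ∞ f x)
    (i : Fin d) : ContMDiffAt 𝓘(ℝ, Eu d) 𝓘(ℝ, ℝ) ∞ (fun y => f y i) x :=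
  (EuclideanSpace.proj i : Eu d →L[ℝ] ℝ).contDiff.contMDiff.contMDiffAt.comp x hf

theorem matSmoothAt_matrixOf {T : M → Eu d →L[ℝ] Eu d} {x : M}
    (h : ∀ w, ContMDiffAt 𝓘(ℝ, Eu d) 𝓘(ℝ, Eu d) ∞ (fun y => T y w) x) :
    MatSmoothAt (fun y => matrixOf (T y)) x := fun i j =>
  Complex.ofRealCLM.contDiff.contMDiff.contMDiffAt.comp x (contMDiffAt_coord (h (basisVec j)) i)

end CoordinateFields

/-! ### Smoothness of the connection coefficients in a fixed chart. -/

section Connection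

variable (D : AffineConnection d M)

theorem connection_sum_smul {ι : Type*} (s : Finset ι) {t : ι → M → ℝ}
    {Y : ι → ∀ y : M, TangentSpace 𝓘(ℝ, Eu d) y} {x : M}
    (ht : ∀ k, MDifferentiableAt 𝓘(ℝ, Eu d) 𝓘(ℝ, ℝ) (t k) x)
    (hY : ∀ k, MDifferentiableAt 𝓘(ℝ, Eu d) (𝓘(ℝ, Eu d).prod 𝓘(ℝ, Eu d))
      (fun y => Bundle.TotalSpace.mk' (Eu d) y (Y k y)) x) (v : TangentSpace 𝓘(ℝ, Eu d) x) :
    D (fun y => ∑ k ∈ s, (t k • Y k) y) x v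
      = ∑ k ∈ s, (t k x • D (Y k) x v + dirDeriv (t k) x v • Y k x) := by
  classical
  have hcov := D.isCovariantDerivativeOn (s := Set.univ)
  induction s using Finset.induction_on with
  | empty =>
    simp only [Finset.sum_empty]
    exact congrArg (fun L => L v) (hcov.zero (x := x))
  | insert a s ha ih =>
    simp only [Finset.sum_insert ha]
    rw [← ih]
    have h1 := hcov.add (σ := t a • Y a) (σ' := fun y => ∑ k ∈ s, (t k • Y k) y) (x := x)
      ((ht a).smul_section (hY a))
      (MDifferentiableAt.sum_section fun k _ => (ht k).smul_section (hY k))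
    have h2 := hcov.leibniz (σ := Y a) (g := t a) (x := x) (hY a) (ht a)
    rw [h2] at h1
    exact congrArg (fun L => L v) h1

/-- The connection matrix at `x'` in the coordinates of the preferred chart at `x`, along the
coordinate field `w`. -/
def localChristoffel (x : M) (w : Eu d) (x' : M) : Matrix (Fin d) (Fin d) ℂ :=
  Matrix.of fun k j => coord (tangentCoordChange 𝓘(ℝ, Eu d) x' x x'
    (D (coordField x (basisVec j)) x' (coordField x w x'))) k

variable {D}

/-- The coordinate fields are smooth only on the chart domain. Multiplied by a bump function they
become globally smooth, so that the smoothness of `D` applies, and near `x` nothing has changed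
because `D` is local. -/
theorem localChristoffel_smooth [T2Space M]
    (hD : CovariantDerivative.ContMDiffCovariantDerivative D ∞) (x : M) (w : Eu d) :
    MatSmoothAt (localChristoffel D x w) x := by
  intro k j
  obtain ⟨ρ⟩ : Nonempty (SmoothBumpFunction 𝓘(ℝ, Eu d) x) := inferInstance
  have hY : ContMDiff 𝓘(ℝ, Eu d) (𝓘(ℝ, Eu d).prod 𝓘(ℝ, Eu d)) ∞
      (fun y => Bundle.TotalSpace.mk' (Eu d) y
        (((ρ : M → ℝ) • (coordField x (basisVec j) :
          ∀ y : M, TangentSpace 𝓘(ℝ, Eu d) y)) y)) :=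
    ContMDiffOn.smul_section_of_tsupport (u := (chartAt (Eu d) x).source)
      ρ.contMDiff.contMDiffOn (chartAt (Eu d) x).open_source ρ.tsupport_subset_chartAt_source
      fun y hy => (coordField_contMDiffAt hy _).contMDiffWithinAt
  have h1 := hD.contMDiff.contMDiff (hY.contMDiffOn) x (Set.mem_univ x)
  have h2 := ContMDiffAt.clm_bundle_apply (h1.contMDiffAt Filter.univ_mem)
    (coordField_contMDiffAt (mem_chart_source _ x) w)
  have h3 := (contMDiffAt_vectorField_iff (mem_chart_source _ x)).1 h2
  refine (Complex.ofRealCLM.contDiff.contMDiff.contMDiffAt.comp x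
    (contMDiffAt_coord h3 k)).congr_of_eventuallyEq ?_
  -- Locality of `D` at `y` requires the bump function to be `1` on a neighbourhood of `y`, not only
  -- at `y`.
  filter_upwards [ρ.eventuallyEq_one.eventuallyEq_nhds, chart_mem_nhds (d := d) x] with y hy hy'
  have e : D (coordField x (basisVec j)) y = D ((ρ : M → ℝ) • (coordField x (basisVec j) :
          ∀ y : M, TangentSpace 𝓘(ℝ, Eu d) y)) y := by
    refine (D.isCovariantDerivativeOn (s := Set.univ)).congr_of_eventuallyEq
      ((coordField_contMDiffAt hy' _).mdifferentiableAt (by simp))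
      ((hY y).mdifferentiableAt (by simp)) Filter.univ_mem ?_
    filter_upwards [hy] with z hz
    rw [Pi.smul_apply', hz]
    exact (one_smul _ _).symm
  simp only [localChristoffel, Matrix.of_apply, e]
  rfl

end Connection

/-! ### The induced connection in a fixed chart. -/

section Covariance

theorem coord_map (L : Eu d →L[ℝ] Eu d) (u : Eu d) (i : Fin d) :
    coord (L u) i = ∑ k, matrixOf L i k * coord u k := by
  conv_lhs => rw [sum_coord u, map_sum]
  simp [coord, matrixOf, mul_comm]

theorem localRep_change (s : RawSection d M) (N : ℕ) {x y z : M}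
    (hx : z ∈ (chartAt (Eu d) x).source) (hy : z ∈ (chartAt (Eu d) y).source) :
    localRep s x N z = linSubst (matrixOf (tangentCoordChange 𝓘(ℝ, Eu d) x y z))
      (localRep s y N z) := by
  rw [localRep, localRep, linSubst_comp, ← matrixOf_comp]
  congr 2
  exact (tangentCoordChange_comp_of_mem hx hy (mem_chart_source _ z)).symm

theorem localRep_change_eventuallyEq (s : RawSection d M) (N : ℕ) {x y z : M}
    (hx : z ∈ (chartAt (Eu d) x).source) (hy : z ∈ (chartAt (Eu d) y).source) :
    localRep s x N =ᶠ[𝓝 z] fun z => linSubst (matrixOf (tangentCoordChange 𝓘(ℝ, Eu d) x y z))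
      (localRep s y N z) := by
  filter_upwards [(chartAt (Eu d) x).open_source.mem_nhds hx,
    (chartAt (Eu d) y).open_source.mem_nhds hy] with z' hx' hy'
  exact localRep_change s N hx' hy'

theorem SmoothAt.localRep {s : RawSection d M} {x x' : M} (hs : SmoothAt s x')
    (h : x' ∈ (chartAt (Eu d) x).source) (N : ℕ) : CoeffSmoothAt (localRep s x N) x' :=
  (CoeffSmoothAt.linSubst (matSmoothAt_matrixOf
    (tangentCoordChange_contMDiffAt h (mem_chart_source _ x'))) (hs N)).congr
    (localRep_change_eventuallyEq s N h (mem_chart_source _ x'))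

/-- The inhomogeneous transformation law: expand a coordinate field of the chart at `x'` in those of
the chart at `x` and apply the Leibniz rule of `D`. The derivatives of the components give the
`matDeriv` term. -/
theorem christoffel_change (D : AffineConnection d M) {x x' : M}
    (h : x' ∈ (chartAt (Eu d) x).source) (w : Eu d) :
    matrixOf (tangentCoordChange 𝓘(ℝ, Eu d) x' x x') * christoffel D x' (coordField x w x')
      = matDeriv (fun y => matrixOf (tangentCoordChange 𝓘(ℝ, Eu d) x' x y)) x'
          (coordField x w x')
        + localChristoffel D x w x' * matrixOf (tangentCoordChange 𝓘(ℝ, Eu d) x' x x') := by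
  have hx' := mem_chart_source (Eu d) x'
  have hS := fun w => tangentCoordChange_contMDiffAt hx' h w
  set S : M → Eu d →L[ℝ] Eu d := fun y => tangentCoordChange 𝓘(ℝ, Eu d) x' x y
  set v := coordField x w x'
  ext i j
  -- These are the components of the `j`-th coordinate field of the chart at `x'` in the frame of
  -- the chart at `x`.
  let t : Fin d → M → ℝ := fun k y => S y (basisVec j) k
  have ht : ∀ k, ContMDiffAt 𝓘(ℝ, Eu d) 𝓘(ℝ, ℝ) ∞ (t k) x' := fun k =>
    contMDiffAt_coord (hS (basisVec j)) k
  have hY : ∀ k, MDifferentiableAt 𝓘(ℝ, Eu d) (𝓘(ℝ, Eu d).prod 𝓘(ℝ, Eu d))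
      (fun y => Bundle.TotalSpace.mk' (Eu d) y
        (coordField x (basisVec k) y : TangentSpace 𝓘(ℝ, Eu d) y)) x' := fun k =>
    (coordField_contMDiffAt h _).mdifferentiableAt (by simp)
  have e1 : D (coordField x' (basisVec j)) x' v
      = ∑ k, (t k x' • D (coordField x (basisVec k)) x' v
        + dirDeriv (t k) x' v • coordField x (basisVec k) x') := by
    rw [← connection_sum_smul D _ (fun k => (ht k).mdifferentiableAt (by simp)) hY v]
    refine congrArg (fun L => L v)
      ((D.isCovariantDerivativeOn (s := Set.univ)).congr_of_eventuallyEq (coordField_mdiff x' _)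
      (MDifferentiableAt.sum_section fun k _ =>
        ((ht k).mdifferentiableAt (by simp)).smul_section (hY k)) Filter.univ_mem ?_)
    filter_upwards [(chartAt (Eu d) x).open_source.mem_nhds h, chart_mem_nhds (d := d) x']
      with y hy hy'
    have e2 : frame x' y = (frame x y).comp (S y) :=
      (tangentCoordChange_comp_of_mem hy' hy (mem_chart_source _ y)).symm
    have e3 : frame x y (S y (basisVec j)) = ∑ k, t k y • frame x y (basisVec k) := by
      conv_lhs => rw [sum_coord (S y (basisVec j)), map_sum]
      simp only [map_smul]
      rfl
    exact (congrArg (fun L : Eu d →L[ℝ] Eu d => L (basisVec j)) e2).trans e3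
  have hinv : ∀ u, S x' (coordField x u x') = u := fun u =>
    congrArg (fun L : Eu d →L[ℝ] Eu d => L u) (frame_inv h)
  have e4 : S x' (D (coordField x' (basisVec j)) x' v)
      = ∑ k, (t k x' • S x' (D (coordField x (basisVec k)) x' v)
        + dirDeriv (t k) x' v • basisVec k) := by
    refine (congrArg (S x') e1).trans ?_
    refine (map_sum (S x') _ _).trans (Finset.sum_congr rfl fun k _ => ?_)
    refine ((S x').map_add _ _).trans ?_
    refine congrArg₂ (· + ·) ((S x').map_smul _ _) (((S x').map_smul _ _).trans ?_)
    rw [hinv]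
  have e5 := congrArg (fun u : Eu d => coord u i) e4
  have e6 := coord_map (S x') (D (coordField x' (basisVec j)) x' v) i
  rw [Matrix.mul_apply, Matrix.add_apply, Matrix.mul_apply]
  refine e6.symm.trans (e5.trans ?_)
  have e7 : matDeriv (fun y => matrixOf (S y)) x' v i j = (dirDeriv (t i) x' v : ℝ) :=
    dirDeriv_ofReal v (ht i)
  rw [e7]
  simp only [coord, PiLp.add_apply, WithLp.ofLp_sum, Finset.sum_apply, PiLp.smul_apply, basisVec,
    PiLp.single_apply, Finset.sum_add_distrib]
  push_cast
  rw [add_comm]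
  congr 1
  · simp [apply_ite (fun r : ℝ => (r : ℂ))]
  · refine Finset.sum_congr rfl fun k _ => ?_
    rw [smul_eq_mul, Complex.ofReal_mul, mul_comm]
    rfl

/-- The hypothesis says that the linear vector fields of `G'` and `G` are related by the map `A`. -/
theorem matrixDer_linSubst {A G G' : Matrix (Fin d) (Fin d) ℂ} (h : A * G' = G * A)
    (a : FormalFun d) : matrixDer G' (linSubst A a) = linSubst A (matrixDer G a) := by
  have h' : ∀ i j, ∑ k, A i k * G' k j = ∑ k, G i k * A k j := fun i j =>
    congrFun (congrFun h i) j
  have e1 : matrixDer G' (linSubst A a)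
      = ∑ i, ∑ j, (∑ k, A i k * G' k j) • (MvPowerSeries.X j * linSubst A (pd i a)) := by
    simp only [matrixDer_apply, pd_linSubst, Finset.mul_sum, Finset.smul_sum, Finset.sum_smul,
      mul_smul_comm, smul_smul]
    calc _ = ∑ k, ∑ i, ∑ j, (G' k j * A i k) • (MvPowerSeries.X j * linSubst A (pd i a)) :=
          Finset.sum_congr rfl fun k _ => Finset.sum_comm
      _ = ∑ i, ∑ k, ∑ j, (G' k j * A i k) • (MvPowerSeries.X j * linSubst A (pd i a)) :=
          Finset.sum_comm
      _ = ∑ i, ∑ j, ∑ k, (G' k j * A i k) • (MvPowerSeries.X j * linSubst A (pd i a)) :=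
          Finset.sum_congr rfl fun k _ => Finset.sum_comm
      _ = _ := by simp only [mul_comm]
  have e2 : linSubst A (matrixDer G a)
      = ∑ i, ∑ j, (∑ k, G i k * A k j) • (MvPowerSeries.X j * linSubst A (pd i a)) := by
    simp only [matrixDer_apply, linSubst_sum, linSubst_smul, linSubst_mul, linSubst_X,
      Finset.sum_mul, Finset.smul_sum, Finset.sum_smul, smul_mul_assoc, smul_smul]
    exact Finset.sum_congr rfl fun i _ => Finset.sum_comm
  rw [e1, e2]
  simp only [h']

/-- Puts the extra term of `coeffDeriv_linSubst` into the form of a linear vector field, comparable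
with the Christoffel term. -/
theorem sum_linear_mul_linSubst_pd {A B : Matrix (Fin d) (Fin d) ℂ} (H : Matrix (Fin d) (Fin d) ℂ)
    (h : B = H * A) (a : FormalFun d) :
    ∑ k, (∑ j, B k j • MvPowerSeries.X j) * linSubst A (pd k a) = linSubst A (matrixDer H a) := by
  simp only [h, matrixDer_apply, linSubst_sum, linSubst_smul, linSubst_mul, linSubst_X,
    Finset.sum_mul, Finset.smul_sum, Finset.sum_smul, smul_mul_assoc, smul_smul, Matrix.mul_apply]
  exact Finset.sum_congr rfl fun i _ => Finset.sum_comm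

theorem matrixDer_add (G H : Matrix (Fin d) (Fin d) ℂ) (a : FormalFun d) :
    matrixDer (G + H) a = matrixDer G a + matrixDer H a := by
  simp only [matrixDer_apply, Matrix.add_apply, add_smul, Finset.sum_add_distrib]

/-- The formula for `∇₀` in the coordinates of the preferred chart at `x`, at nearby points. -/
theorem linSubst_frame_nablaZero (Ω : SymplecticForm d M) (D : AffineConnection d M)
    {s : RawSection d M} {x x' : M} (hs : SmoothAt s x') (h : x' ∈ (chartAt (Eu d) x).source)
    (w : Eu d) (N : ℕ) :
    linSubst (matrixOf (frame x x')) (nablaZero Ω D s x' (coordField x w x') N)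
      = coeffDeriv (localRep s x N) x' (coordField x w x')
        - matrixDer (localChristoffel D x w x') (localRep s x N x') := by
  have hx' := mem_chart_source (Eu d) x'
  let T : M → Matrix (Fin d) (Fin d) ℂ :=
    fun y => matrixOf (tangentCoordChange 𝓘(ℝ, Eu d) x' x y)
  have hT : MatSmoothAt T x' := matSmoothAt_matrixOf (tangentCoordChange_contMDiffAt hx' h)
  set v := coordField x w x'
  set g := localRep s x N
  set F := matrixOf (frame (d := d) x x')
  have hTF : T x' * F = 1 := matrixOf_frame_inv (d := d) h
  have hFT : F * T x' = 1 := mul_eq_one_comm.1 hTF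
  have hsx : s x' N = linSubst (T x') (g x') := by
    rw [← localRep_self s x' N]
    exact localRep_change s N hx' h
  -- The derivative of the transition matrix occurs here and again in `e2`, through
  -- `christoffel_change`; the two contributions cancel in `e3`.
  have e1 : coeffDeriv (localRep s x' N) x' v = linSubst (T x') (coeffDeriv g x' v)
      + linSubst (T x') (matrixDer (matDeriv T x' v * F) (g x')) := by
    rw [coeffDeriv_congr v (localRep_change_eventuallyEq s N hx' h),
      coeffDeriv_linSubst v hT (hs.localRep h N), sum_linear_mul_linSubst_pd (matDeriv T x' v * F)]
    rw [Matrix.mul_assoc, hFT, Matrix.mul_one]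
  have e2 : matrixDer (christoffel D x' v) (s x' N)
      = linSubst (T x') (matrixDer (matDeriv T x' v * F) (g x'))
        + linSubst (T x') (matrixDer (localChristoffel D x w x') (g x')) := by
    rw [← linSubst_add, ← matrixDer_add, hsx]
    refine matrixDer_linSubst ?_ _
    rw [Matrix.add_mul, Matrix.mul_assoc, hFT, Matrix.mul_one]
    exact christoffel_change D h w
  have e3 : nablaZero Ω D s x' v N = linSubst (T x') (coeffDeriv g x' v
      - matrixDer (localChristoffel D x w x') (g x')) := by
    rw [nablaZero, e1, e2, add_comm (linSubst _ (matrixDer (_ * F) _)), add_sub_add_right_eq_sub]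
    exact (map_sub (linSubstL (T x')) _ _).symm
  rw [e3, linSubst_comp, hTF, linSubst_id]

end Covariance

end Manifold

namespace Weyl

variable {d : ℕ} {P : Matrix (Fin d) (Fin d) ℂ}

theorem bracket_add_left (a b c : Weyl P) : bracket (a + b) c = bracket a c + bracket b c := by
  rw [bracket_swap, bracket_add, neg_add, ← bracket_swap, ← bracket_swap]

theorem smul_apply (r : ℝ) (a : Weyl P) (N : ℕ) : (r • a) N = (r : ℂ) • a N := rfl

theorem smul_mul (r : ℝ) (a b : Weyl P) : r • a * b = r • (a * b) := by
  ext1 N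
  simp only [smul_apply, mul_apply, Finset.smul_sum, moyal_smul_left]

theorem mul_smul' (r : ℝ) (a b : Weyl P) : a * r • b = r • (a * b) := by
  ext1 N
  simp only [smul_apply, mul_apply, Finset.smul_sum, moyal_smul_right]

theorem bracket_smul_left (r : ℝ) (a b : Weyl P) : bracket (r • a) b = r • bracket a b := by
  ext1 N
  rw [bracket, smul_mul, mul_smul', ← smul_sub, smul_apply, smul_apply, smul_comm, bracket]

end Weyl

section Manifold

variable {d : ℕ} {M : Type u} [TopologicalSpace M] [ChartedSpace (Eu d) M]
  [IsManifold 𝓘(ℝ, Eu d) ∞ M]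

/-! ### Smoothness of `∇₀ s` and of brackets. -/

section Smoothness

theorem dirDeriv_coordField_contMDiffAt {h : M → ℂ} {x : M}
    (hh : ContMDiffAt 𝓘(ℝ, Eu d) 𝓘(ℝ, ℂ) ∞ h x) (w : Eu d) :
    ContMDiffAt 𝓘(ℝ, Eu d) 𝓘(ℝ, ℂ) ∞ (fun x' => dirDeriv h x' (coordField x w x')) x := by
  have h1 := ContMDiffAt.mfderiv_const (m := ∞) hh le_rfl
  have h2 := (ContinuousLinearMap.apply ℝ ℂ w).contDiff.contMDiff.contMDiffAt.comp
    (n := ∞) x h1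
  refine h2.congr_of_eventuallyEq ?_
  filter_upwards [chart_mem_nhds (d := d) x] with y hy
  have h3 := inTangentCoordinates_eq (I := 𝓘(ℝ, Eu d)) (I' := 𝓘(ℝ, ℂ)) id h
    (fun y => mfderiv 𝓘(ℝ, Eu d) 𝓘(ℝ, ℂ) h y) (x₀ := x) (x := y) hy (Set.mem_univ _)
  have h4 := congrArg (fun L => L w) h3
  refine Eq.trans ?_ h4.symm
  simp only [tangentBundleCore_coordChange_model_space]
  rfl

theorem CoeffSmoothAt.matrixDer {G : M → Matrix (Fin d) (Fin d) ℂ} {x : M}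
    (hG : MatSmoothAt G x) {f : M → FormalFun d} (hf : CoeffSmoothAt f x) :
    CoeffSmoothAt (fun y => Fedosov.matrixDer (G y) (f y)) x := by
  simp only [matrixDer_apply]
  exact CoeffSmoothAt.sum fun k _ => CoeffSmoothAt.sum fun j _ =>
    ((CoeffSmoothAt.const _ x).mul (hf.pd k)).smul (hG k j)

/-- Smoothness of `s` is required near `x` and not only at `x`, because the formula of
`linSubst_frame_nablaZero` is used at all nearby points. -/
theorem smoothAt_nablaZero [T2Space M] (Ω : SymplecticForm d M) {D : AffineConnection d M}
    (hD : CovariantDerivative.ContMDiffCovariantDerivative D ∞) {s : RawSection d M} {x : M}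
    (hs : ∀ᶠ x' in 𝓝 x, SmoothAt s x') (w : Eu d) :
    SmoothAt (fun x' => nablaZero Ω D s x' (coordField x w x')) x := by
  intro N
  have hN := hs.self_of_nhds N
  have h : CoeffSmoothAt (fun x' => coeffDeriv (localRep s x N) x' (coordField x w x')
      + (-1 : ℂ) • matrixDer (localChristoffel D x w x') (localRep s x N x')) x :=
    CoeffSmoothAt.add (fun m => dirDeriv_coordField_contMDiffAt (hN m) w)
      ((CoeffSmoothAt.matrixDer (localChristoffel_smooth hD x w) hN).smul contMDiffAt_const)
  refine h.congr ?_
  filter_upwards [hs, chart_mem_nhds (d := d) x] with y hy hy'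
  rw [neg_one_smul, ← sub_eq_add_neg]
  exact linSubst_frame_nablaZero Ω D hy hy' w N

theorem smoothAt_bracket (Ω : SymplecticForm d M) {a b : RawSection d M} {x : M}
    (ha : SmoothAt a x) (hb : SmoothAt b x) :
    SmoothAt (fun y => Weyl.bracket (P := Ω.poisson y) (a y) (b y)) x := by
  intro N
  refine CoeffSmoothAt.congr (((Ω.smoothAt_rawMul ha hb (N + 1)).add
    ((Ω.smoothAt_rawMul hb ha (N + 1)).smul (c := fun _ => -1) contMDiffAt_const)).smul
    (c := fun _ => Complex.I⁻¹) contMDiffAt_const) (Filter.Eventually.of_forall fun y => ?_)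
  refine (linSubst_smul _ _ _).trans (congrArg (Complex.I⁻¹ • ·) ?_)
  refine (map_sub (linSubstL _) _ _).trans ?_
  rw [sub_eq_add_neg, ← neg_one_smul ℂ]
  rfl

end Smoothness

/-! ### The splitting `∇ = -δ + rem`. -/

section Remainder

variable (Ω : SymplecticForm d M) (D : AffineConnection d M)
  (Φ : ∀ x : M, TangentSpace 𝓘(ℝ, Eu d) x →ₗ[ℝ] Weyl (Ω.poisson x))

/-- The terms of nonnegative degree of the connection: `∇ = -δ + rem`. -/
def rem (s : RawSection d M) (x : M) (v : TangentSpace 𝓘(ℝ, Eu d) x) : Weyl (Ω.poisson x) :=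
  nablaZero Ω D s x v + Weyl.bracket (Φ x v) (s x)

theorem nabla_apply (s : RawSection d M) (x : M) (v : TangentSpace 𝓘(ℝ, Eu d) x) (N : ℕ) :
    nabla Ω D Φ s x v N = rem Ω D Φ s x v N - ∑ j, coord v j • pd j (s x N) := by
  have h := Ω.bracket_flat x v (s x) N
  rw [nabla, add_assoc, Weyl.add_apply, h, rem, neg_add_eq_sub]

theorem smoothAt_rem [T2Space M]
    (hD : CovariantDerivative.ContMDiffCovariantDerivative D ∞)
    (hΦ : ∀ (x : M) (w : Eu d), SmoothAt (fun x' => Φ x' (coordField x w x')) x)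
    {s : RawSection d M} {x : M} (hs : ∀ᶠ x' in 𝓝 x, SmoothAt s x') (w : Eu d) :
    SmoothAt (fun x' => rem Ω D Φ s x' (coordField x w x')) x :=
  SymplecticForm.smoothAt_add (smoothAt_nablaZero Ω hD hs w)
    (smoothAt_bracket Ω (hΦ x w) hs.self_of_nhds)

theorem smoothAt_nabla [T2Space M]
    (hD : CovariantDerivative.ContMDiffCovariantDerivative D ∞)
    (hΦ : ∀ (x : M) (w : Eu d), SmoothAt (fun x' => Φ x' (coordField x w x')) x)
    {s : RawSection d M} {x : M} (hs : ∀ᶠ x' in 𝓝 x, SmoothAt s x') (w : Eu d) :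
    SmoothAt (fun x' => nabla Ω D Φ s x' (coordField x w x')) x := by
  intro N
  refine CoeffSmoothAt.congr ((smoothAt_rem Ω D Φ hD hΦ hs w N).add
    (CoeffSmoothAt.sum (s := Finset.univ) fun j _ => ((hs.self_of_nhds N).pd j).smul
      (c := fun _ => -coord w j) contMDiffAt_const)) (Filter.Eventually.of_forall fun y => ?_)
  -- By the chain rule, `δ` along a coordinate field of the fixed chart has the constant
  -- coefficients `w` in that chart.
  have h : linSubst (matrixOf (frame x y)) (∑ j, coord (coordField x w y) j • pd j (s y N))
      = ∑ j, coord w j • pd j (localRep s x N y) := by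
    simp only [linSubst_sum, linSubst_smul, localRep, pd_linSubst, Finset.smul_sum, smul_smul]
    rw [Finset.sum_comm]
    refine Finset.sum_congr rfl fun i _ => ?_
    rw [← Finset.sum_smul]
    congr 1
    exact (coord_map (frame x y) w i).trans (Finset.sum_congr rfl fun k _ => mul_comm _ _)
  simp only [neg_smul, Finset.sum_neg_distrib, ← sub_eq_add_neg, ← h]
  change linSubst _ (nabla Ω D Φ s y (coordField x w y) N) = _
  rw [nabla_apply]
  exact map_sub (linSubstL _) _ _

variable {Ω D Φ}

theorem matrixDer_smul (c : ℂ) (G : Matrix (Fin d) (Fin d) ℂ) (a : FormalFun d) :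
    matrixDer (c • G) a = c • matrixDer G a := by
  simp only [matrixDer_apply, Matrix.smul_apply, Finset.smul_sum, smul_smul, smul_eq_mul]

theorem rem_add (s : RawSection d M) (x : M) (v w : TangentSpace 𝓘(ℝ, Eu d) x) :
    rem Ω D Φ s x (v + w) = rem Ω D Φ s x v + rem Ω D Φ s x w := by
  have h0 : nablaZero Ω D s x (v + w) = nablaZero Ω D s x v + nablaZero Ω D s x w := by
    ext1 N
    have h1 : coeffDeriv (localRep s x N) x (v + w)
        = coeffDeriv (localRep s x N) x v + coeffDeriv (localRep s x N) x w := by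
      ext m
      exact (mfderiv 𝓘(ℝ, Eu d) 𝓘(ℝ, ℂ) _ x).map_add v w
    have h2 : christoffel D x (v + w) = christoffel D x v + christoffel D x w := by
      ext i j
      simp only [christoffel, map_add, Matrix.of_apply, Matrix.add_apply]
      exact Complex.ofReal_add _ _
    rw [Weyl.add_apply, nablaZero, nablaZero, nablaZero, h1, h2, matrixDer_add]
    abel
  have h3 : Weyl.bracket (Φ x (v + w)) (s x)
      = Weyl.bracket (Φ x v) (s x) + Weyl.bracket (Φ x w) (s x) := by
    rw [map_add]
    exact Weyl.bracket_add_left _ _ _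
  rw [rem, rem, rem, h0, h3]
  abel

theorem rem_smul (s : RawSection d M) (x : M) (r : ℝ) (v : TangentSpace 𝓘(ℝ, Eu d) x) :
    rem Ω D Φ s x (r • v) = r • rem Ω D Φ s x v := by
  have h0 : nablaZero Ω D s x (r • v) = r • nablaZero Ω D s x v := by
    ext1 N
    have h1 : coeffDeriv (localRep s x N) x (r • v)
        = (r : ℂ) • coeffDeriv (localRep s x N) x v := by
      ext m
      exact (mfderiv 𝓘(ℝ, Eu d) 𝓘(ℝ, ℂ) _ x).map_smul r v
    have h2 : christoffel D x (r • v) = (r : ℂ) • christoffel D x v := by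
      ext i j
      simp only [christoffel, map_smul, Matrix.of_apply, Matrix.smul_apply]
      exact Complex.ofReal_mul _ _
    rw [Weyl.smul_apply, nablaZero, nablaZero, h1, h2, matrixDer_smul, smul_sub]
  have h3 : Weyl.bracket (Φ x (r • v)) (s x) = r • Weyl.bracket (Φ x v) (s x) := by
    rw [map_smul]
    exact Weyl.bracket_smul_left _ _ _
  rw [rem, rem, h0, h3, smul_add]

/-- Linearity in `v` makes `rem s` a one-form. It is used to pass from the standard basis at each
point to the coordinate frame of a fixed chart. -/
theorem rem_eq_sum (s : RawSection d M) (x : M) (v : TangentSpace 𝓘(ℝ, Eu d) x) (N : ℕ) :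
    rem Ω D Φ s x v N = ∑ i, coord v i • rem Ω D Φ s x (basisVec i) N := by
  let L : TangentSpace 𝓘(ℝ, Eu d) x →ₗ[ℝ] Weyl (Ω.poisson x) :=
    { toFun := rem Ω D Φ s x
      map_add' := rem_add s x
      map_smul' := rem_smul s x }
  let L' : Eu d →ₗ[ℝ] Weyl (Ω.poisson x) := L
  have h : L' v = ∑ i, (show Eu d from v) i • L' (basisVec i) := by
    conv_lhs => rw [sum_coord (show Eu d from v), map_sum]
    simp only [map_smul]
  refine (congrFun h N).trans ?_
  exact Finset.sum_apply N Finset.univ fun i => (show Eu d from v) i • L' (basisVec i)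

/-- `rem` does not lower degrees. -/
theorem rem_congr_degree (hΦ : ∀ (x : M) (v : TangentSpace 𝓘(ℝ, Eu d) x), Weyl.OrdGE 3 (Φ x v))
    {s t : RawSection d M} {k : ℕ}
    (h : ∀ (x : M) (N : ℕ) (m : Fin d →₀ ℕ), 2 * N + m.degree < k →
      MvPowerSeries.coeff m (s x N) = MvPowerSeries.coeff m (t x N))
    (x : M) (v : TangentSpace 𝓘(ℝ, Eu d) x) (N : ℕ) (m : Fin d →₀ ℕ)
    (hm : 2 * N + m.degree < k) :
    MvPowerSeries.coeff m (rem Ω D Φ s x v N) = MvPowerSeries.coeff m (rem Ω D Φ t x v N) := by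
  have h1 : MvPowerSeries.coeff m (coeffDeriv (localRep s x N) x v)
      = MvPowerSeries.coeff m (coeffDeriv (localRep t x N) x v) := by
    rw [coeff_coeffDeriv, coeff_coeffDeriv]
    congr 1
    funext y
    exact coeff_linSubst_congr _ fun m' hm' => h y N m' (by omega)
  have h2 : MvPowerSeries.coeff m (matrixDer (christoffel D x v) (s x N))
      = MvPowerSeries.coeff m (matrixDer (christoffel D x v) (t x N)) := by
    rw [← sub_eq_zero, ← map_sub, ← map_sub, matrixDer_apply]
    simp only [map_sum, map_smul]
    refine Finset.sum_eq_zero fun i _ => Finset.sum_eq_zero fun j _ => ?_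
    rw [coeff_X_mul_eq_zero, smul_zero]
    intro m' hm'
    rw [MvPowerSeries.coeff_pderiv, map_sub, h x N, sub_self, zero_mul]
    rw [map_add, Finsupp.degree_single]
    omega
  have h3 : MvPowerSeries.coeff m (Weyl.bracket (Φ x v) (s x) N)
      = MvPowerSeries.coeff m (Weyl.bracket (Φ x v) (t x) N) := by
    have h4 : Weyl.OrdGE k (show Weyl (Ω.poisson x) from s x - t x) := fun N m hm => by
      rw [← sub_eq_zero.2 (h x N m hm), ← map_sub]
      rfl
    -- Order `3` of `Φ` outweighs the two degrees lost in the bracket.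
    have h5 := (hΦ x v).bracket (j := k) h4 (by omega) N m hm
    have h6 := congrFun (Weyl.bracket_sub (Φ x v) (s x) (t x)) N
    have h7 := congrArg (MvPowerSeries.coeff m) h6
    rw [← sub_eq_zero, ← map_sub]
    exact h7.symm.trans h5
  rw [rem, rem, Weyl.add_apply, Weyl.add_apply, map_add, map_add, h3, nablaZero, nablaZero,
    map_sub, map_sub, h1, h2]

end Remainder

/-! ### Fedosov's iteration. -/

section FlatSections

variable (Ω : SymplecticForm d M) (D : AffineConnection d M)
  (Φ : ∀ x : M, TangentSpace 𝓘(ℝ, Eu d) x →ₗ[ℝ] Weyl (Ω.poisson x)) (f : M → ℂ)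

/-- The operator whose fixed point is the flat section that extends `f`. -/
def fedosovStep (s : RawSection d M) : RawSection d M := fun x N =>
  (if N = 0 then MvPowerSeries.C (f x) else 0)
    + koszulInv fun i => rem Ω D Φ s x (basisVec i) N

/-- The fixed point of `fedosovStep`. -/
def fedosovLift : RawSection d M := fun x N m =>
  -- Coefficients of total degree below `k` are stable after `k` iterations, and this one has degree
  -- `2 * N + m.degree`.
  MvPowerSeries.coeff m ((fedosovStep Ω D Φ f)^[2 * N + m.degree + 1] 0 x N)

variable {Ω D Φ f}

theorem linSubst_C (A : Matrix (Fin d) (Fin d) ℂ) (c : ℂ) :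
    linSubst A (MvPowerSeries.C c) = MvPowerSeries.C c := by
  rw [← mul_one (MvPowerSeries.C c), ← MvPowerSeries.smul_eq_C_mul, linSubst_smul, linSubst_one]

theorem smoothAt_fedosovStep [T2Space M]
    (hD : CovariantDerivative.ContMDiffCovariantDerivative D ∞)
    (hΦ : ∀ (x : M) (w : Eu d), SmoothAt (fun x' => Φ x' (coordField x w x')) x)
    (hf : ContMDiff 𝓘(ℝ, Eu d) 𝓘(ℝ, ℂ) ∞ f) {s : RawSection d M} (hs : ∀ x, SmoothAt s x)
    (x : M) : SmoothAt (fedosovStep Ω D Φ f s) x := by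
  intro N
  have h1 : CoeffSmoothAt (fun y => (if N = 0 then MvPowerSeries.C (f y) else 0 : FormalFun d)) x := by
    split_ifs
    · have : ∀ y, (MvPowerSeries.C (f y) : FormalFun d) = f y • 1 := fun y => by
        rw [MvPowerSeries.smul_eq_C_mul, mul_one]
      simp only [this]
      exact (CoeffSmoothAt.const 1 x).smul (hf x)
    · exact CoeffSmoothAt.const 0 x
  -- The homotopy is written with the coordinate frame of the fixed chart at `x`; invariance under
  -- linear substitutions identifies it with the pointwise definition.
  have h2 : CoeffSmoothAt (fun y => koszulInv fun j => localRep
      (fun x' => rem Ω D Φ s x' (coordField x (basisVec j) x')) x N y) x := by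
    intro m
    simp only [koszulInv, coeff_degScale]
    refine cmul contMDiffAt_const ?_
    exact CoeffSmoothAt.sum (fun j _ => (CoeffSmoothAt.const _ x).mul
      (smoothAt_rem Ω D Φ hD hΦ (Filter.Eventually.of_forall hs) (basisVec j) N)) m
  refine (h1.add h2).congr (Filter.Eventually.of_forall fun y => ?_)
  simp only [localRep, fedosovStep]
  rw [linSubst_add, linSubst_koszulInv]
  congr 1
  · split_ifs
    · exact linSubst_C _ _
    · exact linSubst_zero _
  · congr 1
    funext j
    congr 1
    exact (rem_eq_sum s y (coordField x (basisVec j) y) N).symm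

/-- The contraction estimate: `rem` preserves agreement up to degree `k` and the factor `yⁱ` in the
homotopy gains one degree. -/
theorem fedosovStep_congr_degree
    (hΦ : ∀ (x : M) (v : TangentSpace 𝓘(ℝ, Eu d) x), Weyl.OrdGE 3 (Φ x v))
    {s t : RawSection d M} {k : ℕ}
    (h : ∀ (x : M) (N : ℕ) (m : Fin d →₀ ℕ), 2 * N + m.degree < k →
      MvPowerSeries.coeff m (s x N) = MvPowerSeries.coeff m (t x N))
    (x : M) (N : ℕ) (m : Fin d →₀ ℕ) (hm : 2 * N + m.degree < k + 1) :
    MvPowerSeries.coeff m (fedosovStep Ω D Φ f s x N)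
      = MvPowerSeries.coeff m (fedosovStep Ω D Φ f t x N) := by
  rw [fedosovStep, fedosovStep, map_add, map_add, koszulInv, koszulInv, coeff_degScale,
    coeff_degScale]
  congr 2
  rw [← sub_eq_zero, ← map_sub, ← Finset.sum_sub_distrib, map_sum]
  refine Finset.sum_eq_zero fun i _ => ?_
  rw [← mul_sub]
  refine coeff_X_mul_eq_zero fun m' hm' => ?_
  rw [map_sub]
  exact sub_eq_zero.2 (rem_congr_degree hΦ h x (basisVec i) N m' (by omega))

theorem iterate_fedosovStep_congr
    (hΦ : ∀ (x : M) (v : TangentSpace 𝓘(ℝ, Eu d) x), Weyl.OrdGE 3 (Φ x v)) (k l : ℕ)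
    (x : M) (N : ℕ) (m : Fin d →₀ ℕ) (hm : 2 * N + m.degree < k) :
    MvPowerSeries.coeff m ((fedosovStep Ω D Φ f)^[k + l] 0 x N)
      = MvPowerSeries.coeff m ((fedosovStep Ω D Φ f)^[k] 0 x N) := by
  induction k generalizing x N m with
  | zero => exact absurd hm (Nat.not_lt_zero _)
  | succ k ih =>
    rw [Nat.succ_add, Function.iterate_succ_apply', Function.iterate_succ_apply']
    exact fedosovStep_congr_degree hΦ ih x N m hm

theorem coeff_fedosovLift
    (hΦ : ∀ (x : M) (v : TangentSpace 𝓘(ℝ, Eu d) x), Weyl.OrdGE 3 (Φ x v)) (k : ℕ)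
    (x : M) (N : ℕ) (m : Fin d →₀ ℕ) (hm : 2 * N + m.degree < k) :
    MvPowerSeries.coeff m (fedosovLift Ω D Φ f x N)
      = MvPowerSeries.coeff m ((fedosovStep Ω D Φ f)^[k] 0 x N) := by
  obtain ⟨l, rfl⟩ := Nat.exists_eq_add_of_lt hm
  rw [add_right_comm]
  exact (iterate_fedosovStep_congr hΦ _ l x N m (by omega)).symm

theorem fedosovStep_fedosovLift
    (hΦ : ∀ (x : M) (v : TangentSpace 𝓘(ℝ, Eu d) x), Weyl.OrdGE 3 (Φ x v)) :
    fedosovStep Ω D Φ f (fedosovLift Ω D Φ f) = fedosovLift Ω D Φ f := by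
  funext x N
  ext m
  rw [fedosovStep_congr_degree hΦ (coeff_fedosovLift hΦ (2 * N + m.degree)) x N m (by omega),
    coeff_fedosovLift hΦ (2 * N + m.degree + 1) x N m (by omega), Function.iterate_succ_apply']

/-- Each local coefficient depends only on coefficients of the same degree, hence equals that of one
finite iterate, with an iteration number independent of the point. -/
theorem smoothAt_fedosovLift [T2Space M]
    (hD : CovariantDerivative.ContMDiffCovariantDerivative D ∞)
    (hΦ : ∀ (x : M) (w : Eu d), SmoothAt (fun x' => Φ x' (coordField x w x')) x)
    (hΦ3 : ∀ (x : M) (v : TangentSpace 𝓘(ℝ, Eu d) x), Weyl.OrdGE 3 (Φ x v))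
    (hf : ContMDiff 𝓘(ℝ, Eu d) 𝓘(ℝ, ℂ) ∞ f) (x : M) : SmoothAt (fedosovLift Ω D Φ f) x := by
  have h : ∀ k x, SmoothAt ((fedosovStep Ω D Φ f)^[k] 0) x := by
    intro k
    induction k with
    | zero => exact fun x => SymplecticForm.smoothAt_zero x
    | succ k ih =>
      intro x
      rw [Function.iterate_succ_apply']
      exact smoothAt_fedosovStep hD hΦ hf ih x
  intro N m
  refine (h (2 * N + m.degree + 1) x N m).congr_of_eventuallyEq
    (Filter.Eventually.of_forall fun y => ?_)
  exact coeff_linSubst_congr _ fun m' hm' => coeff_fedosovLift hΦ3 _ y N m' (by omega)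

/-- A one-form `b` with `δ b = 0` in degree `k - 1` and with `δ⁻¹ b = 0` vanishes in degree `k`. -/
theorem coeff_eq_zero_of_koszul {b : Fin d → FormalFun d} {m : Fin d →₀ ℕ}
    (h1 : ∑ i, MvPowerSeries.X i * b i = 0)
    (h2 : ∀ (m' : Fin d →₀ ℕ) (i j : Fin d), m'.degree + 1 = m.degree →
      MvPowerSeries.coeff m' (pd i (b j)) = MvPowerSeries.coeff m' (pd j (b i))) (j : Fin d) :
    MvPowerSeries.coeff m (b j) = 0 := by
  -- Applying `∂ⱼ` to `∑ yⁱ bᵢ = 0`, exchanging `∂ⱼ bᵢ` for `∂ᵢ bⱼ` and using the Euler identity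
  -- gives `(deg m + 1) bⱼ = 0` at `m`.
  have h3 := congrArg (fun a => MvPowerSeries.coeff m (pd j a)) h1
  simp only [map_sum, Derivation.leibniz, map_add, map_zero, Finset.sum_add_distrib,
    MvPowerSeries.pderiv_X, smul_eq_mul] at h3
  have h4 : ∑ i, MvPowerSeries.coeff m (MvPowerSeries.X i * pd j (b i))
      = ∑ i, MvPowerSeries.coeff m (MvPowerSeries.X i * pd i (b j)) := by
    refine Finset.sum_congr rfl fun i _ => ?_
    rw [← sub_eq_zero, ← map_sub, ← mul_sub]
    refine coeff_X_mul_eq_zero fun m' hm' => ?_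
    rw [map_sub, h2 m' i j hm', sub_self]
  rw [h4, ← map_sum, coeff_euler] at h3
  have h5 : ∑ i, MvPowerSeries.coeff m (b i * Pi.single (M := fun _ => FormalFun d) j 1 i)
      = MvPowerSeries.coeff m (b j) := by
    rw [Finset.sum_eq_single j]
    · simp
    · intro i _ hi
      simp [hi]
    · simp
  rw [h5, ← add_one_mul] at h3
  exact (mul_eq_zero.1 h3).resolve_left (Nat.cast_add_one_ne_zero _)

end FlatSections

end Manifold

section Manifold

variable {d : ℕ} {M : Type u} [TopologicalSpace M] [ChartedSpace (Eu d) M]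
  [IsManifold 𝓘(ℝ, Eu d) ∞ M]

theorem coeff_zero_linSubst (A : Matrix (Fin d) (Fin d) ℂ) (a : FormalFun d) :
    MvPowerSeries.coeff 0 (linSubst A a) = MvPowerSeries.coeff 0 a := by
  classical
  rw [coeff_linSubst_congr A (b := MvPowerSeries.C (MvPowerSeries.coeff 0 a)), linSubst_C,
    MvPowerSeries.coeff_zero_C]
  intro m hm
  rw [map_zero, Finsupp.degree_eq_zero_iff] at hm
  rw [hm, MvPowerSeries.coeff_zero_C]

theorem coord_basisVec (i j : Fin d) : coord (basisVec i) j = if j = i then 1 else 0 := by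
  rw [coord, basisVec, PiLp.single_apply]
  split_ifs <;> simp

/-! ### Flatness and leading terms of the lift. -/

section Flatness

variable {Ω : SymplecticForm d M} {D : AffineConnection d M}
  {Φ : ∀ x : M, TangentSpace 𝓘(ℝ, Eu d) x →ₗ[ℝ] Weyl (Ω.poisson x)}

theorem nabla_basisVec (s : RawSection d M) (x : M) (i : Fin d) (N : ℕ) :
    nabla Ω D Φ s x (basisVec i) N = rem Ω D Φ s x (basisVec i) N - pd i (s x N) := by
  refine (nabla_apply Ω D Φ s x (basisVec i) N).trans (congrArg _ ?_)
  simp [coord_basisVec]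

theorem nabla_eq_sum (s : RawSection d M) (x : M) (v : TangentSpace 𝓘(ℝ, Eu d) x) (N : ℕ) :
    nabla Ω D Φ s x v N = ∑ i, coord v i • nabla Ω D Φ s x (basisVec i) N := by
  simp only [nabla_basisVec, smul_sub, Finset.sum_sub_distrib]
  rw [nabla_apply, rem_eq_sum]

theorem rem_zero (x : M) (v : TangentSpace 𝓘(ℝ, Eu d) x) : rem Ω D Φ 0 x v = 0 := by
  have h1 : Weyl.bracket (Φ x v) 0 = 0 := by
    have := Weyl.bracket_sub (Φ x v) 0 0
    rwa [sub_self, sub_self] at this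
  have h2 : nablaZero Ω D 0 x v = 0 := by
    ext1 N
    have h3 : localRep (0 : RawSection d M) x N = fun _ => 0 := funext fun y => linSubst_zero _
    rw [nablaZero, h3, coeffDeriv_const]
    exact (zero_sub _).trans (neg_eq_zero.2 (map_zero _))
  rw [rem, h2, zero_add]
  exact h1

/-- A fixed point of `fedosovStep` is flat. -/
theorem nabla_eq_zero_of_fedosovStep {f : M → ℂ} {s : RawSection d M}
    (hΦ : ∀ (x : M) (v : TangentSpace 𝓘(ℝ, Eu d) x), Weyl.OrdGE 3 (Φ x v))
    (hs : fedosovStep Ω D Φ f s = s)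
    (hflat : ∀ (x : M) (v w : TangentSpace 𝓘(ℝ, Eu d) x),
      nabla Ω D Φ (fun x' => nabla Ω D Φ s x' (coordField x w x')) x v
        - nabla Ω D Φ (fun x' => nabla Ω D Φ s x' (coordField x v x')) x w = 0)
    (x : M) (v : TangentSpace 𝓘(ℝ, Eu d) x) : nabla Ω D Φ s x v = 0 := by
  -- This is `δ⁻¹ ∇s = 0`: away from degree zero the fixed point equation, multiplied by the degree,
  -- equates the contractions of `rem s` and `δ s` with `y`; in degree zero both vanish.
  have h1 : ∀ (x : M) (N : ℕ),
      ∑ i, MvPowerSeries.X i * nabla Ω D Φ s x (basisVec i) N = 0 := by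
    intro x N
    ext m
    simp only [nabla_basisVec, mul_sub, Finset.sum_sub_distrib]
    rw [map_sub, coeff_euler, map_zero, sub_eq_zero]
    rcases eq_or_ne m 0 with rfl | hm
    · simp [MvPowerSeries.coeff_zero_X_mul]
    · conv_rhs => rw [← hs]
      have hC : MvPowerSeries.coeff m
          (if N = 0 then MvPowerSeries.C (f x) else 0 : FormalFun d) = 0 := by
        classical
        split_ifs
        · rw [MvPowerSeries.coeff_C, if_neg hm]
        · rw [map_zero]
      have hm' : (m.degree : ℂ) ≠ 0 := by
        rw [Nat.cast_ne_zero, Ne, Finsupp.degree_eq_zero_iff]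
        exact hm
      rw [fedosovStep, map_add, hC, zero_add, koszulInv, coeff_degScale, mul_inv_cancel_left₀ hm']
  have h2 : ∀ (k : ℕ) (x : M) (v : TangentSpace 𝓘(ℝ, Eu d) x),
      Weyl.OrdGE k (nabla Ω D Φ s x v) := by
    intro k
    induction k with
    | zero => exact fun x v => Weyl.ordGE_zero _
    | succ k ih =>
      intro x v N m hm
      rw [nabla_eq_sum, map_sum]
      refine Finset.sum_eq_zero fun j _ => ?_
      rw [map_smul, coeff_eq_zero_of_koszul (b := fun i => nabla Ω D Φ s x (basisVec i) N)
        (h1 x N) ?_ j, smul_zero]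
      intro m' i j hm'
      let B : Fin d → RawSection d M :=
        fun j x' => nabla Ω D Φ s x' (coordField x (basisVec j) x')
      -- By induction `∇s` vanishes in this degree, hence so does `rem ∇s`, and `∇∇s` reduces to
      -- `-δ∇s`. Flatness then gives the symmetry required by `coeff_eq_zero_of_koszul`.
      have h3 : ∀ i j : Fin d, MvPowerSeries.coeff m' (nabla Ω D Φ (B j) x (basisVec i) N)
          = -MvPowerSeries.coeff m' (pd i (nabla Ω D Φ s x (basisVec j) N)) := by
        intro i j
        have h4 := rem_congr_degree (Ω := Ω) (D := D) hΦ (k := k) (s := B j) (t := 0)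
          (fun y N m hm => ih y _ N m hm) x (basisVec i) N m' (by omega)
        have h5 := congrFun (rem_zero (Ω := Ω) (D := D) (Φ := Φ) x (basisVec i)) N
        have h6 : B j x N = nabla Ω D Φ s x (basisVec j) N :=
          congrArg (fun u => nabla Ω D Φ s x u N) (coordField_self x (basisVec j))
        have h7 := congrArg (MvPowerSeries.coeff m')
          (nabla_basisVec (Ω := Ω) (D := D) (Φ := Φ) (B j) x i N)
        refine h7.trans ?_
        rw [map_sub, ← h6]
        refine (congrArg (· - _) (h4.trans ((congrArg (MvPowerSeries.coeff m') h5).trans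
          (map_zero _)))).trans (zero_sub _)
      have h6 := congrArg (MvPowerSeries.coeff m') (congrFun (hflat x (basisVec i) (basisVec j)) N)
      have h7 : MvPowerSeries.coeff m' (nabla Ω D Φ (B j) x (basisVec i) N)
          - MvPowerSeries.coeff m' (nabla Ω D Φ (B i) x (basisVec j) N) = 0 :=
        (map_sub _ _ _).symm.trans (h6.trans (map_zero _))
      rw [h3, h3, sub_eq_zero, neg_inj] at h7
      exact h7
  ext1 N
  ext m
  exact h2 (2 * N + m.degree + 1) x v N m (by omega)

theorem coeff_zero_of_fedosovStep {f : M → ℂ} {s : RawSection d M}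
    (hs : fedosovStep Ω D Φ f s = s) (x : M) (N : ℕ) :
    MvPowerSeries.coeff 0 (s x N) = if N = 0 then f x else 0 := by
  classical
  -- The convention `0⁻¹ = 0` makes the homotopy contribute nothing in degree zero.
  rw [← hs, fedosovStep, map_add, koszulInv, coeff_degScale, map_zero, Nat.cast_zero, inv_zero,
    zero_mul, add_zero]
  split_ifs
  · rw [MvPowerSeries.coeff_zero_C]
  · rw [map_zero]

/-- The degree-zero part of `∇s = 0` along `∂ᵢ`: `∇₀` contributes `∂ᵢ f`, `δ` the linear
coefficient, and the bracket with `Φ` starts only in degree one. -/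
theorem coeff_single_of_fedosovStep {f : M → ℂ} {s : RawSection d M}
    (hΦ : ∀ (x : M) (v : TangentSpace 𝓘(ℝ, Eu d) x), Weyl.OrdGE 3 (Φ x v))
    (hs : fedosovStep Ω D Φ f s = s) {x : M} {i : Fin d}
    (h : nabla Ω D Φ s x (basisVec i) = 0) :
    MvPowerSeries.coeff (Finsupp.single i 1) (s x 0) = dirDeriv f x (basisVec i) := by
  have h2 : MvPowerSeries.coeff 0 (Weyl.bracket (Φ x (basisVec i)) (s x) 0) = 0 :=
    (hΦ x (basisVec i)).bracket (j := 1) (Weyl.ordGE_zero (s x)) (by omega) 0 0 (by simp)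
  have h3 : ∀ v : TangentSpace 𝓘(ℝ, Eu d) x, MvPowerSeries.coeff 0 (nablaZero Ω D s x v 0)
      = dirDeriv f x v := by
    intro v
    rw [nablaZero, map_sub, coeff_coeffDeriv, matrixDer_apply]
    simp [localRep, coeff_zero_linSubst, coeff_zero_of_fedosovStep hs,
      MvPowerSeries.coeff_zero_X_mul]
  have h1 := congrArg (MvPowerSeries.coeff 0) ((nabla_basisVec s x i 0).symm.trans (congrFun h 0))
  rw [map_sub, MvPowerSeries.coeff_pderiv, zero_add] at h1
  have h4 : MvPowerSeries.coeff 0 (rem Ω D Φ s x (basisVec i) 0) = dirDeriv f x (basisVec i) :=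
    (map_add _ _ _).trans ((congrArg₂ (· + ·) (h3 (basisVec i)) h2).trans (add_zero _))
  refine Eq.trans ?_ ((sub_eq_zero.1 (h1.trans (map_zero _))).symm.trans h4)
  simp

end Flatness

/-- A linear function of the chart coordinates, cut off by a bump function. -/
theorem exists_contMDiff_dirDeriv [T2Space M] (x : M) (c : Fin d → ℂ) :
    ∃ f : M → ℂ, ContMDiff 𝓘(ℝ, Eu d) 𝓘(ℝ, ℂ) ∞ f ∧
      ∀ i, dirDeriv f x (basisVec i) = c i := by
  obtain ⟨ρ⟩ : Nonempty (SmoothBumpFunction 𝓘(ℝ, Eu d) x) := inferInstance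
  let L : Eu d →L[ℝ] ℂ := ∑ j, (ContinuousLinearMap.toSpanSingleton ℝ (c j)).comp
    (EuclideanSpace.proj j : Eu d →L[ℝ] ℝ)
  refine ⟨fun y => ρ y • L (extChartAt 𝓘(ℝ, Eu d) x y), ?_, fun i => ?_⟩
  · exact ρ.contMDiff_smul (L.contDiff.contMDiff.comp_contMDiffOn
      (contMDiffOn_extChartAt (I := 𝓘(ℝ, Eu d)) (x := x) (n := ∞)))
  · have h1 : (fun y => ρ y • L (extChartAt 𝓘(ℝ, Eu d) x y)) =ᶠ[𝓝 x]
        fun y => L (extChartAt 𝓘(ℝ, Eu d) x y) := by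
      filter_upwards [ρ.eventuallyEq_one] with y hy
      rw [hy]
      exact one_smul _ _
    refine (dirDeriv_congr _ h1).trans ?_
    have h2 : MDifferentiableAt 𝓘(ℝ, Eu d) 𝓘(ℝ, Eu d) (extChartAt 𝓘(ℝ, Eu d) x) x :=
      mdifferentiableAt_extChartAt (mem_chart_source _ x)
    have h3 := (L.hasMFDerivAt (x := extChartAt 𝓘(ℝ, Eu d) x x)).comp x h2.hasMFDerivAt
    -- At its own base point the preferred chart has derivative the identity, since it defines the
    -- identification of `T_x M` with the model space.
    have h4 : mfderiv 𝓘(ℝ, Eu d) 𝓘(ℝ, Eu d) (extChartAt 𝓘(ℝ, Eu d) x) x (basisVec i)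
        = basisVec i := by
      have h5 := mfderiv_chartAt_eq_tangentCoordChange (I := 𝓘(ℝ, Eu d))
        (mem_chart_source (Eu d) x)
      exact (congrArg (fun K : Eu d →L[ℝ] Eu d => K (basisVec i)) h5).trans
        (tangentCoordChange_self (I := 𝓘(ℝ, Eu d)) (mem_extChartAt_source x))
    refine (congrArg (fun K => K (basisVec i)) h3.mfderiv).trans ?_
    refine (congrArg L h4).trans ?_
    simp [L, basisVec, PiLp.single_apply]

/-! ### Flat sections and their centralizer. -/

namespace FedosovConnection

variable {Ω : SymplecticForm d M} (F : FedosovConnection Ω)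

theorem ordGE_pert (x : M) (v : TangentSpace 𝓘(ℝ, Eu d) x) : Weyl.OrdGE 3 (F.pert x v) :=
  F.pert_degree x v

/-- Fedosov's theorem: every smooth function extends to a flat section. -/
theorem exists_flat_section [T2Space M] (V : TopologicalSpace.Opens M) {f : M → ℂ}
    (hf : ContMDiff 𝓘(ℝ, Eu d) 𝓘(ℝ, ℂ) ∞ f) :
    ∃ σ ∈ F.kernel V, ∀ x : V, MvPowerSeries.coeff 0 (σ.1 x 0) = f x ∧
      ∀ i, MvPowerSeries.coeff (Finsupp.single i 1) (σ.1 x 0)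
        = dirDeriv f (x : M) (basisVec i) := by
  let s := fedosovLift Ω F.conn F.pert f
  have hs : fedosovStep Ω F.conn F.pert f s = s := fedosovStep_fedosovLift F.ordGE_pert
  have hsm : ∀ x, SmoothAt s x :=
    smoothAt_fedosovLift F.conn_smooth F.pert_smooth F.ordGE_pert hf
  have hext : ∀ W : TopologicalSpace.Opens M, ∀ x ∈ W,
      Ω.extend (fun y : W => (s y : Weyl (Ω.poisson y))) =ᶠ[𝓝 x] s := by
    intro W x hx
    filter_upwards [W.isOpen.mem_nhds hx] with y hy
    exact Ω.extend_apply _ hy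
  have hmem : ∀ W : TopologicalSpace.Opens M,
      (fun y : W => (s y : Weyl (Ω.poisson y))) ∈ Ω.sections W := fun W x hx =>
    SymplecticForm.smoothAt_congr (hsm x) (hext W x hx)
  have htop : Ω.extend (fun y : (⊤ : TopologicalSpace.Opens M) => (s y : Weyl (Ω.poisson y)))
      = s := funext fun y => Ω.extend_apply _ (show y ∈ (⊤ : TopologicalSpace.Opens M) from trivial)
  -- Flatness of the connection is stated for global sections, so the lift is built on all of `M`
  -- and then restricted to `V`.
  have hflat := F.flat _ (hmem ⊤)
  rw [htop] at hflat
  have h0 := nabla_eq_zero_of_fedosovStep F.ordGE_pert hs hflat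
  refine ⟨⟨_, hmem V⟩, fun x v => ?_, fun x => ⟨?_, fun i => ?_⟩⟩
  · exact (nabla_congr v (hext V x x.2)).trans (h0 x v)
  · exact coeff_zero_of_fedosovStep hs x 0
  · exact coeff_single_of_fedosovStep F.ordGE_pert hs (h0 x (basisVec i))

/-- The centralizer of the flat sections. -/
theorem isConst_of_commute_kernel [T2Space M] (V : TopologicalSpace.Opens M) (x : V)
    {a : Weyl (Ω.poisson (x : M))}
    (h : ∀ σ ∈ F.kernel V, a * σ.1 x = σ.1 x * a) : Weyl.IsConst a := by
  refine Weyl.isConst_of_commute (Ω.poisson_transpose x) (Ω.isUnit_det_poisson x) fun c => ?_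
  obtain ⟨f, hf, hfc⟩ := exists_contMDiff_dirDeriv (x : M) c
  obtain ⟨σ, hσ, hσx⟩ := F.exists_flat_section V hf
  -- The constant terms in all powers of `ħ`. Since `f` has differential `c` at `x`, the difference
  -- `σ - z - lin c` starts in degree two.
  let z : Weyl (Ω.poisson (x : M)) :=
    fun N => MvPowerSeries.C (MvPowerSeries.coeff 0 (σ.1 x N))
  have hz : ∀ N, z N = MvPowerSeries.C (MvPowerSeries.coeff 0 (σ.1 x N)) := fun N => rfl
  refine ⟨σ.1 x, z, fun i N => pd_C i _, fun N m hm => ?_, h σ hσ⟩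
  obtain rfl : N = 0 := by omega
  rw [Weyl.sub_apply, Weyl.sub_apply, Weyl.lin_apply_zero, hz, map_sub, map_sub, map_sum]
  rcases eq_or_ne m 0 with rfl | hm0
  · simp [MvPowerSeries.coeff_zero_C]
  · obtain ⟨i, rfl⟩ : ∃ i, m = Finsupp.single i 1 := by
      have h1 : m.degree = 1 := by
        have := mt (Finsupp.degree_eq_zero_iff m).1 hm0
        omega
      obtain ⟨i, hi⟩ := Finsupp.ne_iff.1 hm0
      have hi' : Finsupp.single i 1 ≤ m := by
        rw [Finsupp.single_le_iff]
        exact Nat.one_le_iff_ne_zero.2 hi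
      obtain ⟨m', rfl⟩ := exists_add_of_le hi'
      rw [map_add, Finsupp.degree_single, Nat.add_eq_left, Finsupp.degree_eq_zero_iff] at h1
      exact ⟨i, by rw [h1, add_zero]⟩
    rw [(hσx x).2 i, hfc, MvPowerSeries.coeff_C, if_neg hm0]
    simp [MvPowerSeries.coeff_X, Finsupp.single_left_inj]

end FedosovConnection

end Manifold

/-! ### The equivariance group, inner automorphisms and group actions. -/

section Manifold

variable {d : ℕ} {M : Type u} [TopologicalSpace M] [ChartedSpace (Eu d) M]
  [IsManifold 𝓘(ℝ, Eu d) ∞ M] {Ω : SymplecticForm d M}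

theorem SymplecticForm.mem_center_poisson_iff {x : M} {a : Weyl (Ω.poisson x)} :
    a ∈ Subring.center (Weyl (Ω.poisson x)) ↔ Weyl.IsConst a :=
  Weyl.mem_center_iff_isConst (Ω.poisson_transpose x) (Ω.isUnit_det_poisson x)

theorem mem_center_commute {R : Type*} [Ring R] {c : R} (h : c ∈ Subring.center R) (a : R) :
    a * c = c * a :=
  Subring.mem_center_iff.1 h a

namespace SymplecticForm

variable {V : TopologicalSpace.Opens M}

theorem units_mul_inv_apply (U : (Ω.sections V)ˣ) (x : V) :
    (U : Ω.sections V).1 x * (↑U⁻¹ : Ω.sections V).1 x = 1 :=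
  congrFun (congrArg Subtype.val U.mul_inv) x

theorem units_inv_mul_apply (U : (Ω.sections V)ˣ) (x : V) :
    (↑U⁻¹ : Ω.sections V).1 x * (U : Ω.sections V).1 x = 1 :=
  congrFun (congrArg Subtype.val U.inv_mul) x

end SymplecticForm

namespace FedosovConnection

variable (F : FedosovConnection Ω) {V : TopologicalSpace.Opens M}

theorem deriv_inv_mul (U : (Ω.sections V)ˣ) (x : V) (v : TangentSpace 𝓘(ℝ, Eu d) (x : M)) :
    F.deriv (↑U⁻¹ : Ω.sections V) x v * (U : Ω.sections V).1 x
      = -((↑U⁻¹ : Ω.sections V).1 x * F.deriv (U : Ω.sections V) x v) := by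
  have h := F.deriv_mul (↑U⁻¹) (U : Ω.sections V) x v
  rw [U.inv_mul, F.deriv_one] at h
  exact eq_neg_of_add_eq_zero_left h.symm

theorem deriv_eq_mul (U : (Ω.sections V)ˣ) (x : V) (v : TangentSpace 𝓘(ℝ, Eu d) (x : M)) :
    F.deriv (U : Ω.sections V) x v = (U : Ω.sections V).1 x *
      -(F.deriv (↑U⁻¹ : Ω.sections V) x v * (U : Ω.sections V).1 x) := by
  rw [deriv_inv_mul, neg_neg, ← mul_assoc, Ω.units_mul_inv_apply, one_mul]

/-- Differentiating `U⁻¹ U = 1` gives `∇(U⁻¹) U = -U⁻¹ ∇U`, so the condition may be imposed on `U⁻¹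
∇U`. -/
theorem isEquivariant_iff (U : (Ω.sections V)ˣ) : F.IsEquivariant U ↔
    ∀ (x : V) (v : TangentSpace 𝓘(ℝ, Eu d) (x : M)),
      ∃ c ∈ Subring.center (Weyl (Ω.poisson x)),
        F.deriv (U : Ω.sections V) x v = (U : Ω.sections V).1 x * c := by
  refine forall_congr' fun x => forall_congr' fun v => ⟨fun h => ⟨_, neg_mem h,
    F.deriv_eq_mul U x v⟩, ?_⟩
  rintro ⟨c, hc, h⟩
  rw [deriv_inv_mul, h, ← mul_assoc, Ω.units_inv_mul_apply, one_mul]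
  exact neg_mem hc

theorem IsEquivariant.inv {F : FedosovConnection Ω} {U : (Ω.sections V)ˣ}
    (h : F.IsEquivariant U) : F.IsEquivariant U⁻¹ := by
  refine (F.isEquivariant_iff _).2 fun x v => ⟨_, h x v, ?_⟩
  rw [mem_center_commute (h x v), mul_assoc, Ω.units_mul_inv_apply, mul_one]

/-- A unit is equivariant if and only if conjugation with it preserves flatness. -/
theorem isEquivariant_iff_kernel [T2Space M] (U : (Ω.sections V)ˣ) : F.IsEquivariant U ↔
    ∀ k ∈ F.kernel V, (U : Ω.sections V) * k * ↑U⁻¹ ∈ F.kernel V := by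
  rw [isEquivariant_iff]
  constructor
  -- With `∇U = U c` and `∇(U⁻¹) = -c U⁻¹`, the derivative of `U k U⁻¹` is `U [c, k] U⁻¹`, which
  -- vanishes for central `c`.
  · intro h k hk x v
    obtain ⟨c, hc, hU⟩ := h x v
    have h1 := F.deriv_inv_mul U x v
    rw [hU, ← mul_assoc, Ω.units_inv_mul_apply, one_mul] at h1
    have h2 : F.deriv (↑U⁻¹ : Ω.sections V) x v = -c * (↑U⁻¹ : Ω.sections V).1 x := by
      rw [← h1, mul_assoc, Ω.units_mul_inv_apply, mul_one]
    rw [F.deriv_mul, F.deriv_mul, hk, mul_zero, add_zero, hU, h2]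
    have h3 := mem_center_commute hc (k.1 x)
    change (U : Ω.sections V).1 x * c * k.1 x * (↑U⁻¹ : Ω.sections V).1 x
      + (U : Ω.sections V).1 x * k.1 x * (-c * (↑U⁻¹ : Ω.sections V).1 x) = 0
    rw [mul_assoc _ c, ← h3]
    noncomm_ring
  · intro h x v
    refine ⟨(↑U⁻¹ : Ω.sections V).1 x * F.deriv (U : Ω.sections V) x v, ?_, ?_⟩
    · refine (F.isConst_of_commute_kernel V x fun k hk => ?_).mem_center
      -- Differentiating this identity, with `k` and `U k U⁻¹` flat, gives `(∇U) k = U k U⁻¹ ∇U`.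
      -- Hence `U⁻¹ ∇U` commutes with every flat section.
      have h1 : (U : Ω.sections V) * k * ↑U⁻¹ * U = U * k := by
        rw [mul_assoc, U.inv_mul, mul_one]
      have h2 := F.deriv_mul ((U : Ω.sections V) * k * (↑U⁻¹ : Ω.sections V)) U x v
      rw [h1, F.deriv_mul, hk, mul_zero, add_zero, h k hk, zero_mul, zero_add] at h2
      rw [mul_assoc, h2]
      change (↑U⁻¹ : Ω.sections V).1 x * ((U : Ω.sections V).1 x * k.1 x
        * (↑U⁻¹ : Ω.sections V).1 x * _) = _
      rw [mul_assoc, mul_assoc, ← mul_assoc, Ω.units_inv_mul_apply, one_mul]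
    · rw [← mul_assoc, Ω.units_mul_inv_apply, one_mul]

/-- The centre of the section ring consists of the sections with values in the fibrewise centres.
The connection serves only to supply enough sections over `V`: the flat ones already have trivial
centralizer. -/
theorem mem_center_sections_iff [T2Space M] (F : FedosovConnection Ω) (σ : Ω.sections V) :
    σ ∈ Subring.center (Ω.sections V) ↔ ∀ x, Weyl.IsConst (σ.1 x) := by
  constructor
  · intro h x
    refine F.isConst_of_commute_kernel V x fun k _ => ?_
    exact congrFun (congrArg Subtype.val (mem_center_commute h k)).symm x
  · intro h
    exact Subring.mem_center_iff.2 fun τ => Subtype.ext (funext fun x =>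
      mem_center_commute (h x).mem_center (τ.1 x))

/-- The Fedosov equivariance group over `V`. -/
def equivarianceGroup [T2Space M] (V : TopologicalSpace.Opens M) : Subgroup (Ω.sections V)ˣ where
  carrier := {U | F.IsEquivariant U}
  one_mem' := (F.isEquivariant_iff_kernel 1).2 fun k hk => by
    rwa [inv_one, Units.val_one, mul_one, one_mul]
  mul_mem' {U U'} hU hU' := (F.isEquivariant_iff_kernel _).2 fun k hk => by
    have h := (F.isEquivariant_iff_kernel U).1 hU _ ((F.isEquivariant_iff_kernel U').1 hU' k hk)
    rw [mul_inv_rev, Units.val_mul, Units.val_mul]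
    simpa only [mul_assoc] using h
  -- Mapping `Ker ∇` into itself is not visibly stable under inverses; the centrality condition is.
  inv_mem' := IsEquivariant.inv

variable [T2Space M]

theorem mem_equivarianceGroup {U : (Ω.sections V)ˣ} :
    U ∈ F.equivarianceGroup V ↔ F.IsEquivariant U := Iff.rfl

theorem conj_mem_kernel {U : (Ω.sections V)ˣ} (hU : U ∈ F.equivarianceGroup V) {k : Ω.sections V}
    (hk : k ∈ F.kernel V) : (U : Ω.sections V) * k * ↑U⁻¹ ∈ F.kernel V :=
  (F.isEquivariant_iff_kernel U).1 hU k hk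

theorem centralUnits_le (V : TopologicalSpace.Opens M) :
    centralUnits (Ω.sections V) ≤ F.equivarianceGroup V := fun z hz =>
  (F.isEquivariant_iff_kernel z).2 fun k hk => by
    have h : k * (z : Ω.sections V) = z * k := mem_center_commute hz.1 k
    rwa [← h, mul_assoc, z.mul_inv, mul_one]

theorem centralUnits_normal {R : Type*} [Ring R] (G : Subgroup Rˣ) :
    ((centralUnits R).subgroupOf G).Normal := by
  refine ⟨fun z hz g => ?_⟩
  have h : (g : Rˣ) * z = z * g := Units.ext (mem_center_commute hz.1 _)
  have h2 : g * z * g⁻¹ = z := Subtype.ext (by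
    rw [Subgroup.coe_mul, Subgroup.coe_mul, h, Subgroup.coe_inv, mul_inv_cancel_right])
  rwa [h2]

theorem flatUnits_le (V : TopologicalSpace.Opens M) : F.flatUnits V ≤ F.equivarianceGroup V :=
  fun u hu => (F.isEquivariant_iff_kernel u).2 fun _ hk => mul_mem (mul_mem hu.1 hk) hu.2

theorem flatUnits_normal (V : TopologicalSpace.Opens M) :
    ((F.flatUnits V).subgroupOf (F.equivarianceGroup V)).Normal := by
  refine ⟨fun u hu g => ⟨?_, ?_⟩⟩
  · exact F.conj_mem_kernel g.2 hu.1
  -- The inverse must be flat as well, and it is the conjugate of `u⁻¹`.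
  · have h := F.conj_mem_kernel g.2 hu.2
    refine (congrArg (· ∈ F.kernel V) ?_).mpr h
    change ((((g : (Ω.sections V)ˣ) * u * (g : (Ω.sections V)ˣ)⁻¹)⁻¹ : (Ω.sections V)ˣ)
      : Ω.sections V) = _
    rw [mul_inv_rev, mul_inv_rev, inv_inv, ← mul_assoc]
    rfl

/-- `U ↦ Ad U` with values in `Inn(Γ(V, 𝒲) | Ker ∇)`. -/
def adHom (V : TopologicalSpace.Opens M) : F.equivarianceGroup V →* relInner (F.kernel V) :=
  ((Ad (Ω.sections V)).comp (F.equivarianceGroup V).subtype).codRestrict _ fun U =>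
    ⟨⟨U, rfl⟩, fun r => by
      refine ⟨fun h => ?_, fun h => ?_⟩
      -- Conjugating back with `U⁻¹`, which is again equivariant.
      · have h1 := F.conj_mem_kernel (inv_mem U.2) h
        refine (congrArg (· ∈ F.kernel V) ?_).mp h1
        change _ * Ad _ (U : (Ω.sections V)ˣ) r * _ = _
        rw [Ad_apply, inv_inv, mul_assoc, mul_assoc, mul_assoc, Units.inv_mul, mul_one,
          Units.inv_mul_cancel_left]
      · have h1 := F.conj_mem_kernel U.2 h
        rw [← Ad_apply] at h1
        exact h1⟩

theorem adHom_surjective (V : TopologicalSpace.Opens M) : Function.Surjective (F.adHom V) := by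
  rintro ⟨φ, ⟨U, rfl⟩, h⟩
  refine ⟨⟨U, (F.isEquivariant_iff_kernel U).2 fun k hk => ?_⟩, rfl⟩
  rw [← Ad_apply]
  exact (h k).2 hk

theorem ker_Ad (R : Type*) [Ring R] : (Ad R).ker = centralUnits R := by
  ext U
  rw [MonoidHom.mem_ker]
  have h1 : Ad R U = 1 ↔ ∀ r : R, r * U = U * r := by
    refine RingEquiv.ext_iff.trans (forall_congr' fun r => ?_)
    rw [Ad_apply, Units.mul_inv_eq_iff_eq_mul]
    exact eq_comm
  rw [h1]
  refine ⟨fun h => ⟨Subring.mem_center_iff.2 h, Subring.mem_center_iff.2 fun r => ?_⟩,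
    fun h => mem_center_commute h.1⟩
  change r * (↑U⁻¹ : R) = ↑U⁻¹ * r
  rw [Units.eq_inv_mul_iff_mul_eq, ← mul_assoc, ← h, mul_assoc, U.mul_inv, mul_one]

theorem ker_adHom (V : TopologicalSpace.Opens M) :
    (F.adHom V).ker = (centralUnits (Ω.sections V)).subgroupOf (F.equivarianceGroup V) := by
  ext U
  rw [← ker_Ad, Subgroup.mem_subgroupOf, MonoidHom.mem_ker, MonoidHom.mem_ker, Subtype.ext_iff]
  rfl

theorem exists_quotient_equiv (V : TopologicalSpace.Opens M) :
    ∃ (_ : ((centralUnits (Ω.sections V)).subgroupOf (F.equivarianceGroup V)).Normal)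
      (e : (F.equivarianceGroup V ⧸ (centralUnits (Ω.sections V)).subgroupOf
        (F.equivarianceGroup V)) ≃* relInner (F.kernel V)),
      ∀ U : F.equivarianceGroup V, (e (QuotientGroup.mk U) : RingAut (Ω.sections V)) =
        Ad (Ω.sections V) (U : (Ω.sections V)ˣ) :=
  ⟨centralUnits_normal _,
    letI := centralUnits_normal (F.equivarianceGroup V)
    (QuotientGroup.quotientMulEquivOfEq (F.ker_adHom V).symm).trans
      (QuotientGroup.quotientKerEquivOfSurjective _ (F.adHom_surjective V)), fun _ => rfl⟩

/-- On flat sections, conjugation by `U · φ^*g · U⁻¹` is `a ∘ Ad g ∘ a⁻¹`, and all three factors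
preserve `Ker ∇`. -/
theorem conj_pullback_mem {φ : M → M} (hφ : Ω.IsSymplecticMap φ) (a : RingAut (F.kernel ⊤))
    {U : (Ω.sections ⊤)ˣ} (h : F.IsAdPullback hφ a U) {g : (Ω.sections ⊤)ˣ}
    (hg : g ∈ F.equivarianceGroup ⊤) :
    U * Units.map hφ.pullback.toMonoidHom g * U⁻¹ ∈ F.equivarianceGroup ⊤ := by
  refine (F.isEquivariant_iff_kernel _).2 fun k hk => ?_
  -- Writing `k = U (φ^*k') U⁻¹` brings the conjugate into the form `a (g k' g⁻¹)`.
  obtain ⟨k', hk'⟩ := a.surjective ⟨k, hk⟩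
  have h1 := h k'
  rw [hk', Ad_apply] at h1
  have h2 := h ⟨_, F.conj_mem_kernel hg k'.2⟩
  rw [Ad_apply] at h2
  have h3 := (a ⟨_, F.conj_mem_kernel hg k'.2⟩).2
  rw [h2, map_mul, map_mul] at h3
  refine (congrArg (· ∈ F.kernel ⊤) ?_).mp h3
  rw [show k = _ from h1]
  simp only [mul_inv_rev, inv_inv, Units.val_mul, ← mul_assoc, Units.inv_mul_cancel_right]
  rfl

end FedosovConnection

end Manifold

/-! ### Locality and the sheaf property. -/

section Manifold

variable {d : ℕ} {M : Type u} [TopologicalSpace M] [ChartedSpace (Eu d) M]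
  [IsManifold 𝓘(ℝ, Eu d) ∞ M] {Ω : SymplecticForm d M}

theorem FedosovConnection.deriv_restrict (F : FedosovConnection Ω)
    {V V' : TopologicalSpace.Opens M} (h : V' ≤ V) (σ : Ω.sections V) (x : V')
    (v : TangentSpace 𝓘(ℝ, Eu d) (x : M)) :
    F.deriv (Ω.restrict h σ) x v = F.deriv σ ⟨x, h x.2⟩ v := by
  refine nabla_congr v ?_
  filter_upwards [V'.isOpen.mem_nhds x.2] with y hy
  rw [Ω.extend_apply _ hy, Ω.extend_apply _ (h hy)]
  rfl

theorem FedosovConnection.IsEquivariant.restrict {F : FedosovConnection Ω}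
    {V V' : TopologicalSpace.Opens M} (h : V' ≤ V) {U : (Ω.sections V)ˣ} (hU : F.IsEquivariant U) :
    F.IsEquivariant (Units.map (Ω.restrict h).toMonoidHom U) := by
  intro x v
  refine (congrArg (· ∈ Subring.center (Weyl (Ω.poisson (x : M)))) ?_).mpr (hU ⟨x, h x.2⟩ v)
  exact congrArg (· * (U : Ω.sections V).1 ⟨x, h x.2⟩) (F.deriv_restrict h (↑U⁻¹) x v)

namespace SymplecticForm

variable {ι : Type*} {W : ι → TopologicalSpace.Opens M}

/-- Sections that agree on overlaps glue. -/
theorem exists_glue (s : ∀ i, Ω.sections (W i))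
    (h : ∀ i j (x : M) (hi : x ∈ W i) (hj : x ∈ W j), (s i).1 ⟨x, hi⟩ = (s j).1 ⟨x, hj⟩) :
    ∃ σ : Ω.sections (iSup W), ∀ i (x : M) (hi : x ∈ W i),
      σ.1 ⟨x, TopologicalSpace.Opens.mem_iSup.2 ⟨i, hi⟩⟩ = (s i).1 ⟨x, hi⟩ := by
  choose k hk using fun x : (iSup W : TopologicalSpace.Opens M) =>
    TopologicalSpace.Opens.mem_iSup.1 x.2
  refine ⟨⟨fun x => (s (k x)).1 ⟨x, hk x⟩, fun x hx => ?_⟩, fun i x hi => h _ _ _ _ _⟩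
  obtain ⟨i, hi⟩ := TopologicalSpace.Opens.mem_iSup.1 hx
  refine smoothAt_congr ((s i).2 x hi) ?_
  filter_upwards [(W i).isOpen.mem_nhds hi] with y hy
  rw [Ω.extend_apply _ hy, Ω.extend_apply _ (TopologicalSpace.Opens.mem_iSup.2 ⟨i, hy⟩)]
  exact h _ _ _ _ _

theorem exists_units_glue (s : ∀ i, (Ω.sections (W i))ˣ)
    (h : ∀ i j (x : M) (hi : x ∈ W i) (hj : x ∈ W j),
      (s i : Ω.sections (W i)).1 ⟨x, hi⟩ = (s j : Ω.sections (W j)).1 ⟨x, hj⟩) :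
    ∃ σ : (Ω.sections (iSup W))ˣ, ∀ i,
      Units.map (Ω.restrict (le_iSup W i)).toMonoidHom σ = s i := by
  obtain ⟨σ, hσ⟩ := Ω.exists_glue (fun i => (s i : Ω.sections (W i))) h
  -- The inverses agree on overlaps because inverses in each fibre are unique; gluing them makes the
  -- glued section a unit.
  obtain ⟨τ, hτ⟩ := Ω.exists_glue (fun i => (↑(s i)⁻¹ : Ω.sections (W i))) fun i j x hi hj => by
    refine left_inv_eq_right_inv (Ω.units_inv_mul_apply (s i) ⟨x, hi⟩) ?_
    exact (congrArg (· * _) (h i j x hi hj)).trans (Ω.units_mul_inv_apply (s j) ⟨x, hj⟩)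
  refine ⟨⟨σ, τ, Subtype.ext (funext fun x => ?_), Subtype.ext (funext fun x => ?_)⟩,
    fun i => Units.ext (Subtype.ext (funext fun x => hσ i x x.2))⟩
  · obtain ⟨i, hi⟩ := TopologicalSpace.Opens.mem_iSup.1 x.2
    exact (congrArg₂ (· * ·) (hσ i x hi) (hτ i x hi)).trans (Ω.units_mul_inv_apply (s i) ⟨x, hi⟩)
  · obtain ⟨i, hi⟩ := TopologicalSpace.Opens.mem_iSup.1 x.2
    exact (congrArg₂ (· * ·) (hτ i x hi) (hσ i x hi)).trans (Ω.units_inv_mul_apply (s i) ⟨x, hi⟩)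

end SymplecticForm

open CategoryTheory Opposite in
theorem FedosovConnection.isSheaf_equivarianceGroup [T2Space M] (F : FedosovConnection Ω)
    (h : ∀ {V V' : TopologicalSpace.Opens M} (i : V' ⟶ V),
      ∀ U ∈ F.equivarianceGroup V, Ω.unitsPresheaf.map i.op U ∈ F.equivarianceGroup V') :
    (subgroupPresheaf Ω.unitsPresheaf F.equivarianceGroup h).IsSheaf := by
  -- The sheaf condition can be tested on underlying sets, where it is unique gluing.
  rw [TopCat.Presheaf.isSheaf_iff_isSheaf_comp (forget GrpCat.{u})]
  refine TopCat.Presheaf.isSheaf_of_isSheafUniqueGluing_types _ ?_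
  intro ι W s hs
  let t : ∀ i, F.equivarianceGroup (W i) := s
  have ht : ∀ i j (x : M) (hi : x ∈ W i) (hj : x ∈ W j),
      ((t i : (Ω.sections (W i))ˣ) : Ω.sections (W i)).1 ⟨x, hi⟩
        = ((t j : (Ω.sections (W j))ˣ) : Ω.sections (W j)).1 ⟨x, hj⟩ := by
    intro i j x hi hj
    have h1 := congrArg (fun r : F.equivarianceGroup (W i ⊓ W j) =>
      ((r : (Ω.sections (W i ⊓ W j))ˣ) : Ω.sections (W i ⊓ W j)).1 ⟨x, hi, hj⟩) (hs i j)
    exact h1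
  obtain ⟨σ, hσ⟩ := Ω.exists_units_glue (fun i => (t i : (Ω.sections (W i))ˣ)) ht
  -- Equivariance is a condition at each point on the germ of the unit, so it passes from the pieces
  -- to the glued unit.
  have hmem : σ ∈ F.equivarianceGroup (iSup W) := by
    intro x v
    obtain ⟨i, hi⟩ := TopologicalSpace.Opens.mem_iSup.1 x.2
    have h1 := (t i).2 ⟨x, hi⟩ v
    refine (congrArg (· ∈ Subring.center (Weyl (Ω.poisson (x : M)))) ?_).mpr h1
    rw [← hσ i]
    exact congrArg (· * _) (F.deriv_restrict (le_iSup W i) (↑σ⁻¹) ⟨x, hi⟩ v).symm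
  refine ⟨(⟨σ, hmem⟩ : F.equivarianceGroup (iSup W)), fun i => Subtype.ext (hσ i), fun τ hτ => ?_⟩
  refine Subtype.ext (Units.ext (Subtype.ext (funext fun x => ?_)))
  obtain ⟨i, hi⟩ := TopologicalSpace.Opens.mem_iSup.1 x.2
  have h1 := congrArg (fun r : F.equivarianceGroup (W i) =>
      ((r : (Ω.sections (W i))ˣ) : Ω.sections (W i)).1 ⟨x, hi⟩) (hτ i)
  have h2 := congrArg (fun r : (Ω.sections (W i))ˣ => (r : Ω.sections (W i)).1 ⟨x, hi⟩) (hσ i)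
  exact h1.trans h2.symm

end Manifold

/-! ### Exponentials of power series in `ħ`. -/

/-- The coefficients of the exponential of the power series `∑ f n * X ^ n`. -/
def expCoeff (f : ℕ → ℂ) : ℕ → ℂ
  | 0 => Complex.exp (f 0)
  -- The recursion encodes `E' = f' E`. It avoids infinite sums: only the constant term needs the
  -- analytic exponential.
  | n + 1 => (n + 1 : ℂ)⁻¹ *
      ∑ q : Fin (n + 1), ((n - q : ℕ) + 1) * f (n - q + 1) * expCoeff f q

theorem expCoeff_zero (f : ℕ → ℂ) : expCoeff f 0 = Complex.exp (f 0) := by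
  rw [expCoeff]

theorem expCoeff_succ (f : ℕ → ℂ) (n : ℕ) : expCoeff f (n + 1) = (n + 1 : ℂ)⁻¹ *
    ∑ p ∈ antidiagonal n, ((p.1 : ℂ) + 1) * f (p.1 + 1) * expCoeff f p.2 := by
  rw [expCoeff, ← Finset.Nat.sum_antidiagonal_swap,
    Finset.Nat.sum_antidiagonal_eq_sum_range_succ_mk, Finset.sum_range]
  rfl

theorem derivative_expCoeff (f : ℕ → ℂ) :
    PowerSeries.derivative ℂ (PowerSeries.mk (expCoeff f))
      = PowerSeries.derivative ℂ (PowerSeries.mk f) * PowerSeries.mk (expCoeff f) := by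
  ext n
  have hn : (n + 1 : ℂ) ≠ 0 := by exact_mod_cast n.succ_ne_zero
  rw [PowerSeries.coeff_derivative, PowerSeries.coeff_mk, expCoeff_succ, mul_comm,
    mul_inv_cancel_left₀ hn, PowerSeries.coeff_mul]
  refine Finset.sum_congr rfl fun p _ => ?_
  rw [PowerSeries.coeff_derivative, PowerSeries.coeff_mk, PowerSeries.coeff_mk, mul_comm (f _)]

/-- The product has formal derivative `(f' - f') E = 0`, with `E` the product itself, and constant
term `exp (f 0) exp (-f 0) = 1`. -/
theorem expCoeff_mul_neg (f : ℕ → ℂ) :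
    PowerSeries.mk (expCoeff f) * PowerSeries.mk (expCoeff (-f)) = 1 := by
  have hneg : PowerSeries.mk (-f) = -PowerSeries.mk f := by
    ext n
    simp
  refine PowerSeries.derivative.ext ?_ ?_
  · rw [Derivation.leibniz, derivative_expCoeff, derivative_expCoeff, hneg, map_neg,
      PowerSeries.derivative_one, smul_eq_mul, smul_eq_mul]
    ring
  · rw [map_mul, map_one, PowerSeries.constantCoeff_mk, PowerSeries.constantCoeff_mk,
      expCoeff_zero, expCoeff_zero, ← Complex.exp_add, Pi.neg_apply, add_neg_cancel,
      Complex.exp_zero]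

/-- Uniqueness for the linear differential equation `E' = g * E`. -/
theorem eq_zero_of_derivative_eq_mul {E g : PowerSeries ℂ}
    (h : PowerSeries.derivative ℂ E = g * E) (h0 : PowerSeries.coeff 0 E = 0) : E = 0 := by
  ext n
  induction n using Nat.strong_induction_on with
  | _ n ih =>
    rcases n with _ | n
    · exact h0
    · have h1 := congrArg (PowerSeries.coeff n) h
      rw [PowerSeries.coeff_derivative, PowerSeries.coeff_mul, Finset.sum_eq_zero] at h1
      · have hn : (n + 1 : ℂ) ≠ 0 := by exact_mod_cast n.succ_ne_zero
        exact (mul_eq_zero.1 h1).resolve_right hn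
      · intro p hp
        have := Finset.HasAntidiagonal.mem_antidiagonal.1 hp
        rw [ih p.2 (by omega), map_zero, mul_zero]

/-! ### Central elements as power series in `ħ`. -/

namespace Weyl

variable {d : ℕ} {P : Matrix (Fin d) (Fin d) ℂ}

theorem sum_apply {ι : Type*} [Fintype ι] (a : ι → Weyl P) (N : ℕ) :
    (∑ i, a i) N = ∑ i, a i N :=
  Finset.sum_apply (M := fun _ : ℕ => FormalFun d) N Finset.univ a

/-- The central element `∑ g N * ħ ^ N`. -/
def const (g : ℕ → ℂ) : Weyl P := fun N => MvPowerSeries.C (g N)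

theorem const_apply (g : ℕ → ℂ) (N : ℕ) : (const g : Weyl P) N = MvPowerSeries.C (g N) := rfl

theorem isConst_const (g : ℕ → ℂ) : IsConst (const g : Weyl P) := fun i N => pd_C i (g N)

/-- Identifies multiplication in the centre with that of `ℂ⟦ħ⟧`, which transports the identities for
`expCoeff`. -/
theorem const_mul (g h : ℕ → ℂ) : (const g * const h : Weyl P)
    = const fun N => PowerSeries.coeff N (PowerSeries.mk g * PowerSeries.mk h) := by
  ext1 N
  rw [(isConst_const g).mul_apply, const_apply, PowerSeries.coeff_mul, map_sum]
  refine Finset.sum_congr rfl fun p _ => ?_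
  rw [const_apply, const_apply, ← map_mul, PowerSeries.coeff_mk, PowerSeries.coeff_mk]

theorem const_coeff_one :
    (const fun N => PowerSeries.coeff N (1 : PowerSeries ℂ)) = (1 : Weyl P) := by
  ext1 N
  rw [const_apply, one_apply, PowerSeries.coeff_one]
  split_ifs
  · exact map_one _
  · exact map_zero _

theorem IsConst.eq_const {a : Weyl P} (h : IsConst a) :
    a = const fun N => MvPowerSeries.coeff 0 (a N) := by
  classical
  ext1 N
  ext m
  rw [const_apply, MvPowerSeries.coeff_C]
  split_ifs with hm
  · rw [hm]
  · exact (pd_eq_zero_iff (a N)).1 (fun i => h i N) m hm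

end Weyl

/-! ### Derivatives of exponentials and of central sections. -/

section Manifold

variable {d : ℕ} {M : Type u} [TopologicalSpace M] [ChartedSpace (Eu d) M]

theorem contMDiffAt_expCoeff {f : M → ℕ → ℂ} {x : M}
    (hf : ∀ N, ContMDiffAt 𝓘(ℝ, Eu d) 𝓘(ℝ, ℂ) ∞ (fun y => f y N) x) (N : ℕ) :
    ContMDiffAt 𝓘(ℝ, Eu d) 𝓘(ℝ, ℂ) ∞ (fun y => expCoeff (f y) N) x := by
  induction N using Nat.strong_induction_on with
  | _ N ih =>
    rcases N with _ | N
    · simp only [expCoeff_zero]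
      exact Complex.contDiff_exp.contMDiff.contMDiffAt.comp x (hf 0)
    · simp only [expCoeff_succ]
      refine cmul contMDiffAt_const (csum fun p hp => ?_)
      have := Finset.HasAntidiagonal.mem_antidiagonal.1 hp
      exact cmul (cmul contMDiffAt_const (hf _)) (ih _ (by omega))

variable [IsManifold 𝓘(ℝ, Eu d) ∞ M]

theorem dirDeriv_const_mul {f : M → ℂ} {x : M} (v : TangentSpace 𝓘(ℝ, Eu d) x) (c : ℂ)
    (hf : ContMDiffAt 𝓘(ℝ, Eu d) 𝓘(ℝ, ℂ) ∞ f x) :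
    dirDeriv (fun y => c * f y) x v = c * dirDeriv f x v := by
  rw [dirDeriv_mul v contMDiffAt_const hf, dirDeriv_const, zero_mul, zero_add]

theorem dirDeriv_exp {f : M → ℂ} {x : M} (v : TangentSpace 𝓘(ℝ, Eu d) x)
    (hf : ContMDiffAt 𝓘(ℝ, Eu d) 𝓘(ℝ, ℂ) ∞ f x) :
    dirDeriv (fun y => Complex.exp (f y)) x v = dirDeriv f x v * Complex.exp (f x) := by
  have h1 : HasMFDerivAt 𝓘(ℝ, ℂ) 𝓘(ℝ, ℂ) Complex.exp (f x)
      ((Complex.exp (f x)) • (1 : ℂ →L[ℝ] ℂ)) :=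
    ((Complex.hasStrictDerivAt_exp (f x)).hasDerivAt.complexToReal_fderiv).hasMFDerivAt
  refine (congrArg (fun L => L v) (h1.comp x (mdiff hf).hasMFDerivAt).mfderiv).trans ?_
  exact mul_comm (Complex.exp (f x)) (dirDeriv f x v)

/-- The derivative `Y'` along `v` and the product `F * Y` satisfy the same inhomogeneous first-order
linear equation in `ħ` with the same constant term, so uniqueness for the homogeneous equation
identifies them. -/
theorem dirDeriv_expCoeff {f : M → ℕ → ℂ} {x : M} (v : TangentSpace 𝓘(ℝ, Eu d) x)
    (hf : ∀ N, ContMDiffAt 𝓘(ℝ, Eu d) 𝓘(ℝ, ℂ) ∞ (fun y => f y N) x) :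
    PowerSeries.mk (fun N => dirDeriv (fun y => expCoeff (f y) N) x v)
      = PowerSeries.mk (fun N => dirDeriv (fun y => f y N) x v)
        * PowerSeries.mk (expCoeff (f x)) := by
  have hexp := contMDiffAt_expCoeff hf
  set Y := PowerSeries.mk (expCoeff (f x))
  set G := PowerSeries.mk (f x)
  set F := PowerSeries.mk (fun N => dirDeriv (fun y => f y N) x v)
  set Y' := PowerSeries.mk (fun N => dirDeriv (fun y => expCoeff (f y) N) x v)
  have h1 : PowerSeries.derivative ℂ Y'
      = PowerSeries.derivative ℂ F * Y + PowerSeries.derivative ℂ G * Y' := by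
    ext n
    have hn : (n + 1 : ℂ) ≠ 0 := by exact_mod_cast n.succ_ne_zero
    rw [PowerSeries.coeff_derivative, PowerSeries.coeff_mk, map_add, PowerSeries.coeff_mul,
      PowerSeries.coeff_mul, ← Finset.sum_add_distrib]
    simp only [expCoeff_succ]
    have h2 : ∀ p ∈ antidiagonal n, ContMDiffAt 𝓘(ℝ, Eu d) 𝓘(ℝ, ℂ) ∞
        (fun y => ((p.1 : ℂ) + 1) * f y (p.1 + 1) * expCoeff (f y) p.2) x := fun p _ =>
      cmul (cmul contMDiffAt_const (hf _)) (hexp _)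
    rw [dirDeriv_const_mul v _ (csum h2), mul_comm, mul_inv_cancel_left₀ hn, dirDeriv_sum v h2]
    refine Finset.sum_congr rfl fun p _ => ?_
    rw [dirDeriv_mul v (cmul contMDiffAt_const (hf _)) (hexp _), dirDeriv_const_mul v _ (hf _),
      PowerSeries.coeff_derivative, PowerSeries.coeff_derivative]
    simp only [Y, Y', F, G, PowerSeries.coeff_mk]
    ring
  have h2 := eq_zero_of_derivative_eq_mul (E := Y' - F * Y) (g := PowerSeries.derivative ℂ G)
    (by
      rw [map_sub, h1, Derivation.leibniz, smul_eq_mul, smul_eq_mul,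
        show PowerSeries.derivative ℂ Y = PowerSeries.derivative ℂ G * Y from
          derivative_expCoeff (f x)]
      ring)
    (by
      simp only [Y, Y', F, map_sub, PowerSeries.coeff_mul, Finset.Nat.antidiagonal_zero,
        Finset.sum_singleton, PowerSeries.coeff_mk,
        expCoeff_zero, dirDeriv_exp v (hf 0), sub_self])
  exact sub_eq_zero.1 h2

variable {Ω : SymplecticForm d M}

theorem smoothAt_const {g : M → ℕ → ℂ} {x : M}
    (hg : ∀ N, ContMDiffAt 𝓘(ℝ, Eu d) 𝓘(ℝ, ℂ) ∞ (fun y => g y N) x) :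
    SmoothAt (d := d) (fun y N => MvPowerSeries.C (g y N)) x := by
  classical
  intro N m
  simp only [localRep, linSubst_C, MvPowerSeries.coeff_C]
  split_ifs
  · exact hg N
  · exact contMDiffAt_const

/-- Brackets with central elements vanish, and `∇₀` sees no fibre coordinates, so only the
derivative of the coefficients remains. -/
theorem nabla_const {D : AffineConnection d M}
    {Φ : ∀ x : M, TangentSpace 𝓘(ℝ, Eu d) x →ₗ[ℝ] Weyl (Ω.poisson x)} (g : M → ℕ → ℂ) (x : M)
    (v : TangentSpace 𝓘(ℝ, Eu d) x) :
    nabla Ω D Φ (fun y N => MvPowerSeries.C (g y N)) x v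
      = Weyl.const fun N => dirDeriv (fun y => g y N) x v := by
  classical
  have hb : ∀ a : Weyl (Ω.poisson x),
      Weyl.bracket a (Weyl.const (g x) : Weyl (Ω.poisson x)) = 0 := fun a =>
    Weyl.bracket_eq_zero_of_commute
      (mem_center_commute (Weyl.isConst_const (g x)).mem_center a)
  have h : nabla Ω D Φ (fun y N => MvPowerSeries.C (g y N)) x v
      = nablaZero Ω D (fun y N => MvPowerSeries.C (g y N)) x v := by
    refine (congrArg₂ (fun a b => a + nablaZero Ω D (fun y N => MvPowerSeries.C (g y N)) x v + b)
      (hb _) (hb _)).trans ?_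
    rw [zero_add, add_zero]
  rw [h]
  ext1 N
  ext m
  have h0 : matrixDer (christoffel D x v) (MvPowerSeries.C (g x N)) = 0 := by
    simp only [matrixDer_apply, pd_C, mul_zero, smul_zero, Finset.sum_const_zero]
  rw [nablaZero, h0, sub_zero, coeff_coeffDeriv, Weyl.const_apply]
  simp only [localRep, linSubst_C, MvPowerSeries.coeff_C]
  split_ifs
  · rfl
  · exact dirDeriv_const v 0

end Manifold

/-! ### Logarithmic derivatives and vanishing first cohomology. -/

section Manifold

variable {d : ℕ} {M : Type u} [TopologicalSpace M] [ChartedSpace (Eu d) M]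
  [IsManifold 𝓘(ℝ, Eu d) ∞ M] {Ω : SymplecticForm d M}

theorem SmoothAt.smul {c : M → ℂ} {s : RawSection d M} {x : M}
    (hc : ContMDiffAt 𝓘(ℝ, Eu d) 𝓘(ℝ, ℂ) ∞ c x) (hs : SmoothAt s x) :
    SmoothAt (fun y N => c y • s y N) x := fun N =>
  (CoeffSmoothAt.smul hc (hs N)).congr
    (Filter.Eventually.of_forall fun _ => linSubst_smul _ _ _)

/-- Every section over `V` agrees near a point of `V` with a global section. -/
theorem SymplecticForm.exists_global_section [T2Space M] {V : TopologicalSpace.Opens M}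
    (σ : Ω.sections V) (x : V) :
    ∃ τ : Ω.sections ⊤, Ω.extend τ.1 =ᶠ[𝓝 (x : M)] Ω.extend σ.1 := by
  -- The closed support must lie in `V`, so that the product with `σ`, extended by zero, is smooth
  -- on all of `M`.
  obtain ⟨ρ, -, hρ⟩ := (SmoothBumpFunction.nhds_basis_tsupport (I := 𝓘(ℝ, Eu d)) (x : M)).mem_iff.1
    (V.isOpen.mem_nhds x.2)
  let c : M → ℂ := fun y => (ρ y : ℂ)
  have hc : ∀ y, ContMDiffAt 𝓘(ℝ, Eu d) 𝓘(ℝ, ℂ) ∞ c y := fun y =>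
    Complex.ofRealCLM.contDiff.contMDiff.contMDiffAt.comp y ρ.contMDiffAt
  let s : RawSection d M := fun y N => c y • Ω.extend σ.1 y N
  have hs : ∀ y, SmoothAt s y := by
    intro y
    by_cases hy : y ∈ tsupport ρ
    · exact (σ.2 y (hρ hy)).smul (hc y)
    · refine SymplecticForm.smoothAt_congr (SymplecticForm.smoothAt_zero y) ?_
      filter_upwards [notMem_tsupport_iff_eventuallyEq.1 hy] with z hz
      have h : ∀ a : FormalFun d, c z • a = 0 := fun a => by simp [c, hz]
      exact funext fun N => h _
  have htop : Ω.extend (fun y : (⊤ : TopologicalSpace.Opens M) => (s y : Weyl (Ω.poisson y)))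
      = s := funext fun y => Ω.extend_apply _ (show y ∈ (⊤ : TopologicalSpace.Opens M) from trivial)
  refine ⟨⟨fun y => (s y : Weyl (Ω.poisson y)), fun y _ =>
    (congrArg (SmoothAt · y) htop).mpr (hs y)⟩, htop.eventuallyEq.trans ?_⟩
  filter_upwards [ρ.eventuallyEq_one] with y hy
  have h : ∀ a : FormalFun d, c y • a = a := fun a => by simp [c, hy]
  exact funext fun N => h _

/-- A central section with coefficients smooth on `V`. -/
def SymplecticForm.constSection (Ω : SymplecticForm d M)
    (V : TopologicalSpace.Opens M) (g : M → ℕ → ℂ)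
    (hg : ∀ x ∈ V, ∀ N, ContMDiffAt 𝓘(ℝ, Eu d) 𝓘(ℝ, ℂ) ∞ (fun y => g y N) x) : Ω.sections V :=
  ⟨fun x => Weyl.const (g x), fun x hx =>
    SymplecticForm.smoothAt_congr (smoothAt_const (hg x hx)) (by
      filter_upwards [V.isOpen.mem_nhds hx] with y hy
      exact Ω.extend_apply _ hy)⟩

namespace FedosovConnection

variable (F : FedosovConnection Ω) {V : TopologicalSpace.Opens M}

/-- Extends flatness from global to local sections: `∇∇` at `x` depends only on the germ, and every
germ comes from a global section. -/
theorem flat_section [T2Space M] (σ : Ω.sections V) (x : V)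
    (v w : TangentSpace 𝓘(ℝ, Eu d) (x : M)) :
    nabla Ω F.conn F.pert
        (fun x' => nabla Ω F.conn F.pert (Ω.extend σ.1) x' (coordField (x : M) w x')) x v
      - nabla Ω F.conn F.pert
        (fun x' => nabla Ω F.conn F.pert (Ω.extend σ.1) x' (coordField (x : M) v x')) x w = 0 := by
  obtain ⟨τ, hτ⟩ := Ω.exists_global_section σ x
  have h : ∀ u : TangentSpace 𝓘(ℝ, Eu d) (x : M),
      (fun x' => nabla Ω F.conn F.pert (Ω.extend σ.1) x' (coordField (x : M) u x') : RawSection d M)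
        =ᶠ[𝓝 (x : M)]
      fun x' => nabla Ω F.conn F.pert (Ω.extend τ.1) x' (coordField (x : M) u x') := fun u =>
    hτ.eventuallyEq_nhds.mono fun y hy => (nabla_congr _ hy).symm
  rw [nabla_congr v (h w), nabla_congr w (h v)]
  exact F.flat τ.1 τ.2 x v w

/-- The logarithmic derivative `U⁻¹ ∇ U`. -/
def logDeriv (U : (Ω.sections V)ˣ) (x : V) (v : TangentSpace 𝓘(ℝ, Eu d) (x : M)) :
    Weyl (Ω.poisson (x : M)) :=
  (↑U⁻¹ : Ω.sections V).1 x * F.deriv (U : Ω.sections V) x v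

theorem deriv_eq_mul_logDeriv (U : (Ω.sections V)ˣ) (x : V)
    (v : TangentSpace 𝓘(ℝ, Eu d) (x : M)) :
    F.deriv (U : Ω.sections V) x v = (U : Ω.sections V).1 x * F.logDeriv U x v := by
  rw [logDeriv, ← mul_assoc, Ω.units_mul_inv_apply, one_mul]

theorem IsEquivariant.isConst_logDeriv {F : FedosovConnection Ω} {U : (Ω.sections V)ˣ}
    (hU : F.IsEquivariant U) (x : V) (v : TangentSpace 𝓘(ℝ, Eu d) (x : M)) :
    Weyl.IsConst (F.logDeriv U x v) := by
  have h := hU x v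
  rw [F.deriv_inv_mul, neg_mem_iff] at h
  exact SymplecticForm.mem_center_poisson_iff.1 h

theorem logDeriv_eq_sum (U : (Ω.sections V)ˣ) (x : V) (v : TangentSpace 𝓘(ℝ, Eu d) (x : M)) :
    F.logDeriv U x v = ∑ i, (show Eu d from v) i • F.logDeriv U x (basisVec i) := by
  have h : F.deriv (U : Ω.sections V) x v
      = ∑ i, (show Eu d from v) i • F.deriv (U : Ω.sections V) x (basisVec i) := by
    ext1 N
    refine (nabla_eq_sum _ _ v N).trans ?_
    exact (Weyl.sum_apply (fun i => (show Eu d from v) i •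
      F.deriv (U : Ω.sections V) x (basisVec i)) N).symm
  rw [logDeriv, h, Finset.mul_sum]
  exact Finset.sum_congr rfl fun i _ => Weyl.mul_smul' _ _ _

open Classical in
/-- The coefficient of `ħ ^ N` of `U⁻¹ ∇ U` when this is central, extended by zero. -/
def logForm (U : (Ω.sections V)ˣ) (N : ℕ) (x : M) : TangentSpace 𝓘(ℝ, Eu d) x →L[ℝ] ℂ :=
  if h : x ∈ V then
    ∑ i, (ContinuousLinearMap.toSpanSingleton ℝ
      (MvPowerSeries.coeff 0 (F.logDeriv U ⟨x, h⟩ (basisVec i) N))).comp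
      (EuclideanSpace.proj i : Eu d →L[ℝ] ℝ)
  else 0

theorem logForm_apply (U : (Ω.sections V)ˣ) (N : ℕ) (x : V)
    (v : TangentSpace 𝓘(ℝ, Eu d) (x : M)) :
    F.logForm U N x v = MvPowerSeries.coeff 0 (F.logDeriv U x v N) := by
  have h : F.logForm U N (x : M) = ∑ i, (ContinuousLinearMap.toSpanSingleton ℝ
      (MvPowerSeries.coeff 0 (F.logDeriv U x (basisVec i) N))).comp
      (EuclideanSpace.proj i : Eu d →L[ℝ] ℝ) := dif_pos x.2
  have h2 : F.logDeriv U x v N = ∑ i, (show Eu d from v) i • F.logDeriv U x (basisVec i) N :=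
    (congrFun (F.logDeriv_eq_sum U x v) N).trans (Weyl.sum_apply _ N)
  have hs : ∀ (g : Fin d → Eu d →L[ℝ] ℂ) (u : Eu d), (∑ i, g i) u = ∑ i, g i u :=
    fun g u => sum_apply _ _ _
  rw [h, h2, map_sum]
  refine (hs _ v).trans (Finset.sum_congr rfl fun i _ => ?_)
  rfl

theorem contMDiffAt_logForm [T2Space M] (U : (Ω.sections V)ˣ) (N : ℕ) (x : V) (w : Eu d) :
    ContMDiffAt 𝓘(ℝ, Eu d) 𝓘(ℝ, ℂ) ∞ (fun y => F.logForm U N y (coordField (x : M) w y)) x := by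
  have h1 : SmoothAt (fun y => nabla Ω F.conn F.pert (Ω.extend (U : Ω.sections V).1) y
      (coordField (x : M) w y)) (x : M) := by
    refine smoothAt_nabla Ω F.conn F.pert F.conn_smooth F.pert_smooth ?_ w
    filter_upwards [V.isOpen.mem_nhds x.2] with y hy
    exact (U : Ω.sections V).2 y hy
  have h2 := Ω.smoothAt_rawMul ((↑U⁻¹ : Ω.sections V).2 x x.2) h1 N 0
  refine h2.congr_of_eventuallyEq ?_
  filter_upwards [V.isOpen.mem_nhds x.2] with y hy
  rw [F.logForm_apply U N ⟨y, hy⟩, localRep, coeff_zero_linSubst]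
  exact congrArg (fun a : Weyl (Ω.poisson y) => MvPowerSeries.coeff 0
    ((a * nabla Ω F.conn F.pert (Ω.extend (U : Ω.sections V).1) y (coordField (x : M) w y)) N))
    (Ω.extend_apply _ hy).symm

/-- With `∇U = U α` and `α` central, `∇_v ∇_w U = U α(v) α(w) + U ∂_v(α(w))` along coordinate
fields. After antisymmetrization the products cancel, and flatness leaves `U dα = 0`. -/
theorem closed_logForm [T2Space M] {U : (Ω.sections V)ˣ} (hU : F.IsEquivariant U) (N : ℕ) (x : V)
    (v w : TangentSpace 𝓘(ℝ, Eu d) (x : M)) :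
    dirDeriv (fun y => F.logForm U N y (coordField (x : M) w y)) (x : M) v
      - dirDeriv (fun y => F.logForm U N y (coordField (x : M) v y)) (x : M) w = 0 := by
  let g : TangentSpace 𝓘(ℝ, Eu d) (x : M) → M → ℕ → ℂ := fun u y N =>
    F.logForm U N y (coordField (x : M) u y)
  have hg : ∀ u N, ContMDiffAt 𝓘(ℝ, Eu d) 𝓘(ℝ, ℂ) ∞ (fun y => g u y N) (x : M) := fun u N =>
    F.contMDiffAt_logForm U N x u
  have hB : ∀ u : TangentSpace 𝓘(ℝ, Eu d) (x : M),
      (fun y => nabla Ω F.conn F.pert (Ω.extend (U : Ω.sections V).1) y (coordField (x : M) u y) :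
        RawSection d M) =ᶠ[𝓝 (x : M)]
      Ω.rawMul (Ω.extend (U : Ω.sections V).1) (fun y N => MvPowerSeries.C (g u y N)) := by
    intro u
    filter_upwards [V.isOpen.mem_nhds x.2] with y hy
    refine (F.deriv_eq_mul_logDeriv U ⟨y, hy⟩ _).trans ?_
    rw [SymplecticForm.rawMul, Ω.extend_apply _ hy,
      (hU.isConst_logDeriv ⟨y, hy⟩ (coordField (x : M) u y)).eq_const]
    refine congrArg ((U : Ω.sections V).1 ⟨y, hy⟩ * ·) ?_
    ext1 N
    exact congrArg MvPowerSeries.C (F.logForm_apply U N ⟨y, hy⟩ _).symm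
  have hgx : ∀ u : TangentSpace 𝓘(ℝ, Eu d) (x : M),
      (Weyl.const (g u x) : Weyl (Ω.poisson (x : M))) = F.logDeriv U x u := by
    intro u
    rw [(hU.isConst_logDeriv x u).eq_const]
    refine congrArg Weyl.const (funext fun N => ?_)
    refine (F.logForm_apply U N x _).trans ?_
    exact congrArg (fun u => MvPowerSeries.coeff 0 (F.logDeriv U x u N)) (coordField_self (x : M) u)
  have hn : ∀ u u' : TangentSpace 𝓘(ℝ, Eu d) (x : M), nabla Ω F.conn F.pert
      (fun y => nabla Ω F.conn F.pert (Ω.extend (U : Ω.sections V).1) y (coordField (x : M) u y))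
        (x : M) u' = (U : Ω.sections V).1 x * F.logDeriv U x u' * F.logDeriv U x u
          + (U : Ω.sections V).1 x * Weyl.const fun N => dirDeriv (fun y => g u y N) (x : M) u' := by
    intro u u'
    refine (nabla_congr u' (hB u)).trans ?_
    refine (nabla_mul u' F.conn_symplectic ((U : Ω.sections V).2 x x.2)
      (smoothAt_const (hg u))).trans ?_
    rw [nabla_const, Ω.extend_apply _ x.2, ← F.deriv_eq_mul_logDeriv, ← hgx u]
    rfl
  have h := F.flat_section (U : Ω.sections V) x v w
  rw [hn w v, hn v w, mul_assoc, mul_assoc,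
    mem_center_commute (hU.isConst_logDeriv x w).mem_center, add_sub_add_left_eq_sub,
    ← mul_sub] at h
  have h2 := congrArg ((↑U⁻¹ : Ω.sections V).1 x * ·) h
  simp only [← mul_assoc, Ω.units_inv_mul_apply, one_mul, mul_zero] at h2
  have h3 := congrArg (MvPowerSeries.coeff 0) (congrFun h2 N)
  rw [Weyl.sub_apply, map_sub, Weyl.const_apply, Weyl.const_apply, MvPowerSeries.coeff_zero_C,
    MvPowerSeries.coeff_zero_C] at h3
  exact h3.trans (map_zero _)

theorem deriv_constSection (g : M → ℕ → ℂ)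
    (hg : ∀ x ∈ V, ∀ N, ContMDiffAt 𝓘(ℝ, Eu d) 𝓘(ℝ, ℂ) ∞ (fun y => g y N) x) (x : V)
    (v : TangentSpace 𝓘(ℝ, Eu d) (x : M)) :
    F.deriv (Ω.constSection V g hg) x v
      = Weyl.const fun N => dirDeriv (fun y => g y N) (x : M) v := by
  refine (nabla_congr v ?_).trans (nabla_const g (x : M) v)
  filter_upwards [V.isOpen.mem_nhds x.2] with y hy
  exact Ω.extend_apply _ hy

/-- The unit is `exp (∑ f N ħ ^ N)`, with inverse the exponential of the negative. -/
theorem exists_centralUnit [T2Space M] (f : M → ℕ → ℂ)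
    (hf : ∀ x ∈ V, ∀ N, ContMDiffAt 𝓘(ℝ, Eu d) 𝓘(ℝ, ℂ) ∞ (fun y => f y N) x) :
    ∃ z ∈ centralUnits (Ω.sections V), ∀ (x : V) (v : TangentSpace 𝓘(ℝ, Eu d) (x : M)),
      F.deriv (z : Ω.sections V) x v = (z : Ω.sections V).1 x *
        Weyl.const fun N => dirDeriv (fun y => f y N) (x : M) v := by
  have hf' : ∀ x ∈ V, ∀ N, ContMDiffAt 𝓘(ℝ, Eu d) 𝓘(ℝ, ℂ) ∞ (fun y => (-f) y N) x :=
    fun x hx N => (hf x hx N).neg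
  let z : (Ω.sections V)ˣ :=
    { val := Ω.constSection V _ fun x hx => contMDiffAt_expCoeff (hf x hx)
      inv := Ω.constSection V _ fun x hx => contMDiffAt_expCoeff (hf' x hx)
      val_inv := Subtype.ext (funext fun x => by
        refine (Weyl.const_mul _ _).trans ?_
        rw [Pi.neg_apply, expCoeff_mul_neg]
        exact Weyl.const_coeff_one)
      inv_val := Subtype.ext (funext fun x => by
        refine (Weyl.const_mul _ _).trans ?_
        rw [mul_comm, Pi.neg_apply, expCoeff_mul_neg]
        exact Weyl.const_coeff_one) }
  refine ⟨z, ⟨?_, ?_⟩, fun x v => ?_⟩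
  · exact (F.mem_center_sections_iff _).2 fun x => Weyl.isConst_const _
  · exact (F.mem_center_sections_iff _).2 fun x => Weyl.isConst_const _
  · refine (F.deriv_constSection _ _ x v).trans ?_
    refine Eq.trans ?_ (Weyl.const_mul _ _).symm
    refine congrArg Weyl.const (funext fun N => ?_)
    rw [mul_comm, ← dirDeriv_expCoeff v (hf x x.2), PowerSeries.coeff_mk]

/-- Each coefficient of `ħ` in the logarithmic derivative of `U` has a primitive; exponentiating
them gives a central `z` with the same logarithmic derivative, so `U` and `z` differ by a flat unit.
-/
theorem mem_equivarianceGroup_iff_of_vanishes [T2Space M] (V : TopologicalSpace.Opens M)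
    (hV : FirstDeRhamVanishes (d := d) V) (U : (Ω.sections V)ˣ) :
    U ∈ F.equivarianceGroup V ↔
      ∃ z ∈ centralUnits (Ω.sections V), ∃ k ∈ F.flatUnits V, U = z * k := by
  constructor
  · intro hU
    choose f hf hdf using fun N => hV (F.logForm U N)
      (fun x hx w => F.contMDiffAt_logForm U N ⟨x, hx⟩ w)
      (fun x hx v w => F.closed_logForm hU N ⟨x, hx⟩ v w)
    obtain ⟨z, hz, hzd⟩ := F.exists_centralUnit (fun y N => f N y) fun x hx N => hf N x hx
    have hzd' : ∀ (x : V) (v : TangentSpace 𝓘(ℝ, Eu d) (x : M)),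
        F.deriv (z : Ω.sections V) x v = (z : Ω.sections V).1 x * F.logDeriv U x v := by
      intro x v
      rw [hzd, (hU.isConst_logDeriv x v).eq_const]
      refine congrArg ((z : Ω.sections V).1 x * ·) (congrArg Weyl.const (funext fun N => ?_))
      exact (hdf N x x.2 v).trans (F.logForm_apply U N x v)
    -- Symmetric in the two units, since a flat unit requires both `U z⁻¹` and its inverse `z U⁻¹`
    -- to be flat.
    have hk : ∀ U₁ U₂ : (Ω.sections V)ˣ, (∀ (x : V) (v : TangentSpace 𝓘(ℝ, Eu d) (x : M)),
        F.deriv (U₁ : Ω.sections V) x v = (U₁ : Ω.sections V).1 x * F.logDeriv U x v) →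
        (∀ (x : V) (v : TangentSpace 𝓘(ℝ, Eu d) (x : M)),
        F.deriv (U₂ : Ω.sections V) x v = (U₂ : Ω.sections V).1 x * F.logDeriv U x v) →
        ((U₁ * U₂⁻¹ : (Ω.sections V)ˣ) : Ω.sections V) ∈ F.kernel V := by
      intro U₁ U₂ h₁ h₂ x v
      have h3 := F.deriv_mul ((U₁ * U₂⁻¹ : (Ω.sections V)ˣ) : Ω.sections V) U₂ x v
      rw [← Units.val_mul, inv_mul_cancel_right, h₁, h₂] at h3
      have h4 : (U₁ : Ω.sections V).1 x
          = ((U₁ * U₂⁻¹ : (Ω.sections V)ˣ) : Ω.sections V).1 x * (U₂ : Ω.sections V).1 x := by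
        conv_lhs => rw [← inv_mul_cancel_right U₁ U₂]
        rfl
      rw [h4, mul_assoc] at h3
      have h5 := congrArg (· * (↑U₂⁻¹ : Ω.sections V).1 x) (right_eq_add.1 h3)
      simpa only [mul_assoc, Ω.units_mul_inv_apply, mul_one, zero_mul] using h5
    have hU' := F.deriv_eq_mul_logDeriv U
    have hc : U * z⁻¹ = z⁻¹ * U := Units.ext (mem_center_commute hz.2 _)
    refine ⟨z, hz, z⁻¹ * U, ⟨?_, ?_⟩, (mul_inv_cancel_left z U).symm⟩
    · rw [← hc]
      exact hk U z hU' hzd'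
    · change (((z⁻¹ * U)⁻¹ : (Ω.sections V)ˣ) : Ω.sections V) ∈ F.kernel V
      rw [← hc, mul_inv_rev, inv_inv]
      exact hk z U hzd' hU'
  · rintro ⟨z, hz, k, hk, rfl⟩
    exact mul_mem (F.centralUnits_le V hz) (F.flatUnits_le V hk)

end FedosovConnection

end Manifold

end Fedosov

end

/-- The membership condition determines `𝒢` uniquely, so the existential form makes closure under
the group operations part of the assertion. -/
theorem mainTheorem6 {n : ℕ} {M : Type u} [TopologicalSpace M] [T2Space M]
    [SecondCountableTopology M] [ChartedSpace (EuclideanSpace ℝ (Fin (2 * n))) M]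
    [IsManifold 𝓘(ℝ, EuclideanSpace ℝ (Fin (2 * n))) ∞ M]
    (Ω : SymplecticForm (2 * n) M) (F : FedosovConnection Ω) :
    ∃ 𝒢 : ∀ V : TopologicalSpace.Opens M, Subgroup (Ω.sections V)ˣ,
      (∀ (V : TopologicalSpace.Opens M) (U : (Ω.sections V)ˣ), U ∈ 𝒢 V ↔ F.IsEquivariant U) ∧
      (∀ V : TopologicalSpace.Opens M,
        (centralUnits (Ω.sections V) ≤ 𝒢 V ∧
          ((centralUnits (Ω.sections V)).subgroupOf (𝒢 V)).Normal) ∧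
        (F.flatUnits V ≤ 𝒢 V ∧ ((F.flatUnits V).subgroupOf (𝒢 V)).Normal)) ∧
      (∀ V : TopologicalSpace.Opens M,
        ∃ (_ : ((centralUnits (Ω.sections V)).subgroupOf (𝒢 V)).Normal)
          (e : (𝒢 V ⧸ (centralUnits (Ω.sections V)).subgroupOf (𝒢 V)) ≃* relInner (F.kernel V)),
          ∀ U : 𝒢 V, (e (QuotientGroup.mk U) : RingAut (Ω.sections V)) =
            Ad (Ω.sections V) (U : (Ω.sections V)ˣ)) ∧
      (∃ h : ∀ {V V' : TopologicalSpace.Opens M} (i : V' ⟶ V),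
          ∀ U ∈ 𝒢 V, Ω.unitsPresheaf.map i.op U ∈ 𝒢 V',
        (subgroupPresheaf Ω.unitsPresheaf 𝒢 h).IsSheaf) ∧
      (∀ V : TopologicalSpace.Opens M, FirstDeRhamVanishes (d := 2 * n) V →
        ∀ U : (Ω.sections V)ˣ,
        U ∈ 𝒢 V ↔ ∃ z ∈ centralUnits (Ω.sections V), ∃ k ∈ F.flatUnits V, U = z * k) ∧
      (∀ (Γ : Type v) [Group Γ] [MulAction Γ M]
        (hΓ : ∀ γ : Γ, Ω.IsSymplecticMap (fun x : M => γ • x))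
        (A : Γᵐᵒᵖ →* RingAut (F.kernel ⊤)),
        (∀ γ : Γ, ∃ U : (Ω.sections ⊤)ˣ, F.IsAdPullback (hΓ γ) (A (MulOpposite.op γ)) U) →
        ∀ (γ : Γ) (U : (Ω.sections ⊤)ˣ), F.IsAdPullback (hΓ γ) (A (MulOpposite.op γ)) U →
          ∀ g ∈ 𝒢 ⊤, U * Units.map (hΓ γ).pullback.toMonoidHom g * U⁻¹ ∈ 𝒢 ⊤) := by
  refine ⟨F.equivarianceGroup, fun V U => F.mem_equivarianceGroup, fun V => ⟨⟨F.centralUnits_le V,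
    FedosovConnection.centralUnits_normal _⟩, F.flatUnits_le V, F.flatUnits_normal V⟩,
    F.exists_quotient_equiv, ⟨fun i U hU => hU.restrict (CategoryTheory.leOfHom i),
    F.isSheaf_equivarianceGroup _⟩, F.mem_equivarianceGroup_iff_of_vanishes, ?_⟩
  intro Γ _ _ hΓ A _ γ U hU g hg
  exact F.conj_pullback_mem (hΓ γ) _ hU hg
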